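/- **Setting.** Let $\Omega\subset\mathbb R^2$ be the interior of the closure of the union of a finite set $G^0$ of open squares of a uniform axis-parallel grid, and for $\ell\ge 1$ let $G^\ell$ be obtained from $G^{\ell-1}$ by dividing each square into four equal ones. A *partition* $P$ of $\Omega$ is a finite set of pairwise disjoint cells $\tau\in\bigcup_\ell G^\ell$ such that the interior of the closure of $\bigcup_{\tau\in P}\tau$ is $\Omega$; for such $P$ let $\Omega^\ell$ be the union of the closures of the cells of $P$ of level at least $\ell$. *Splines.* Fix a degree $r\ge2$. Let $b^0=\mathbf 1_{[0,1)}$, $b^k(x)=\int_0^1 b^{k-1}(x-t)\,dt$, and let $\mathcal B^\ell$ be the set of restrictions to $\Omega$, as far as they do not vanish identically, of the tensor-product B-splines generated by $b^r$ on the grid of level $\ell$; supports are supports of functions on $\Omega$. Let $\mathcal H_P$ be the set of all $\beta\in\mathcal B^\ell$, $\ell\ge0$, with $\operatorname{supp}\beta\subseteq\Omega^\ell$ and $\operatorname{supp}\beta\not\subseteq\Omega^{\ell+1}$. For a spline $s$ of level $\ell$, with level-$(\ell+1)$ expansion $s=\sum_{\beta\in\mathcal B^{\ell+1}}c_\beta\beta$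 given by the two-scale relation, put $\operatorname{trunc}^{\ell+1}s=\sum_{\operatorname{supp}\beta\not\subseteq\Omega^{\ell+1}}c_\beta\beta$. The truncated basis $\mathcal T_P$ consists of the functions $\operatorname{trunc}^{L}(\cdots(\operatorname{trunc}^{\ell+1}\beta))$, $\beta\in\mathcal H_P\cap\mathcal B^\ell$, where $L$ is the largest level of a cell of $P$. $P$ is *admissible* if for every $\tau\in P$ the functions of $\mathcal T_P$ that do not vanish identically on $\tau$ belong to at most two successive levels. For $\tau\in P$ let $\omega_\tau$ be the interior of the closure of the union of all $\tau'\in P$ such that some function of $\mathcal T_P$ vanishes identically neither on $\tau$ nor on $\tau'$. *Refinement.* For a cell $\tau$ let $S(\tau,k)$ be the set of all $\tau'\in G^k$ for which some $\beta\in\mathcal B^k$ has a support meeting both $\tau$ and $\tau'$. $P$ is *strictly admissible* if for every $\ell\ge1$ the set $\Omega^{\ell+1}$ is contained in the union of the closures of all $\tau\in G^{\ell}$ such that every cell of $S(\tau,\ell)$ is contained in $\Omega^{\ell}$; the initial mesh $G^0$ is an example. For $\tau\in G^\ell$ let $\mathcal N(P,\tau)=\{\tau'\in P\cap G^{\ell-1}:\exists\,\tau''\in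 S(\tau,\ell),\ \tau''\subseteq\tau'\}$ if $\ell\ge1$, and $\mathcal N(P,\tau)=\emptyset$ if $\ell=0$. The recursive refinement of $\tau$ in $P$ first applies recursive refinement successively to all $\tau'\in\mathcal N(P,\tau)$ and then, if $\tau$ still belongs to the partition, replaces $\tau$ by its four children. $\mathrm{REFINE}(P,\mathcal M)$ applies recursive refinement successively to all $\tau\in\mathcal M$. All loops may be run in any order. *Besov seminorm.* Fix an integer $m\ge1$. For open $G\subseteq\Omega$ let $\omega_m(f,t,G)_p=\sup_{|h|\le t}\|\Delta_h^m f\|_{L^p(G_{mh})}$ with $G_{mh}=\{x:[x,x+mh]\subseteq G\}$, where $[x,x+mh]$ is the line segment, and let $$|f|_{B^\alpha_{p,p}(G)}=\Big(\int_0^\infty \big(t^{-\alpha-1/p}\,\omega_m(f,t,G)_p\big)^p\,dt\Big)^{1/p};$$ $v\in B^\alpha_{p,p}(\Omega)$ means $v\in L^p(\Omega)$ and $|v|_{B^\alpha_{p,p}(\Omega)}<\infty$. **Lemma (adaptive procedure, due to Binev).** Let $\alpha\ge0$, $0<p<\infty$, $\delta>0$, and let $P_0$ be a strictly admissible partition of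 $\Omega$. For a partition $P$ and $\tau\in P$ let $$e(\tau,P)=|\tau|^\delta\,|v|_{B^\alpha_{p,p}(\omega)},$$ where either $\omega=\tau$ throughout or $\omega=\omega_\tau$ throughout. There is a constant $C>0$, depending only on $\Omega,G^0,P_0,r,m,\alpha,p,\delta$ and on the choice of $\omega$, such that for all $v\in B^\alpha_{p,p}(\Omega)$ and all $\varepsilon>0$ the following holds. Starting from $P_0$, the procedure which, as long as $\mathcal M_\ell=\{\tau\in P_\ell:e(\tau,P_\ell)>\varepsilon\}$ is nonempty, sets $P_{\ell+1}=\mathrm{REFINE}(P_\ell,\mathcal M_\ell)$, terminates after finitely many steps, and its final $P$ is an admissible partition of $\Omega$ with $$\sum_{\tau\in P}e(\tau,P)^2\le C\,\#P\,\varepsilon^2\qquad\text{and}\qquad \#P-\#P_0\le C\,|v|_{B^\alpha_{p,p}(\Omega)}^{p/(1+\delta p)}\,\varepsilon^{-p/(1+\delta p)}.$$ -/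

import Mathlib

open Set MeasureTheory
open scoped ENNReal

noncomputable section

namespace AdaptiveSpline

/-- The Euclidean plane. -/
abbrev Plane : Type := EuclideanSpace ℝ (Fin 2)

/-! ### Besov seminorms -/

/-- The set `G_{mh}` of the points `x` for which the whole segment `[x, x + m h]` lies in `G`. -/
def diffDomain (m : ℕ) (h : Plane) (G : Set Plane) : Set Plane :=
  {x | segment ℝ x (x + m • h) ⊆ G}

/-- The modulus of smoothness `ω_m(f, t)_p = sup_{|h| ≤ t} ‖Δ_h^m f‖_{L^p(G_{mh})}`. -/
def modulus (m : ℕ) (p : ℝ≥0∞) (f : Plane → ℝ) (G : Set Plane) (t : ℝ) : ℝ≥0∞ :=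
  ⨆ (h : Plane) (_ : ‖h‖ ≤ t), eLpNorm ((fwdDiff h)^[m] f) p (volume.restrict (diffDomain m h G))

/-- The seminorm `|f|_{B^α_{q,p;m}(G)} = ‖t ↦ t^{-α-1/q} ω_m(f, t)_p‖_{L^q(0,∞)}`,
possibly infinite. -/
def besovSeminorm (α : ℝ) (q p : ℝ≥0∞) (m : ℕ) (f : Plane → ℝ) (G : Set Plane) : ℝ≥0∞ :=
  eLpNorm (fun t : ℝ => ENNReal.ofReal (t ^ (-α - 1 / q.toReal)) * modulus m p f G t) q
    (volume.restrict (Ioi 0))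

/-- Membership in the Besov space `B^α_{q,p;m}(G)`. -/
def MemBesov (α : ℝ) (q p : ℝ≥0∞) (m : ℕ) (f : Plane → ℝ) (G : Set Plane) : Prop :=
  MemLp f p (volume.restrict G) ∧ besovSeminorm α q p m f G < ∞

/-! ### The dyadic hierarchy of meshes -/

/-- A cell, given by its level and its integer position in the uniform grid of that level. -/
structure Cell where
  level : ℕ
  pos : Fin 2 → ℤ
deriving DecidableEq

/-- An initial mesh: finitely many squares of a uniform grid in the plane with mesh width `h₀`. -/
structure GridDomain where
  origin : Plane
  h₀ : ℝ
  h₀_pos : 0 < h₀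
  base : Finset (Fin 2 → ℤ)

variable (D : GridDomain)

/-- Side length of the cells of level `ℓ`. -/
def side (ℓ : ℕ) : ℝ := D.h₀ / 2 ^ ℓ

/-- The open square represented by a cell. -/
def cellSet (τ : Cell) : Set Plane :=
  {x | ∀ i, side D τ.level * τ.pos i < x i - D.origin i ∧
    x i - D.origin i < side D τ.level * (τ.pos i + 1)}

/-- The domain `Ω`: the interior of the closure of the union of the initial squares. -/
def domain : Set Plane := interior (closure (⋃ k ∈ D.base, cellSet D ⟨0, k⟩))

/-- The uniform mesh `G^ℓ`, obtained from the initial mesh by `ℓ` uniform dyadic subdivisions: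
the cells of level `ℓ` whose ancestor of level `0` is one of the initial squares. -/
def grid (ℓ : ℕ) : Set Cell := {τ | τ.level = ℓ ∧ (fun i => τ.pos i / 2 ^ ℓ) ∈ D.base}

/-- The initial mesh `G^0` as a set of cells. -/
def initialMesh : Finset Cell := D.base.image (fun k => ⟨0, k⟩)

/-- Hierarchical partitions of `Ω`. -/
def IsPartition (P : Finset Cell) : Prop :=
  (∀ τ ∈ P, τ ∈ grid D τ.level) ∧
  (∀ τ ∈ P, ∀ τ' ∈ P, τ ≠ τ' → Disjoint (cellSet D τ) (cellSet D τ')) ∧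
  interior (closure (⋃ τ ∈ P, cellSet D τ)) = domain D

/-- The closed subdomain `Ω^ℓ` of a partition: the part covered by cells of level at least `ℓ`. -/
def subdomain (P : Finset Cell) (ℓ : ℕ) : Set Plane :=
  ⋃ τ ∈ P, ⋃ (_ : ℓ ≤ τ.level), closure (cellSet D τ)

/-! ### B-splines and the truncated hierarchical basis -/

/-- The cardinal B-spline of degree `k`, by repeated convolution with `1_{[0,1)}`. -/
def cardinalBSpline : ℕ → ℝ → ℝ
  | 0 => (Ico (0 : ℝ) 1).indicator 1
  | k + 1 => fun x => ∫ t in (0 : ℝ)..1, cardinalBSpline k (x - t)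

/-- Coefficients of the two-scale relation of the cardinal B-spline of degree `r`. -/
def mask (r : ℕ) (n : ℤ) : ℝ := if 0 ≤ n then ((r + 1).choose n.toNat : ℝ) / 2 ^ r else 0

theorem cardinalBSpline_bounds (k : ℕ) : Measurable (cardinalBSpline k) ∧
    ∀ x, ‖cardinalBSpline k x‖ ≤ 1 := by
  induction k with
  | zero =>
    refine ⟨measurable_one.indicator measurableSet_Ico, fun x => ?_⟩
    simp only [cardinalBSpline]
    by_cases h : x ∈ Ico (0 : ℝ) 1 <;> simp [h]
  | succ k ih =>
    constructor
    · simp only [cardinalBSpline]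
      have : StronglyMeasurable (fun q : ℝ × ℝ => cardinalBSpline k (q.1 - q.2)) :=
        (ih.1.comp (measurable_fst.sub measurable_snd)).stronglyMeasurable
      simp only [intervalIntegral.integral_of_le zero_le_one]
      exact (this.integral_prod_right (ν := volume.restrict (Ioc (0 : ℝ) 1))).measurable
    · intro x
      simp only [cardinalBSpline]
      simpa using intervalIntegral.norm_integral_le_of_norm_le_const (a := (0 : ℝ)) (b := 1)
        (f := fun t => cardinalBSpline k (x - t)) (C := 1) (fun t _ => ih.2 _)

theorem cardinalBSpline_integrable (k : ℕ) (g : ℝ → ℝ) (hg : Measurable g) (a b : ℝ) :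
    IntervalIntegrable (fun t => cardinalBSpline k (g t)) volume a b := by
  refine (intervalIntegrable_const (c := (1 : ℝ))).mono_fun
    (((cardinalBSpline_bounds k).1.comp hg).aestronglyMeasurable) ?_
  filter_upwards with t
  simpa using (cardinalBSpline_bounds k).2 (g t)

/-- The two-scale relation of the cardinal B-splines, which `mask` records. -/
theorem cardinalBSpline_two_scale (k : ℕ) (x : ℝ) :
    cardinalBSpline k x =
      ∑ j ∈ Finset.range (k + 2), mask k j * cardinalBSpline k (2 * x - j) := by
  have hm : ∀ k j : ℕ, mask k (j : ℤ) = ((k + 1).choose j : ℝ) / 2 ^ k := by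
    intro k j; simp [mask]
  simp only [hm]
  induction k generalizing x with
  | zero =>
    simp only [cardinalBSpline, Finset.sum_range_succ, Finset.sum_range_zero]
    simp only [Set.indicator, mem_Ico, Pi.one_apply]
    norm_num
    split_ifs <;> first | (norm_num; done) | (exfalso; grind)
  | succ k ih =>
    have step : ∀ y : ℝ, ∫ t in (0 : ℝ)..1, cardinalBSpline k (y - 2 * t) =
        (cardinalBSpline (k + 1) y + cardinalBSpline (k + 1) (y - 1)) / 2 := by
      intro y
      have h1 := intervalIntegral.integral_comp_mul_left (a := (0 : ℝ)) (b := 1)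
        (fun s => cardinalBSpline k (y - s)) (c := 2) two_ne_zero
      rw [h1, mul_zero, mul_one, ← intervalIntegral.integral_add_adjacent_intervals
        (cardinalBSpline_integrable k (fun s => y - s) (by fun_prop) 0 1)
        (cardinalBSpline_integrable k (fun s => y - s) (by fun_prop) 1 2)]
      have h2 : ∫ s in (0 : ℝ)..1, cardinalBSpline k (y - 1 - s) =
          ∫ s in (1 : ℝ)..2, cardinalBSpline k (y - s) := by
        have h := intervalIntegral.integral_comp_add_right (a := (0 : ℝ)) (b := 1)
          (fun s => cardinalBSpline k (y - s)) 1
        rw [zero_add, one_add_one_eq_two] at h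
        rw [← h]
        refine intervalIntegral.integral_congr fun t _ => ?_
        exact congrArg (cardinalBSpline k) (by ring)
      rw [← h2]
      simp only [cardinalBSpline, smul_eq_mul]
      ring
    have e1 : cardinalBSpline (k + 1) x = ∑ j ∈ Finset.range (k + 2),
        ((k + 1).choose j : ℝ) / 2 ^ k * ((cardinalBSpline (k + 1) (2 * x - j) +
          cardinalBSpline (k + 1) (2 * x - j - 1)) / 2) := by
      change ∫ t in (0 : ℝ)..1, cardinalBSpline k (x - t) = _
      rw [intervalIntegral.integral_congr (fun t _ => ih (x - t))]
      rw [intervalIntegral.integral_finsetSum]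
      · refine Finset.sum_congr rfl fun j _ => ?_
        rw [intervalIntegral.integral_const_mul, ← step]
        congr 1
        exact intervalIntegral.integral_congr fun t _ => congrArg (cardinalBSpline k) (by ring)
      · intro j _
        exact (cardinalBSpline_integrable k (fun t => 2 * (x - t) - j) (by fun_prop) 0 1).const_mul _
    rw [e1, Finset.sum_range_succ' _ (k + 2)]
    have e2 : ∀ j : ℕ, ((k + 1 + 1).choose (j + 1) : ℝ) =
        (k + 1).choose j + (k + 1).choose (j + 1) := by
      intro j; rw [Nat.choose_succ_succ]; push_cast; ring
    have e3 : ∑ j ∈ Finset.range (k + 2), ((k + 1).choose j : ℝ) *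
          cardinalBSpline (k + 1) (2 * x - j) =
        ∑ j ∈ Finset.range (k + 2), ((k + 1).choose (j + 1) : ℝ) *
          cardinalBSpline (k + 1) (2 * x - (j + 1 : ℕ)) + cardinalBSpline (k + 1) (2 * x) := by
      rw [Finset.sum_range_succ' _ (k + 1), Finset.sum_range_succ _ (k + 1)]
      simp
    have e4 : ∀ j : ℕ, 2 * x - j - 1 = 2 * x - (j + 1 : ℕ) := by
      intro j; push_cast; ring
    simp only [e2, e4, add_div, add_mul, mul_add, Finset.sum_add_distrib]
    have l : ∀ (c : ℕ → ℝ) (g : ℕ → ℝ), ∑ j ∈ Finset.range (k + 2), c j / 2 ^ k * (g j / 2) =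
        (∑ j ∈ Finset.range (k + 2), c j * g j) / 2 ^ (k + 1) := by
      intro c g
      rw [Finset.sum_div]
      refine Finset.sum_congr rfl fun j _ => ?_
      rw [pow_succ]; field_simp
    have l' : ∀ (c : ℕ → ℝ) (g : ℕ → ℝ), ∑ j ∈ Finset.range (k + 2), c j / 2 ^ (k + 1) * g j =
        (∑ j ∈ Finset.range (k + 2), c j * g j) / 2 ^ (k + 1) := by
      intro c g
      rw [Finset.sum_div]
      refine Finset.sum_congr rfl fun j _ => ?_
      field_simp
    rw [l (fun j => ((k + 1).choose j : ℝ)) (fun j => cardinalBSpline (k + 1) (2 * x - j)),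
      l (fun j => ((k + 1).choose j : ℝ)) (fun j => cardinalBSpline (k + 1) (2 * x - (j + 1 : ℕ))),
      l' (fun j => ((k + 1).choose j : ℝ)) (fun j => cardinalBSpline (k + 1) (2 * x - (j + 1 : ℕ))),
      l' (fun j => ((k + 1).choose (j + 1) : ℝ))
        (fun j => cardinalBSpline (k + 1) (2 * x - (j + 1 : ℕ))), e3]
    simp
    ring

variable (r : ℕ)

/-- The tensor-product B-spline of degree `r`, level `ℓ` and position `k`. The basis `B^ℓ` consists
of the restrictions to `Ω` of those which do not vanish identically on `Ω`. -/
def bspline (ℓ : ℕ) (k : Fin 2 → ℤ) (x : Plane) : ℝ :=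
  ∏ i, cardinalBSpline r ((x i - D.origin i) / side D ℓ - k i)

/-- The support of a B-spline as a function on `Ω` (empty if it vanishes identically there). -/
def bsupp (ℓ : ℕ) (k : Fin 2 → ℤ) : Set Plane :=
  closure {x | x ∈ domain D ∧ bspline D r ℓ k x ≠ 0}

/-- The spline of level `ℓ` with the B-spline coefficients `c`. -/
def spline (ℓ : ℕ) (c : (Fin 2 → ℤ) → ℝ) (x : Plane) : ℝ := ∑ᶠ k, c k * bspline D r ℓ k x

/-- The coefficients of a spline with respect to the B-splines of the next level. -/
def refineCoeff (c : (Fin 2 → ℤ) → ℝ) (k : Fin 2 → ℤ) : ℝ :=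
  ∑ᶠ j : Fin 2 → ℤ, c j * ∏ i, mask r (k i - 2 * j i)

/-- `IsActive P ℓ k`: the B-spline of level `ℓ` and position `k` belongs to the hierarchical basis
`H_P`. -/
def IsActive (P : Finset Cell) (ℓ : ℕ) (k : Fin 2 → ℤ) : Prop :=
  bsupp D r ℓ k ⊆ subdomain D P ℓ ∧ ¬ bsupp D r ℓ k ⊆ subdomain D P (ℓ + 1)

open Classical in
/-- The coefficients, with respect to the B-splines of level `ℓ + n`, of
`trunc^{ℓ+n} (⋯ (trunc^{ℓ+1} β))`, where `β` is the B-spline of level `ℓ` and position `k`. -/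
def truncCoeff (P : Finset Cell) (ℓ : ℕ) (k : Fin 2 → ℤ) : ℕ → (Fin 2 → ℤ) → ℝ
  | 0 => Pi.single k 1
  | n + 1 => fun j =>
      if bsupp D r (ℓ + (n + 1)) j ⊆ subdomain D P (ℓ + (n + 1)) then 0
      else refineCoeff r (truncCoeff P ℓ k n) j

/-- The largest level of a cell of `P`. -/
def depth (P : Finset Cell) : ℕ := P.sup Cell.level

/-- The truncated B-spline `Trunc^{ℓ+1} β`, where `β` is the B-spline of level `ℓ` and position `k`.
The truncated basis `T_P` consists of these functions for the active `β`. -/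
def thb (P : Finset Cell) (ℓ : ℕ) (k : Fin 2 → ℤ) : Plane → ℝ :=
  spline D r (ℓ + (depth P - ℓ)) (truncCoeff D r P ℓ k (depth P - ℓ))

/-- `P` is admissible: on each cell of `P`, the functions of the truncated basis which do not
vanish there belong to at most two successive levels. -/
def IsAdmissible (P : Finset Cell) : Prop :=
  ∀ τ ∈ P, ∃ n : ℕ, ∀ (ℓ : ℕ) (k : Fin 2 → ℤ), IsActive D r P ℓ k →
    (Function.support (thb D r P ℓ k) ∩ cellSet D τ).Nonempty → ℓ = n ∨ ℓ = n + 1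

/-- The support extension `S(τ, k)` of a cell with respect to level `k`. -/
def supportExt (τ : Cell) (k : ℕ) : Set Cell :=
  {τ' | τ' ∈ grid D k ∧ ∃ j : Fin 2 → ℤ,
    (bsupp D r k j ∩ cellSet D τ').Nonempty ∧ (bsupp D r k j ∩ cellSet D τ).Nonempty}

/-- The auxiliary subdomain `U^ℓ`. -/
def auxSubdomain (P : Finset Cell) (ℓ : ℕ) : Set Plane :=
  ⋃ τ ∈ grid D ℓ, ⋃ (_ : ∀ τ' ∈ supportExt D r τ ℓ, cellSet D τ' ⊆ subdomain D P ℓ),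
    closure (cellSet D τ)

/-- `P` is strictly admissible: `Ω^{ℓ+1} ⊆ U^ℓ` for all `ℓ ≥ 1`. -/
def IsStrictlyAdmissible (P : Finset Cell) : Prop :=
  ∀ ℓ : ℕ, 1 ≤ ℓ → subdomain D P (ℓ + 1) ⊆ auxSubdomain D r P ℓ

/-- The initial mesh is an admissible choice of the initial partition. -/
theorem isStrictlyAdmissible_initialMesh : IsStrictlyAdmissible D r (initialMesh D) := by
  intro ℓ hℓ x hx
  simp only [subdomain, initialMesh, mem_iUnion, Finset.mem_image] at hx
  obtain ⟨τ, ⟨k, _, rfl⟩, h, _⟩ := hx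
  simp at h

theorem isPartition_initialMesh : IsPartition D (initialMesh D) := by
  refine ⟨?_, ?_, ?_⟩
  · intro τ hτ
    obtain ⟨k, hk, rfl⟩ := Finset.mem_image.1 hτ
    simpa [grid] using hk
  · intro τ hτ τ' hτ' hne
    obtain ⟨k, hk, rfl⟩ := Finset.mem_image.1 hτ
    obtain ⟨k', hk', rfl⟩ := Finset.mem_image.1 hτ'
    rw [Set.disjoint_left]
    intro x hx hx'
    apply hne
    congr 1
    funext i
    have h1 := hx i
    have h2 := hx' i
    simp only [side, pow_zero, div_one] at h1 h2
    have hp := D.h₀_pos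
    have a1 : (k i : ℝ) < k' i + 1 := lt_of_mul_lt_mul_left (h1.1.trans h2.2) hp.le
    have a2 : (k' i : ℝ) < k i + 1 := lt_of_mul_lt_mul_left (h2.1.trans h1.2) hp.le
    have b1 : k i < k' i + 1 := by exact_mod_cast a1
    have b2 : k' i < k i + 1 := by exact_mod_cast a2
    omega
  · simp [initialMesh, domain]

/-- The patch `ω_τ`, as an open set: the region covered by the cells of `P` on which some function
of the truncated basis lives that lives on `τ` as well. -/
def patch (P : Finset Cell) (τ : Cell) : Set Plane :=
  interior (closure (⋃ τ' ∈ {τ' | τ' ∈ P ∧ ∃ (ℓ : ℕ) (k : Fin 2 → ℤ), IsActive D r P ℓ k ∧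
    (Function.support (thb D r P ℓ k) ∩ cellSet D τ).Nonempty ∧
    (Function.support (thb D r P ℓ k) ∩ cellSet D τ').Nonempty}, cellSet D τ'))

/-! ### Refinement -/

/-- The four children of a cell. -/
def children (τ : Cell) : Finset Cell :=
  Finset.univ.image (fun e : Fin 2 → Fin 2 => ⟨τ.level + 1, fun i => 2 * τ.pos i + (e i : ℕ)⟩)

/-- Dyadic refinement of the cell `τ` if it belongs to `P`. -/
def split (P : Finset Cell) (τ : Cell) : Finset Cell :=
  if τ ∈ P then P.erase τ ∪ children τ else P

open Classical in
/-- The neighbourhood `N(P, τ)`: the cells of `P` one level coarser than `τ` which contain a cell of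
the support extension of `τ` with respect to its own level. -/
def neighbourhood (P : Finset Cell) (τ : Cell) : Finset Cell :=
  P.filter (fun τ' => τ'.level + 1 = τ.level ∧
    ∃ τ'' ∈ supportExt D r τ τ.level, cellSet D τ'' ⊆ cellSet D τ')

variable (enum : Finset Cell → List Cell)

/-- The procedure `recursive_refine [P, τ]` for a cell `τ` whose level is the first argument:
first all cells of `N(P, τ)` are treated recursively, then `τ` is refined. Cells of level `0` have
an empty neighbourhood. The function `enum` fixes the order in which loops run through a set. -/
def recursiveRefineAux : ℕ → Finset Cell → Cell → Finset Cell
  | 0, P, τ => split P τ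
  | n + 1, P, τ =>
      split ((enum (neighbourhood D r P τ)).foldl (recursiveRefineAux n) P) τ

/-- The procedure `recursive_refine [P, τ]`. -/
def recursiveRefine (P : Finset Cell) (τ : Cell) : Finset Cell :=
  recursiveRefineAux D r enum τ.level P τ

/-- The procedure `REFINE [P, M]`. -/
def refine (P M : Finset Cell) : Finset Cell :=
  (enum M).foldl (recursiveRefine D r enum) P

/-! ### The adaptive procedure -/

variable (ω : Finset Cell → Cell → Set Plane) (α p δ : ℝ) (m : ℕ) (v : Plane → ℝ)

/-- The error quantity `e(τ, P) = |τ|^δ |v|_{B^α_{p,p;m}(ω)}`, where `ω = ω P τ`. -/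
def cellError (P : Finset Cell) (τ : Cell) : ℝ≥0∞ :=
  volume (cellSet D τ) ^ δ *
    besovSeminorm α (ENNReal.ofReal p) (ENNReal.ofReal p) m v (ω P τ)

open Classical in
/-- The marked cells `{τ ∈ P : e(τ, P) > ε}`. -/
def marked (ε : ℝ) (P : Finset Cell) : Finset Cell :=
  P.filter (fun τ => ENNReal.ofReal ε < cellError D ω α p δ m v P τ)

/-- The partitions `P_ℓ` generated by the adaptive procedure (with `P_{ℓ+1} = P_ℓ` as soon as no
cell of `P_ℓ` is marked). -/
def adaptiveSeq (ε : ℝ) (P₀ : Finset Cell) : ℕ → Finset Cell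
  | 0 => P₀
  | n + 1 => refine D r enum (adaptiveSeq ε P₀ n)
      (marked D ω α p δ m v ε (adaptiveSeq ε P₀ n))

end AdaptiveSpline

end

namespace AdaptiveSpline

/-! ### The tree of cells -/

/-! A partition is the set of leaves of a dyadic forest, and its strict ancestors are exactly the
cells that have been refined. Since a split replaces one leaf by at most four, `#P - #P₀` is at most
three times the number of new strict ancestors. The task is to count refined cells.

Two facts control them. First, refining `τ` recursively touches only cells `σ` no finer than `τ`
whose distance to `τ` is bounded by a multiple of the size of `σ` (`NearTo`,
`refines_recursiveRefineAux`). So a refined cell of level `k` comes from marked cells of levels `ℓ ≥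
k`, and each of these is responsible for boundedly many cells of level `k` (`card_nearTo_le`).
Second, a marked cell satisfies a condition independent of the current partition: the error computed
on `Ω` intersected with a fixed multiple of the cell exceeds `ε` (`IsUnresolved`). If the `p`-th
powers of these local seminorms sum to at most a constant times the global one, Chebyshev's
inequality gives at most `X · 4^(-δpℓ)` such cells on level `ℓ`, where `X` is a multiple of `|v|^p
ε^(-p)` (`exists_card_unresolved_le`). The refined cells of level `k` are therefore bounded both by
a multiple of `4^k` and by a multiple of `X · 4^(-δpk)`. Balancing the two bounds gives
`X^(1/(1+δp))` (`sum_le_of_two_bounds`). This bound does not depend on the number of steps, and each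
nonempty step refines a new cell, so the procedure terminates. At the stop every error is at most
`ε`, which gives the bound on the sum of squares.

The analytic core is the local-to-global estimate `exists_sum_besovSeminorm_le`. A supremum over
steps `h` does not commute with summation over cells, so the local modulus is first bounded by an
average over steps (`exists_modulus_le_average`), using an identity that expresses `Δ_h^m` through
differences with perturbed steps. The perturbed segments must stay in `Ω`, which may have reentrant
corners or squares touching at a corner; `exists_sign_translate` supplies a quadrant of admissible
perturbations.

Admissibility of the result follows because recursive refinement preserves strict admissibility,
read as a condition on the forest (`IsPartition.strictlyAdmissible_iff`), and strict admissibility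
leaves only two levels of truncated B-splines on each cell (`thb_level`). -/

/-- `σ` is a descendant of `τ`, or `τ` itself. -/
def Desc (σ τ : Cell) : Prop :=
  ∃ n : ℕ, σ.level = τ.level + n ∧ ∀ i, σ.pos i / 2 ^ n = τ.pos i

theorem Desc.refl (σ : Cell) : Desc σ σ := ⟨0, by simp⟩

theorem Desc.level_le {σ τ : Cell} (h : Desc σ τ) : τ.level ≤ σ.level := by
  obtain ⟨n, h, -⟩ := h; omega

theorem Desc.trans {σ τ ρ : Cell} (h : Desc σ τ) (h' : Desc τ ρ) : Desc σ ρ := by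
  obtain ⟨n, h1, h2⟩ := h
  obtain ⟨k, h3, h4⟩ := h'
  refine ⟨n + k, by omega, fun i => ?_⟩
  rw [pow_add, ← Int.ediv_ediv_of_nonneg (by positivity), h2, h4]

theorem Cell.ext' {σ τ : Cell} (h : σ.level = τ.level) (h' : ∀ i, σ.pos i = τ.pos i) : σ = τ := by
  cases σ; cases τ
  simp only [Cell.mk.injEq] at *
  exact ⟨h, funext h'⟩

theorem Desc.eq_of_level_le {σ τ : Cell} (h : Desc σ τ) (h' : σ.level ≤ τ.level) : σ = τ := by
  obtain ⟨n, h1, h2⟩ := h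
  obtain rfl : n = 0 := by omega
  exact Cell.ext' (by omega) fun i => by simpa using h2 i

/-- Two cells with a common descendant are comparable. -/
theorem Desc.comparable {σ τ ρ : Cell} (h : Desc σ τ) (h' : Desc σ ρ) (hl : τ.level ≤ ρ.level) :
    Desc ρ τ := by
  obtain ⟨n, h1, h2⟩ := h
  obtain ⟨k, h3, h4⟩ := h'
  refine ⟨n - k, by omega, fun i => ?_⟩
  rw [← h2, ← h4, Int.ediv_ediv_of_nonneg (by positivity), ← pow_add]
  congr 2; omega

/-- The ancestor of level `k` of a cell of level at least `k`. -/
def up (τ : Cell) (k : ℕ) : Cell := ⟨k, fun i => τ.pos i / 2 ^ (τ.level - k)⟩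

theorem desc_up {τ : Cell} {k : ℕ} (h : k ≤ τ.level) : Desc τ (up τ k) :=
  ⟨τ.level - k, by simp only [up]; omega, fun i => rfl⟩

theorem Desc.eq_up {σ τ : Cell} (h : Desc σ τ) : τ = up σ τ.level := by
  obtain ⟨n, h1, h2⟩ := h
  refine Cell.ext' rfl fun i => ?_
  rw [← h2 i]
  simp only [up]
  congr 2; omega

theorem Desc.grid_iff {D : GridDomain} {σ τ : Cell} (h : Desc σ τ) :
    σ ∈ grid D σ.level ↔ τ ∈ grid D τ.level := by
  obtain ⟨n, h1, h2⟩ := h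
  simp only [grid, mem_ofPred_eq, true_and]
  have : (fun i => σ.pos i / 2 ^ σ.level) = fun i => τ.pos i / 2 ^ τ.level := by
    funext i
    rw [← h2, Int.ediv_ediv_of_nonneg (by positivity), ← pow_add]
    congr 2; omega
  rw [this]

theorem grid_level {D : GridDomain} {ℓ : ℕ} {τ : Cell} (h : τ ∈ grid D ℓ) : τ.level = ℓ := h.1

theorem Desc.mem_grid {D : GridDomain} {σ τ : Cell} {ℓ : ℕ} (h : Desc σ τ) (hσ : σ ∈ grid D ℓ) :
    τ ∈ grid D τ.level := by
  rw [← h.grid_iff, grid_level hσ]; exact hσ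

theorem side_pos (D : GridDomain) (ℓ : ℕ) : 0 < side D ℓ :=
  div_pos D.h₀_pos (by positivity)

theorem side_add (D : GridDomain) (ℓ n : ℕ) : side D ℓ = side D (ℓ + n) * 2 ^ n := by
  simp only [side, pow_add]
  field_simp

theorem side_anti (D : GridDomain) {k ℓ : ℕ} (h : k ≤ ℓ) : side D ℓ ≤ side D k := by
  obtain ⟨n, rfl⟩ := Nat.exists_eq_add_of_le h
  rw [side_add D k n]
  exact le_mul_of_one_le_right (side_pos D _).le (one_le_pow₀ one_le_two)

theorem Desc.cellSet_subset (D : GridDomain) {σ τ : Cell} (h : Desc σ τ) :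
    cellSet D σ ⊆ cellSet D τ := by
  obtain ⟨n, h1, h2⟩ := h
  intro x hx i
  have hs := side_pos D σ.level
  have e : side D τ.level = side D σ.level * 2 ^ n := by rw [h1]; exact side_add D _ n
  have a1 : 2 ^ n * τ.pos i ≤ σ.pos i := by
    rw [← h2 i]; exact Int.mul_ediv_self_le (by positivity)
  have a2 : σ.pos i + 1 ≤ 2 ^ n * (τ.pos i + 1) := by
    rw [← h2 i]
    have := Int.lt_mul_ediv_self_add (x := σ.pos i) (k := 2 ^ n) (by positivity)
    linarith
  have b1 : (2 : ℝ) ^ n * τ.pos i ≤ σ.pos i := by exact_mod_cast a1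
  have b2 : (σ.pos i : ℝ) + 1 ≤ 2 ^ n * (τ.pos i + 1) := by exact_mod_cast a2
  obtain ⟨c1, c2⟩ := hx i
  rw [e, mul_assoc, mul_assoc]
  exact ⟨(mul_le_mul_of_nonneg_left b1 hs.le).trans_lt c1,
    c2.trans_le (mul_le_mul_of_nonneg_left b2 hs.le)⟩

/-- Dyadic squares that overlap are nested: the coordinates of a common point pin down the integer
quotient of the finer position. -/
theorem desc_of_inter (D : GridDomain) {σ τ : Cell} (hl : τ.level ≤ σ.level)
    (h : (cellSet D σ ∩ cellSet D τ).Nonempty) : Desc σ τ := by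
  obtain ⟨x, hσ, hτ⟩ := h
  obtain ⟨n, hn⟩ := Nat.exists_eq_add_of_le hl
  refine ⟨n, hn, fun i => ?_⟩
  have hs := side_pos D σ.level
  have e : side D τ.level = side D σ.level * 2 ^ n := by rw [hn]; exact side_add D _ n
  obtain ⟨a1, a2⟩ := hσ i
  obtain ⟨b1, b2⟩ := hτ i
  rw [e, mul_assoc] at b1 b2
  have c1 : (2 : ℝ) ^ n * τ.pos i < σ.pos i + 1 := lt_of_mul_lt_mul_left (b1.trans a2) hs.le
  have c2 : (σ.pos i : ℝ) < 2 ^ n * (τ.pos i + 1) := lt_of_mul_lt_mul_left (a1.trans b2) hs.le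
  have d1 : 2 ^ n * τ.pos i < σ.pos i + 1 := by exact_mod_cast c1
  have d2 : σ.pos i < 2 ^ n * (τ.pos i + 1) := by exact_mod_cast c2
  refine Int.ediv_eq_iff_of_pos (by positivity) |>.2 ⟨by linarith, by linarith⟩

theorem isOpen_cellSet (D : GridDomain) (τ : Cell) : IsOpen (cellSet D τ) := by
  have : cellSet D τ = ⋂ i, {x : Plane | side D τ.level * τ.pos i < x i - D.origin i ∧
      x i - D.origin i < side D τ.level * (τ.pos i + 1)} := by
    ext x; simp [cellSet]
  rw [this]
  refine isOpen_iInter_of_finite fun i => ?_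
  rw [ofPred_and]
  exact (isOpen_lt (by fun_prop) (by fun_prop)).inter (isOpen_lt (by fun_prop) (by fun_prop))

theorem cellSet_nonempty (D : GridDomain) (τ : Cell) : (cellSet D τ).Nonempty := by
  refine ⟨WithLp.toLp 2 fun i => D.origin i + side D τ.level * (τ.pos i + 1 / 2), fun i => ?_⟩
  have hs := side_pos D τ.level
  constructor <;> simp only [add_sub_cancel_left] <;> nlinarith

/-- The closure of a cell. -/
theorem closure_cellSet (D : GridDomain) (τ : Cell) : closure (cellSet D τ) =
    {x | ∀ i, side D τ.level * τ.pos i ≤ x i - D.origin i ∧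
      x i - D.origin i ≤ side D τ.level * (τ.pos i + 1)} := by
  apply subset_antisymm
  · refine closure_minimal (fun x hx i => ⟨(hx i).1.le, (hx i).2.le⟩) ?_
    simp only [ofPred_forall, ofPred_and]
    refine isClosed_iInter fun i => ?_
    exact (isClosed_le (by fun_prop) (by fun_prop)).inter (isClosed_le (by fun_prop) (by fun_prop))
  · intro x hx
    -- By convexity the points `x + t (y - x)` with `0 < t < 1` lie in the open cell, and they tend
    -- to `x`.
    obtain ⟨y, hy⟩ := cellSet_nonempty D τ
    have hlim : Filter.Tendsto (fun t : ℝ => x + t • (y - x)) (nhdsWithin 0 (Ioo 0 1))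
        (nhds x) := by
      have : ContinuousAt (fun t : ℝ => x + t • (y - x)) 0 := by fun_prop
      have h2 := this.tendsto
      simp only [zero_smul, add_zero] at h2
      exact h2.mono_left nhdsWithin_le_nhds
    have hne : (nhdsWithin (0 : ℝ) (Ioo 0 1)).NeBot := by
      rw [← mem_closure_iff_nhdsWithin_neBot, closure_Ioo zero_ne_one]
      exact ⟨le_rfl, zero_le_one⟩
    refine mem_closure_of_tendsto hlim ?_
    filter_upwards [self_mem_nhdsWithin] with t ht i
    obtain ⟨h1, h2⟩ := hx i
    obtain ⟨h3, h4⟩ := hy i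
    simp only [PiLp.add_apply, PiLp.smul_apply, PiLp.sub_apply, smul_eq_mul]
    have := ht.1
    have := ht.2
    constructor <;> nlinarith

theorem cellSet_inter_of_closure (D : GridDomain) {σ τ : Cell}
    (h : (cellSet D σ ∩ closure (cellSet D τ)).Nonempty) :
    (cellSet D σ ∩ cellSet D τ).Nonempty := by
  obtain ⟨x, h1, h2⟩ := h
  exact mem_closure_iff.1 h2 _ (isOpen_cellSet D σ) h1

theorem cellSet_subset_domain {D : GridDomain} {τ : Cell} {ℓ : ℕ} (h : τ ∈ grid D ℓ) :
    cellSet D τ ⊆ domain D := by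
  have hd : Desc τ (up τ 0) := desc_up (Nat.zero_le _)
  have hg : (up τ 0).pos ∈ D.base := by simpa [grid, up] using hd.mem_grid h
  refine (hd.cellSet_subset D).trans ?_
  refine interior_maximal ?_ (isOpen_cellSet D _)
  refine Subset.trans ?_ subset_closure
  intro x hx
  simp only [mem_iUnion]
  exact ⟨_, hg, hx⟩

/-! ### Partitions as trees -/

/-- `σ` belongs to the tree of the partition `P`. -/
def InTree (P : Finset Cell) (σ : Cell) : Prop := ∃ τ ∈ P, Desc τ σ

/-- The strict ancestors of the cells of `P`. -/
def ancestors (P : Finset Cell) : Finset Cell :=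
  P.biUnion fun τ => (Finset.range τ.level).image (up τ)

theorem mem_ancestors {P : Finset Cell} {σ : Cell} :
    σ ∈ ancestors P ↔ ∃ τ ∈ P, Desc τ σ ∧ σ.level < τ.level := by
  simp only [ancestors, Finset.mem_biUnion, Finset.mem_image, Finset.mem_range]
  constructor
  · rintro ⟨τ, hτ, k, hk, rfl⟩
    exact ⟨τ, hτ, desc_up hk.le, hk⟩
  · rintro ⟨τ, hτ, h, hl⟩
    exact ⟨τ, hτ, σ.level, hl, h.eq_up.symm⟩

theorem inTree_iff {P : Finset Cell} {σ : Cell} : InTree P σ ↔ σ ∈ P ∨ σ ∈ ancestors P := by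
  rw [mem_ancestors]
  constructor
  · rintro ⟨τ, hτ, h⟩
    rcases h.level_le.lt_or_eq with hl | hl
    · exact Or.inr ⟨τ, hτ, h, hl⟩
    · rw [h.eq_of_level_le hl.ge] at hτ; exact Or.inl hτ
  · rintro (h | ⟨τ, hτ, h, -⟩)
    · exact ⟨σ, h, Desc.refl σ⟩
    · exact ⟨τ, hτ, h⟩

theorem InTree.of_desc {P : Finset Cell} {σ τ : Cell} (h : InTree P σ) (h' : Desc σ τ) :
    InTree P τ := by
  obtain ⟨ρ, hρ, h⟩ := h; exact ⟨ρ, hρ, h.trans h'⟩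

theorem IsPartition.eq_of_desc {D : GridDomain} {P : Finset Cell} (hP : IsPartition D P)
    {σ τ : Cell} (hσ : σ ∈ P) (hτ : τ ∈ P) (h : Desc σ τ) : σ = τ := by
  by_contra hne
  obtain ⟨x, hx⟩ := cellSet_nonempty D σ
  exact Set.disjoint_left.1 (hP.2.1 σ hσ τ hτ hne) hx (h.cellSet_subset D hx)

theorem IsPartition.notMem_ancestors {D : GridDomain} {P : Finset Cell} (hP : IsPartition D P)
    {σ : Cell} (hσ : σ ∈ P) : σ ∉ ancestors P := by
  rw [mem_ancestors]
  rintro ⟨τ, hτ, h, hl⟩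
  rw [hP.eq_of_desc hτ hσ h] at hl
  exact lt_irrefl _ hl

theorem closure_biUnion_cellSet (D : GridDomain) (P : Finset Cell) :
    closure (⋃ τ ∈ P, cellSet D τ) = ⋃ τ ∈ P, closure (cellSet D τ) :=
  P.finite_toSet.closure_biUnion _

theorem IsPartition.exists_closure {D : GridDomain} {P : Finset Cell} (hP : IsPartition D P)
    {x : Plane} (hx : x ∈ domain D) : ∃ τ ∈ P, x ∈ closure (cellSet D τ) := by
  rw [← hP.2.2] at hx
  have := interior_subset hx
  rw [closure_biUnion_cellSet] at this
  simpa using this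

/-- The leaves cover `Ω`, so some leaf overlaps `σ`; nestedness then puts it above or below `σ`.
This dichotomy replaces geometry in all later tree arguments. -/
theorem IsPartition.cover {D : GridDomain} {P : Finset Cell} (hP : IsPartition D P)
    {σ : Cell} (hσ : σ ∈ grid D σ.level) : InTree P σ ∨ ∃ τ ∈ P, Desc σ τ := by
  obtain ⟨x, hx⟩ := cellSet_nonempty D σ
  obtain ⟨τ, hτ, h⟩ := hP.exists_closure (cellSet_subset_domain hσ hx)
  have hne := cellSet_inter_of_closure D ⟨x, hx, h⟩
  rcases le_total τ.level σ.level with hl | hl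
  · exact Or.inr ⟨τ, hτ, desc_of_inter D hl hne⟩
  · rw [inter_comm] at hne
    exact Or.inl ⟨τ, hτ, desc_of_inter D hl hne⟩

theorem IsPartition.inTree_grid {D : GridDomain} {P : Finset Cell} (hP : IsPartition D P)
    {σ : Cell} (hσ : InTree P σ) : σ ∈ grid D σ.level := by
  obtain ⟨τ, hτ, h⟩ := hσ
  exact h.mem_grid (hP.1 τ hτ)

/-- Translates the geometric subdomains into the forest. For the converse direction, a leaf coarser
than `σ` that overlaps `σ` would lie strictly above the leaf known to be below `σ`, contradicting
disjointness. -/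
theorem IsPartition.cellSet_subset_subdomain_iff {D : GridDomain} {P : Finset Cell}
    (hP : IsPartition D P) {σ : Cell} (hσ : σ ∈ grid D σ.level) :
    cellSet D σ ⊆ subdomain D P σ.level ↔ InTree P σ := by
  constructor
  · intro h
    obtain ⟨x, hx⟩ := cellSet_nonempty D σ
    have := h hx
    simp only [subdomain, mem_iUnion] at this
    obtain ⟨τ, hτ, hl, hc⟩ := this
    have hne := cellSet_inter_of_closure D ⟨x, hx, hc⟩
    rw [inter_comm] at hne
    exact ⟨τ, hτ, desc_of_inter D hl hne⟩
  · rintro ⟨ρ, hρ, h⟩ x hx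
    obtain ⟨τ, hτ, hc⟩ := hP.exists_closure (cellSet_subset_domain hσ hx)
    have hne := cellSet_inter_of_closure D ⟨x, hx, hc⟩
    simp only [subdomain, mem_iUnion]
    refine ⟨τ, hτ, ?_, hc⟩
    by_contra hl
    have h1 : Desc σ τ := desc_of_inter D (by omega) hne
    have h2 := hP.eq_of_desc hρ hτ (h.trans h1)
    have := h.level_le
    have := h1.level_le
    subst h2
    omega

/-- Every cell of the support extension of a strict ancestor belongs to the tree. -/
def TreeAdmissible (D : GridDomain) (r : ℕ) (P : Finset Cell) : Prop :=
  ∀ σ ∈ ancestors P, 1 ≤ σ.level → ∀ τ ∈ supportExt D r σ σ.level, InTree P τ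

theorem supportExt_level {D : GridDomain} {r k : ℕ} {σ τ : Cell} (h : τ ∈ supportExt D r σ k) :
    τ.level = k := h.1.1

theorem supportExt_grid {D : GridDomain} {r k : ℕ} {σ τ : Cell} (h : τ ∈ supportExt D r σ k) :
    τ ∈ grid D τ.level := by
  rw [supportExt_level h]; exact h.1

/-- `Ω^{ℓ+1}` is made of closures of leaves with a strict ancestor of level `ℓ`, and a cell of level
`ℓ` whose closure meets such an open leaf must be that ancestor. Hence the inclusion in
`auxSubdomain` only tests the strict ancestors. -/
theorem IsPartition.strictlyAdmissible_iff {D : GridDomain} {r : ℕ} {P : Finset Cell}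
    (hP : IsPartition D P) : IsStrictlyAdmissible D r P ↔ TreeAdmissible D r P := by
  constructor
  · intro h σ hσ hl τ hτ
    obtain ⟨ρ, hρ, hd, hlt⟩ := mem_ancestors.1 hσ
    obtain ⟨x, hx⟩ := cellSet_nonempty D ρ
    have hxs : x ∈ subdomain D P (σ.level + 1) := by
      simp only [subdomain, mem_iUnion]
      exact ⟨ρ, hρ, hlt, subset_closure hx⟩
    have := h σ.level hl hxs
    simp only [auxSubdomain, mem_iUnion] at this
    obtain ⟨σ', hσ', hS, hc⟩ := this
    have hne := cellSet_inter_of_closure D ⟨x, hx, hc⟩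
    have hl' := grid_level hσ'
    have hd' : Desc ρ σ' := desc_of_inter D (by omega) hne
    obtain rfl : σ = σ' := by
      rw [hd.eq_up, hd'.eq_up, hl']
    have := hS τ hτ
    rw [← hP.cellSet_subset_subdomain_iff (supportExt_grid hτ), supportExt_level hτ]
    exact this
  · intro h ℓ hℓ x hx
    simp only [subdomain, mem_iUnion] at hx
    obtain ⟨ρ, hρ, hl, hc⟩ := hx
    have hd : Desc ρ (up ρ ℓ) := desc_up (by omega)
    simp only [auxSubdomain, mem_iUnion]
    refine ⟨up ρ ℓ, hd.mem_grid (hP.1 ρ hρ), fun τ hτ => ?_,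
      closure_mono (hd.cellSet_subset D) hc⟩
    have := h (up ρ ℓ) (mem_ancestors.2 ⟨ρ, hρ, hd, by simp only [up]; omega⟩) hℓ τ hτ
    rw [← hP.cellSet_subset_subdomain_iff (supportExt_grid hτ), supportExt_level hτ] at this
    exact this

/-! ### Dyadic refinement of one cell -/

theorem mem_children {σ τ : Cell} : σ ∈ children τ ↔ σ.level = τ.level + 1 ∧ Desc σ τ := by
  simp only [children, Finset.mem_image, Finset.mem_univ, true_and]
  constructor
  · rintro ⟨e, rfl⟩
    refine ⟨rfl, 1, rfl, fun i => ?_⟩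
    have := (e i).2
    simp only [pow_one]
    omega
  · rintro ⟨h1, n, h2, h3⟩
    obtain rfl : n = 1 := by omega
    refine ⟨fun i => ⟨(σ.pos i % 2).toNat, by omega⟩, ?_⟩
    refine Cell.ext' h1.symm fun i => ?_
    have := h3 i
    simp only [pow_one] at this ⊢
    omega

theorem children_nonempty (τ : Cell) : (children τ).Nonempty :=
  ⟨_, Finset.mem_image_of_mem _ (Finset.mem_univ 0)⟩

theorem card_children_le (τ : Cell) : (children τ).card ≤ 4 := by
  refine Finset.card_image_le.trans ?_
  simp

theorem closure_cellSet_subset_children (D : GridDomain) (τ : Cell) :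
    closure (cellSet D τ) ⊆ ⋃ σ ∈ children τ, closure (cellSet D σ) := by
  intro x hx
  rw [closure_cellSet] at hx
  have e := side_add D τ.level 1
  have hs := side_pos D (τ.level + 1)
  set s := side D (τ.level + 1)
  rw [e] at hx
  simp only [mem_iUnion, children, Finset.mem_image, Finset.mem_univ, true_and]
  refine ⟨_, ⟨fun i => if x i - D.origin i ≤ s * (2 * τ.pos i + 1) then 0 else 1, rfl⟩, ?_⟩
  rw [closure_cellSet]
  intro i
  obtain ⟨h1, h2⟩ := hx i
  change s * _ ≤ _ ∧ _ ≤ s * _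
  dsimp only
  split_ifs with h <;> push_cast <;> constructor <;> simp <;> nlinarith

theorem mem_split {P : Finset Cell} {σ τ : Cell} (hτ : τ ∈ P) :
    σ ∈ split P τ ↔ (σ ∈ P ∧ σ ≠ τ) ∨ (σ.level = τ.level + 1 ∧ Desc σ τ) := by
  rw [split, if_pos hτ, Finset.mem_union, Finset.mem_erase, mem_children]
  tauto

theorem IsPartition.split {D : GridDomain} {P : Finset Cell} (hP : IsPartition D P) {τ : Cell}
    (hτ : τ ∈ P) : IsPartition D (split P τ) := by
  have key : ∀ σ ρ : Cell, σ ∈ P → σ ≠ τ → ρ.level = τ.level + 1 → Desc ρ τ →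
      Disjoint (cellSet D σ) (cellSet D ρ) := fun σ ρ h1 h2 _ h4 =>
    (hP.2.1 σ h1 τ hτ h2).mono_right (h4.cellSet_subset D)
  refine ⟨fun σ hσ => ?_, fun σ hσ ρ hρ hne => ?_, ?_⟩
  · rcases (mem_split hτ).1 hσ with ⟨h, -⟩ | ⟨-, h⟩
    · exact hP.1 σ h
    · exact h.grid_iff.2 (hP.1 τ hτ)
  · rcases (mem_split hτ).1 hσ with ⟨h1, h2⟩ | ⟨h1, h2⟩ <;>
    rcases (mem_split hτ).1 hρ with ⟨h3, h4⟩ | ⟨h3, h4⟩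
    · exact hP.2.1 σ h1 ρ h3 hne
    · exact key σ ρ h1 h2 h3 h4
    · exact (key ρ σ h3 h4 h1 h2).symm
    · rw [Set.disjoint_iff_inter_eq_empty]
      by_contra hne'
      exact hne ((desc_of_inter D (by omega) (nonempty_iff_ne_empty.2 hne')).eq_of_level_le
        (by omega))
  · rw [← hP.2.2]
    congr 1
    rw [closure_biUnion_cellSet, closure_biUnion_cellSet]
    apply subset_antisymm
    · refine iUnion₂_subset fun σ hσ => ?_
      rcases (mem_split hτ).1 hσ with ⟨h, -⟩ | ⟨-, h⟩
      · exact subset_biUnion_of_mem (u := fun σ => closure (cellSet D σ)) h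
      · exact (closure_mono (h.cellSet_subset D)).trans
          (subset_biUnion_of_mem (u := fun σ => closure (cellSet D σ)) hτ)
    · refine iUnion₂_subset fun σ hσ => ?_
      by_cases h : σ = τ
      · subst h
        refine (closure_cellSet_subset_children D σ).trans (iUnion₂_subset fun ρ hρ => ?_)
        exact subset_biUnion_of_mem (u := fun σ => closure (cellSet D σ))
          ((mem_split hτ).2 (Or.inr (mem_children.1 hρ)))
      · exact subset_biUnion_of_mem (u := fun σ => closure (cellSet D σ))
          ((mem_split hτ).2 (Or.inl ⟨hσ, h⟩))

/-- The bookkeeping behind the count: each effective split enlarges `ancestors` by the split cell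
and by nothing else. -/
theorem ancestors_split {P : Finset Cell} {τ : Cell} (hτ : τ ∈ P) :
    ancestors (split P τ) = insert τ (ancestors P) := by
  obtain ⟨c, hc⟩ := children_nonempty τ
  rw [mem_children] at hc
  ext σ
  rw [Finset.mem_insert, mem_ancestors, mem_ancestors]
  constructor
  · rintro ⟨ρ, hρ, h, hl⟩
    rcases (mem_split hτ).1 hρ with ⟨h1, -⟩ | ⟨h1, h2⟩
    · exact Or.inr ⟨ρ, h1, h, hl⟩
    · have h3 : Desc τ σ := h.comparable h2 (by omega)
      rcases h3.level_le.lt_or_eq with h4 | h4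
      · exact Or.inr ⟨τ, hτ, h3, h4⟩
      · exact Or.inl (h3.eq_of_level_le h4.ge).symm
  · rintro (rfl | ⟨ρ, hρ, h, hl⟩)
    · exact ⟨c, (mem_split hτ).2 (Or.inr hc), hc.2, by omega⟩
    · by_cases h' : ρ = τ
      · subst h'
        exact ⟨c, (mem_split hτ).2 (Or.inr hc), hc.2.trans h, by omega⟩
      · exact ⟨ρ, (mem_split hτ).2 (Or.inl ⟨hρ, h'⟩), h, hl⟩

theorem card_split_le {P : Finset Cell} {τ : Cell} (hτ : τ ∈ P) :
    (split P τ).card ≤ P.card + 3 := by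
  rw [split, if_pos hτ]
  refine (Finset.card_union_le _ _).trans ?_
  have h1 := Finset.card_erase_of_mem hτ
  have h2 := Finset.card_pos.2 ⟨τ, hτ⟩
  have := card_children_le τ
  omega

end AdaptiveSpline

namespace AdaptiveSpline

/-! ### Elementary properties of B-splines -/

theorem cardinalBSpline_nonneg (k : ℕ) (x : ℝ) : 0 ≤ cardinalBSpline k x := by
  induction k generalizing x with
  | zero => exact indicator_nonneg (fun _ _ => zero_le_one) x
  | succ k ih => exact intervalIntegral.integral_nonneg zero_le_one fun t _ => ih _

theorem cardinalBSpline_eq_zero (k : ℕ) {x : ℝ} (h : x < 0 ∨ k + 1 < x) :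
    cardinalBSpline k x = 0 := by
  induction k generalizing x with
  | zero =>
    refine indicator_of_notMem (fun hx => ?_) _
    rcases h with h | h
    · exact absurd hx.1 (not_le.2 h)
    · norm_num at h; exact absurd hx.2 (not_lt.2 h.le)
  | succ k ih =>
    change ∫ t in (0 : ℝ)..1, cardinalBSpline k (x - t) = 0
    rw [intervalIntegral.integral_congr (g := fun _ => (0 : ℝ)), intervalIntegral.integral_zero]
    intro t ht
    rw [uIcc_of_le zero_le_one] at ht
    refine ih ?_
    push_cast at h
    rcases h with h | h
    · exact Or.inl (by linarith [ht.1])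
    · exact Or.inr (by linarith [ht.2])

theorem cardinalBSpline_mem_Icc {k : ℕ} {x : ℝ} (h : cardinalBSpline k x ≠ 0) :
    0 ≤ x ∧ x ≤ k + 1 := by
  by_contra hx
  refine h (cardinalBSpline_eq_zero k ?_)
  by_contra! h'
  exact hx h'

/-- The convolution integral is a difference of two values of a primitive of a bounded function.
Continuity makes the set where a B-spline does not vanish open, so that it meets open cells. -/
theorem continuous_cardinalBSpline {k : ℕ} (hk : 1 ≤ k) : Continuous (cardinalBSpline k) := by
  obtain ⟨k, rfl⟩ := Nat.exists_eq_add_of_le' hk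
  have hint := cardinalBSpline_integrable k (fun t => t) measurable_id
  have : cardinalBSpline (k + 1) = fun x =>
      (∫ t in (0 : ℝ)..x, cardinalBSpline k t) - ∫ t in (0 : ℝ)..(x - 1), cardinalBSpline k t := by
    funext x
    change ∫ t in (0 : ℝ)..1, cardinalBSpline k (x - t) = _
    rw [intervalIntegral.integral_comp_sub_left (fun t => cardinalBSpline k t),
      intervalIntegral.integral_interval_sub_left (hint _ _) (hint _ _), sub_zero]
  rw [this]
  have hc := intervalIntegral.continuous_primitive hint 0
  exact hc.sub (hc.comp (continuous_id.sub continuous_const))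

theorem mask_nonneg (r : ℕ) (n : ℤ) : 0 ≤ mask r n := by
  unfold mask; split_ifs <;> positivity

/-- All terms of the two-scale relation are nonnegative, so nothing can cancel a positive one. -/
theorem cardinalBSpline_pos_of_child {r : ℕ} {n : ℤ} {y : ℝ} (hn : mask r n ≠ 0)
    (h : cardinalBSpline r (2 * y - n) ≠ 0) : cardinalBSpline r y ≠ 0 := by
  have h0 : 0 ≤ n := by
    by_contra h'
    exact hn (by simp [mask, h'])
  lift n to ℕ using h0
  have h1 : n ∈ Finset.range (r + 2) := by
    rw [Finset.mem_range]
    by_contra h'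
    refine hn ?_
    simp only [mask, Nat.cast_nonneg, if_true, Int.toNat_natCast]
    rw [Nat.choose_eq_zero_of_lt (by omega)]
    simp
  have hpos : 0 < mask r n * cardinalBSpline r (2 * y - n) :=
    mul_pos ((mask_nonneg r n).lt_of_ne' hn)
      ((cardinalBSpline_nonneg r _).lt_of_ne' (by exact_mod_cast h))
  rw [cardinalBSpline_two_scale]
  refine (hpos.trans_le ?_).ne'
  exact Finset.single_le_sum (f := fun j : ℕ => mask r j * cardinalBSpline r (2 * y - j))
    (fun j _ => mul_nonneg (mask_nonneg r _) (cardinalBSpline_nonneg r _)) h1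

variable {D : GridDomain} {r : ℕ}

theorem continuous_bspline (hr : 1 ≤ r) (ℓ : ℕ) (k : Fin 2 → ℤ) : Continuous (bspline D r ℓ k) := by
  unfold bspline
  refine continuous_finsetProd _ fun i _ => (continuous_cardinalBSpline hr).comp ?_
  fun_prop

theorem bspline_factor {ℓ : ℕ} {k : Fin 2 → ℤ} {x : Plane} (h : bspline D r ℓ k x ≠ 0) (i : Fin 2) :
    cardinalBSpline r ((x i - D.origin i) / side D ℓ - k i) ≠ 0 :=
  Finset.prod_ne_zero_iff.1 h i (Finset.mem_univ i)

/-- A B-spline does not vanish where one of its children does not vanish. -/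
theorem bspline_ne_zero_of_child {ℓ : ℕ} {j k : Fin 2 → ℤ} {x : Plane}
    (hm : ∏ i, mask r (k i - 2 * j i) ≠ 0) (h : bspline D r (ℓ + 1) k x ≠ 0) :
    bspline D r ℓ j x ≠ 0 := by
  refine Finset.prod_ne_zero_iff.2 fun i _ => ?_
  refine cardinalBSpline_pos_of_child (Finset.prod_ne_zero_iff.1 hm i (Finset.mem_univ i)) ?_
  convert bspline_factor h i using 2
  rw [side_add D ℓ 1]
  have := (side_pos D (ℓ + 1)).ne'
  push_cast
  field_simp
  ring

theorem bsupp_subset_of_child {ℓ : ℕ} {j k : Fin 2 → ℤ} (hm : ∏ i, mask r (k i - 2 * j i) ≠ 0) :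
    bsupp D r (ℓ + 1) k ⊆ bsupp D r ℓ j :=
  closure_mono fun _ hx => ⟨hx.1, bspline_ne_zero_of_child hm hx.2⟩

theorem bsupp_inter_cellSet {ℓ : ℕ} {k : Fin 2 → ℤ} {τ : Cell}
    (h : (bsupp D r ℓ k ∩ cellSet D τ).Nonempty) :
    ∃ x ∈ cellSet D τ, x ∈ domain D ∧ bspline D r ℓ k x ≠ 0 := by
  obtain ⟨x, h1, h2⟩ := h
  obtain ⟨y, h3, h4⟩ := mem_closure_iff.1 h1 _ (isOpen_cellSet D τ) h2
  exact ⟨y, h3, h4⟩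

theorem bsupp_inter_of_ne_zero {ℓ : ℕ} {k : Fin 2 → ℤ} {τ : Cell} {x : Plane}
    (hτ : τ ∈ grid D τ.level) (hx : x ∈ cellSet D τ) (h : bspline D r ℓ k x ≠ 0) :
    (bsupp D r ℓ k ∩ cellSet D τ).Nonempty :=
  ⟨x, subset_closure ⟨cellSet_subset_domain hτ hx, h⟩, hx⟩

/-! ### The support extension -/

theorem pos_of_bspline_ne_zero {τ : Cell} {k : Fin 2 → ℤ} {x : Plane} (hx : x ∈ cellSet D τ)
    (h : bspline D r τ.level k x ≠ 0) (i : Fin 2) : k i ≤ τ.pos i ∧ τ.pos i ≤ k i + r := by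
  have h1 := cardinalBSpline_mem_Icc (bspline_factor h i)
  have hs := side_pos D τ.level
  obtain ⟨h2, h3⟩ := hx i
  rw [mul_comm, ← lt_div_iff₀ hs] at h2
  rw [mul_comm, ← div_lt_iff₀ hs] at h3
  have a1 : (k i : ℝ) < τ.pos i + 1 := by linarith [h1.1]
  have a2 : (τ.pos i : ℝ) < k i + r + 1 := by linarith [h1.2]
  have b1 : k i < τ.pos i + 1 := by exact_mod_cast a1
  have b2 : τ.pos i < k i + r + 1 := by exact_mod_cast a2
  omega

/-- In each coordinate a B-spline lives on `r + 1` consecutive cells of its own level, and both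
cells are among these. -/
theorem supportExt_pos {σ τ : Cell} (h : τ ∈ supportExt D r σ σ.level) (i : Fin 2) :
    |τ.pos i - σ.pos i| ≤ r := by
  have hl := supportExt_level h
  obtain ⟨-, j, h1, h2⟩ := h
  obtain ⟨x, hx, -, hx'⟩ := bsupp_inter_cellSet h1
  obtain ⟨y, hy, -, hy'⟩ := bsupp_inter_cellSet h2
  rw [← hl] at hx'
  have a := pos_of_bspline_ne_zero hx hx' i
  have b := pos_of_bspline_ne_zero hy hy' i
  rw [abs_le]; omega

/-- The remainder is `0` or `1`, and these two mask entries are positive. Thus halving the position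
yields a parent for every B-spline. -/
theorem mask_half_ne_zero (r : ℕ) (n : ℤ) : mask r (n - 2 * (n / 2)) ≠ 0 := by
  have h : n - 2 * (n / 2) = 0 ∨ n - 2 * (n / 2) = 1 := by omega
  rcases h with h | h <;> rw [h] <;> (simp [mask]; try positivity)

/-- The B-spline joining the two cells is contained, as regards supports, in a coarser one, which
joins the parents. -/
theorem supportExt_up {σ τ σ' τ' : Cell} (h : τ ∈ supportExt D r σ σ.level)
    (hσ : Desc σ σ') (hτ : Desc τ τ') (hlσ : σ.level = σ'.level + 1) (hlτ : τ.level = τ'.level + 1) :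
    τ' ∈ supportExt D r σ' σ'.level := by
  have hl := supportExt_level h
  have hg := supportExt_grid h
  obtain ⟨-, j, h1, h2⟩ := h
  have e : τ'.level = σ'.level := by omega
  have hsub : bsupp D r σ.level j ⊆ bsupp D r σ'.level (fun i => j i / 2) := by
    rw [hlσ]
    exact bsupp_subset_of_child (Finset.prod_ne_zero_iff.2 fun i _ => mask_half_ne_zero r (j i))
  refine ⟨?_, _, h1.mono (inter_subset_inter hsub (hτ.cellSet_subset D)),
    h2.mono (inter_subset_inter hsub (hσ.cellSet_subset D))⟩
  rw [← e]
  exact hτ.grid_iff.1 hg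

/-- In a strictly admissible partition, the support extension of a cell of the tree belongs to the
tree up to one level. -/
theorem TreeAdmissible.parent_inTree {P : Finset Cell} (hP : IsPartition D P)
    (h : TreeAdmissible D r P) {σ τ τ' : Cell} (hσ : InTree P σ)
    (hτ : τ ∈ supportExt D r σ σ.level) (hd : Desc τ τ') (hl : τ.level = τ'.level + 1) :
    InTree P τ' := by
  have hτl := supportExt_level hτ
  have hd' : Desc σ (up σ τ'.level) := desc_up (by omega)
  obtain ⟨ρ, hρ, hd''⟩ := hσ
  have hanc : up σ τ'.level ∈ ancestors P :=
    mem_ancestors.2 ⟨ρ, hρ, hd''.trans hd', by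
      have := hd''.level_le; simp only [up]; omega⟩
  have hmem : τ' ∈ supportExt D r (up σ τ'.level) τ'.level :=
    supportExt_up hτ hd' hd (by simp only [up]; omega) hl
  -- Tree admissibility says nothing about level `0`, but there every grid cell lies in the forest
  -- anyway.
  rcases Nat.eq_zero_or_pos τ'.level with h0 | h0
  · have hg : τ' ∈ grid D τ'.level := hd.mem_grid (supportExt_grid hτ)
    rcases hP.cover hg with h1 | ⟨ρ', h1, h2⟩
    · exact h1
    · rw [h2.eq_of_level_le (by omega)]; exact ⟨ρ', h1, Desc.refl _⟩
  · exact h _ hanc h0 τ' hmem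

/-! ### Levels of truncated B-splines on a cell -/

theorem refineCoeff_ne_zero {c : (Fin 2 → ℤ) → ℝ} {k : Fin 2 → ℤ} (h : refineCoeff r c k ≠ 0) :
    ∃ j, c j ≠ 0 ∧ ∏ i, mask r (k i - 2 * j i) ≠ 0 := by
  by_contra! h'
  refine h (finsum_eq_zero_of_forall_eq_zero fun j => ?_)
  by_cases hj : c j = 0
  · simp [hj]
  · simp [h' j hj]

theorem truncCoeff_succ_ne_zero {P : Finset Cell} {ℓ n : ℕ} {k j : Fin 2 → ℤ}
    (h : truncCoeff D r P ℓ k (n + 1) j ≠ 0) :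
    ¬ bsupp D r (ℓ + (n + 1)) j ⊆ subdomain D P (ℓ + (n + 1)) ∧
      ∃ j', truncCoeff D r P ℓ k n j' ≠ 0 ∧ ∏ i, mask r (j i - 2 * j' i) ≠ 0 := by
  rw [truncCoeff] at h
  dsimp only at h
  split_ifs at h with h'
  · exact absurd rfl h
  · exact ⟨h', refineCoeff_ne_zero h⟩

/-- A B-spline contributing to a truncated one descends from those of the previous levels. -/
theorem truncCoeff_descend {P : Finset Cell} {ℓ n m : ℕ} {k j : Fin 2 → ℤ} {x : Plane}
    (h : truncCoeff D r P ℓ k (n + m) j ≠ 0) (hx : bspline D r (ℓ + (n + m)) j x ≠ 0) :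
    ∃ j', truncCoeff D r P ℓ k n j' ≠ 0 ∧ bspline D r (ℓ + n) j' x ≠ 0 := by
  induction m generalizing j with
  | zero => exact ⟨j, h, hx⟩
  | succ m ih =>
    obtain ⟨-, j', h1, h2⟩ := truncCoeff_succ_ne_zero (n := n + m) h
    exact ih h1 (bspline_ne_zero_of_child h2 hx)

theorem thb_ne_zero {P : Finset Cell} {ℓ : ℕ} {k : Fin 2 → ℤ} {x : Plane}
    (h : thb D r P ℓ k x ≠ 0) : ∃ j, truncCoeff D r P ℓ k (depth P - ℓ) j ≠ 0 ∧
      bspline D r (ℓ + (depth P - ℓ)) j x ≠ 0 := by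
  by_contra! h'
  refine h (finsum_eq_zero_of_forall_eq_zero fun j => ?_)
  by_cases hj : truncCoeff D r P ℓ k (depth P - ℓ) j = 0
  · simp [hj]
  · simp [h' j hj]

/-- Truncation can only shrink the nonvanishing set: any contribution at `x` traces back to level
`ℓ`, where `k` carries the only nonzero coefficient. -/
theorem bspline_ne_zero_of_thb {P : Finset Cell} {ℓ : ℕ} {k : Fin 2 → ℤ} {x : Plane}
    (h : thb D r P ℓ k x ≠ 0) : bspline D r ℓ k x ≠ 0 := by
  obtain ⟨j, h1, h2⟩ := thb_ne_zero h
  rw [← zero_add (depth P - ℓ)] at h1 h2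
  obtain ⟨j', h3, h4⟩ := truncCoeff_descend h1 h2
  rw [truncCoeff] at h3
  have : j' = k := by
    by_contra hne
    exact h3 (Pi.single_eq_of_ne hne 1)
  rwa [this] at h4

theorem isClosed_subdomain (P : Finset Cell) (ℓ : ℕ) : IsClosed (subdomain D P ℓ) :=
  P.finite_toSet.isClosed_biUnion fun _ _ => isClosed_iUnion_of_finite fun _ => isClosed_closure

theorem closure_subset_of_cellSet_subset {P : Finset Cell} {ℓ : ℕ} {τ : Cell}
    (h : cellSet D τ ⊆ subdomain D P ℓ) : closure (cellSet D τ) ⊆ subdomain D P ℓ :=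
  closure_minimal h (isClosed_subdomain P ℓ)

/-- Every point of the domain lies in the closure of some cell of the uniform mesh. -/
theorem exists_grid_closure {x : Plane} (hx : x ∈ domain D) (ℓ : ℕ) :
    ∃ τ ∈ grid D ℓ, x ∈ closure (cellSet D τ) := by
  induction ℓ with
  | zero =>
    obtain ⟨τ, hτ, h⟩ := (isPartition_initialMesh D).exists_closure hx
    refine ⟨τ, ?_, h⟩
    have := (isPartition_initialMesh D).1 τ hτ
    obtain ⟨k, -, rfl⟩ := Finset.mem_image.1 hτ
    exact this
  | succ ℓ ih =>
    obtain ⟨τ, hτ, h⟩ := ih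
    have := closure_cellSet_subset_children D τ h
    simp only [mem_iUnion] at this
    obtain ⟨σ, hσ, hx⟩ := this
    rw [mem_children] at hσ
    have hl := grid_level hτ
    refine ⟨σ, ?_, hx⟩
    rw [← hl] at hτ ⊢
    rw [← hσ.1]
    exact hσ.2.grid_iff.2 hτ

/-- A B-spline which lives on a cell whose support extension lies in `Ω^ℓ` is supported there. -/
theorem bsupp_subset_of_supportExt (hr : 1 ≤ r) {P : Finset Cell} {τ : Cell} {k : Fin 2 → ℤ}
    (hS : ∀ τ' ∈ supportExt D r τ τ.level, cellSet D τ' ⊆ subdomain D P τ.level)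
    (h : (bsupp D r τ.level k ∩ cellSet D τ).Nonempty) :
    bsupp D r τ.level k ⊆ subdomain D P τ.level := by
  refine closure_minimal (fun x hx => ?_) (isClosed_subdomain P _)
  obtain ⟨τ', hτ', hc⟩ := exists_grid_closure hx.1 τ.level
  have hopen : IsOpen {y | bspline D r τ.level k y ≠ 0} :=
    isOpen_ne_fun (continuous_bspline hr _ _) continuous_const
  obtain ⟨y, hy, hy'⟩ := mem_closure_iff.1 hc _ hopen hx.2
  exact closure_subset_of_cellSet_subset (hS τ' ⟨hτ', k, bsupp_inter_of_ne_zero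
    (by rw [grid_level hτ']; exact hτ') hy' hy, h⟩) hc

/-- Otherwise `τ` would overlap a leaf of level at least `ℓ`, necessarily different from `τ`. -/
theorem level_le_of_active {P : Finset Cell} (hP : IsPartition D P) {τ : Cell} (hτ : τ ∈ P)
    {ℓ : ℕ} {k : Fin 2 → ℤ} (hk : IsActive D r P ℓ k)
    (h : (bsupp D r ℓ k ∩ cellSet D τ).Nonempty) : ℓ ≤ τ.level := by
  obtain ⟨x, hx, hx'⟩ := h
  have := hk.1 hx
  simp only [subdomain, mem_iUnion] at this
  obtain ⟨σ, hσ, hl, hc⟩ := this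
  obtain ⟨y, hy, hy'⟩ := cellSet_inter_of_closure D ⟨x, hx', hc⟩
  by_contra hlt
  refine Set.disjoint_left.1 (hP.2.1 τ hτ σ hσ ?_) hy hy'
  rintro rfl
  exact hlt hl

/-- On a cell `τ` of a strictly admissible partition there live only truncated B-splines of the
level of `τ` and of the previous level. -/
theorem thb_level (hr : 1 ≤ r) {P : Finset Cell} (hP : IsPartition D P)
    (hA : IsStrictlyAdmissible D r P) {τ : Cell} (hτ : τ ∈ P) {ℓ : ℕ} {k : Fin 2 → ℤ}
    (hk : IsActive D r P ℓ k)
    (h : (Function.support (thb D r P ℓ k) ∩ cellSet D τ).Nonempty) :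
    ℓ ≤ τ.level ∧ τ.level ≤ ℓ + 1 := by
  obtain ⟨x, hx, hxτ⟩ := h
  have hg := hP.1 τ hτ
  refine ⟨level_le_of_active hP hτ hk
    (bsupp_inter_of_ne_zero hg hxτ (bspline_ne_zero_of_thb hx)), ?_⟩
  by_contra! hlt
  have hdepth : τ.level ≤ depth P := Finset.le_sup hτ
  obtain ⟨j, h1, h2⟩ := thb_ne_zero hx
  -- Isolate the first truncation, to level `ℓ + 1`. It already removes everything on `τ`: if `τ`
  -- has level at least `ℓ + 2`, strict admissibility forces every B-spline of level `ℓ + 1` living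
  -- on `τ` to be supported in `Ω^{ℓ+1}`.
  obtain ⟨n, hn⟩ : ∃ n, depth P - ℓ = 0 + 1 + n := ⟨depth P - ℓ - 1, by omega⟩
  rw [hn] at h1 h2
  obtain ⟨j', h3, h4⟩ := truncCoeff_descend h1 h2
  refine (truncCoeff_succ_ne_zero h3).1 ?_
  have hx' : x ∈ subdomain D P (ℓ + 1 + 1) := by
    simp only [subdomain, mem_iUnion]
    exact ⟨τ, hτ, by omega, subset_closure hxτ⟩
  have := hA (ℓ + 1) (by omega) hx'
  simp only [auxSubdomain, mem_iUnion] at this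
  obtain ⟨σ, hσ, hS, hc⟩ := this
  have hσl := grid_level hσ
  have hd : Desc τ σ := desc_of_inter D (by omega) (cellSet_inter_of_closure D ⟨x, hxτ, hc⟩)
  rw [zero_add] at h4 ⊢
  rw [← hσl] at hS h4 ⊢
  exact bsupp_subset_of_supportExt hr hS
    (bsupp_inter_of_ne_zero (by rw [hσl]; exact hσ) (hd.cellSet_subset D hxτ) h4)

theorem IsStrictlyAdmissible.isAdmissible (hr : 1 ≤ r) {P : Finset Cell} (hP : IsPartition D P)
    (hA : IsStrictlyAdmissible D r P) : IsAdmissible D r P := by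
  intro τ hτ
  -- For a cell of level `0` the truncated subtraction gives `0`, and only `ℓ = 0` occurs.
  refine ⟨τ.level - 1, fun ℓ k hk h => ?_⟩
  have := thb_level hr hP hA hτ hk h
  omega

/-! ### The extent of the patches -/

/-- The open square of half side length `K` times that of `τ` around the lower left corner of `τ`. -/
def box (D : GridDomain) (K : ℝ) (τ : Cell) : Set Plane :=
  {x | ∀ i, |x i - D.origin i - side D τ.level * τ.pos i| < K * side D τ.level}

/-- A function living on `τ` is at most one level coarser than `τ`, so its support has width at most
`2 (r + 1)` sides of `τ`. A further cell `τ'` adds at most two sides and `τ` itself one, in total `2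
r + 5`; one more makes the inequality strict. -/
theorem patch_subset_box (hr : 1 ≤ r) {P : Finset Cell} (hP : IsPartition D P)
    (hA : IsStrictlyAdmissible D r P) {τ : Cell} (hτ : τ ∈ P) :
    patch D r P τ ⊆ box D (2 * r + 6) τ := by
  have hs := side_pos D τ.level
  have hcl : IsClosed {x : Plane | ∀ i, |x i - D.origin i - side D τ.level * τ.pos i| ≤
      (2 * r + 5) * side D τ.level} := by
    simp only [ofPred_forall]
    exact isClosed_iInter fun i => isClosed_le (by fun_prop) continuous_const
  have hsub : patch D r P τ ⊆ {x : Plane | ∀ i, |x i - D.origin i - side D τ.level * τ.pos i| ≤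
      (2 * r + 5) * side D τ.level} := by
    refine interior_subset.trans (closure_minimal (iUnion₂_subset ?_) hcl)
    rintro τ' ⟨hτ', ℓ, k, hk, h1, h2⟩ y hy i
    have l1 := thb_level hr hP hA hτ hk h1
    have l2 := thb_level hr hP hA hτ' hk h2
    obtain ⟨x, hx, hxτ⟩ := h1
    obtain ⟨x', hx', hxτ'⟩ := h2
    have a := cardinalBSpline_mem_Icc (bspline_factor (bspline_ne_zero_of_thb hx) i)
    have a' := cardinalBSpline_mem_Icc (bspline_factor (bspline_ne_zero_of_thb hx') i)
    have hsl := side_pos D ℓ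
    have e1 : side D ℓ ≤ 2 * side D τ.level := by
      have := side_anti D l1.2
      have h2 := side_add D ℓ 1
      linarith
    have e2 : side D τ'.level ≤ side D ℓ := side_anti D l2.1
    rw [sub_nonneg, le_div_iff₀ hsl, sub_le_iff_le_add, div_le_iff₀ hsl] at a a'
    have b := hxτ i
    have b' := hxτ' i
    have c := hy i
    have e3 : (r : ℝ) * side D ℓ ≤ r * (2 * side D τ.level) :=
      mul_le_mul_of_nonneg_left e1 (Nat.cast_nonneg r)
    rw [abs_le]
    constructor <;> nlinarith
  intro x hx i
  have := hsub hx i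
  linarith

theorem patch_subset_domain {P : Finset Cell} (hP : IsPartition D P) (τ : Cell) :
    patch D r P τ ⊆ domain D := by
  rw [← hP.2.2]
  refine interior_mono (closure_mono (iUnion₂_subset fun τ' hτ' => ?_))
  exact subset_biUnion_of_mem (u := fun τ => cellSet D τ) hτ'.1

theorem cellSet_subset_box {K : ℝ} (hK : 1 ≤ K) (τ : Cell) : cellSet D τ ⊆ box D K τ := by
  intro x hx i
  have hs := side_pos D τ.level
  obtain ⟨h1, h2⟩ := hx i
  rw [abs_lt]
  constructor <;> nlinarith

end AdaptiveSpline

namespace AdaptiveSpline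

/-! ### Recursive refinement -/

variable {D : GridDomain} {r : ℕ}

/-- `Q` arises from the partition `P` by refinement of cells with the property `W`. -/
structure Refines (D : GridDomain) (r : ℕ) (W : Cell → Prop) (P Q : Finset Cell) : Prop where
  isPartition : IsPartition D Q
  treeAdmissible : TreeAdmissible D r Q
  ancestors_subset : ancestors P ⊆ ancestors Q
  inTree : ∀ σ ∈ P, InTree Q σ
  card_le : Q.card + 3 * (ancestors P).card ≤ P.card + 3 * (ancestors Q).card
  new : ∀ σ ∈ ancestors Q, σ ∉ ancestors P → W σ

namespace Refines

variable {W W' : Cell → Prop} {P Q R : Finset Cell}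

theorem rfl' (hP : IsPartition D P) (hA : TreeAdmissible D r P) : Refines D r W P P :=
  ⟨hP, hA, subset_rfl, fun σ hσ => ⟨σ, hσ, Desc.refl σ⟩, le_rfl, fun _ h h' => absurd h h'⟩

theorem inTree_mono (h : Refines D r W P Q) {σ : Cell} (hσ : InTree P σ) : InTree Q σ := by
  obtain ⟨τ, hτ, hd⟩ := hσ
  exact (h.inTree τ hτ).of_desc hd

theorem trans (h : Refines D r W P Q) (h' : Refines D r W Q R) : Refines D r W P R where
  isPartition := h'.isPartition
  treeAdmissible := h'.treeAdmissible
  ancestors_subset := h.ancestors_subset.trans h'.ancestors_subset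
  inTree σ hσ := h'.inTree_mono (h.inTree σ hσ)
  card_le := by have := h.card_le; have := h'.card_le; omega
  new σ h1 h2 := by
    by_cases h3 : σ ∈ ancestors Q
    · exact h.new σ h3 h2
    · exact h'.new σ h1 h3

theorem mono (h : Refines D r W P Q) (hW : ∀ σ, W σ → W' σ) : Refines D r W' P Q :=
  { h with new := fun σ h1 h2 => hW σ (h.new σ h1 h2) }

end Refines

/-- When `τ` is a leaf, it is the only new ancestor, and `hS` is precisely the admissibility
condition for it. When `τ` has already been refined, `split` does nothing; for this reason
membership in the forest is assumed and not membership in `P`. -/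
theorem refines_split {W : Cell → Prop} {P : Finset Cell} {τ : Cell} (hP : IsPartition D P)
    (hA : TreeAdmissible D r P) (hτ : InTree P τ) (hW : W τ)
    (hS : 1 ≤ τ.level → ∀ σ ∈ supportExt D r τ τ.level, InTree P σ) :
    Refines D r W P (split P τ) ∧ τ ∈ ancestors (split P τ) := by
  by_cases h : τ ∈ P
  · have e := ancestors_split h
    have hin : ∀ σ ∈ P, InTree (split P τ) σ := by
      intro σ hσ
      rw [inTree_iff, e]
      by_cases h' : σ = τ
      · exact Or.inr (h' ▸ Finset.mem_insert_self _ _)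
      · exact Or.inl ((mem_split h).2 (Or.inl ⟨hσ, h'⟩))
    have hin' : ∀ σ, InTree P σ → InTree (split P τ) σ := by
      rintro σ ⟨ρ, hρ, hd⟩
      exact (hin ρ hρ).of_desc hd
    refine ⟨⟨hP.split h, ?_, ?_, hin, ?_, ?_⟩, by rw [e]; exact Finset.mem_insert_self _ _⟩
    · intro σ hσ hl ρ hρ
      rw [e, Finset.mem_insert] at hσ
      rcases hσ with rfl | hσ
      · exact hin' _ (hS hl ρ hρ)
      · exact hin' _ (hA σ hσ hl ρ hρ)
    · rw [e]; exact Finset.subset_insert _ _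
    · have := card_split_le h
      rw [e, Finset.card_insert_of_notMem (hP.notMem_ancestors h)]
      omega
    · intro σ h1 h2
      rw [e, Finset.mem_insert] at h1
      rcases h1 with rfl | h1
      · exact hW
      · exact absurd h1 h2
  · have e : split P τ = P := if_neg h
    rw [e]
    exact ⟨Refines.rfl' hP hA, (inTree_iff.1 hτ).resolve_left h⟩

/-- The loop body is controlled on every intermediate partition `Q`, since earlier iterations may
already have refined later entries. Ancestors are never lost, so all entries end up refined whatever
the order. -/
theorem refines_foldl {W : Cell → Prop} (F : Finset Cell → Cell → Finset Cell) (l : List Cell)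
    (hF : ∀ τ ∈ l, ∀ Q, IsPartition D Q → TreeAdmissible D r Q → InTree Q τ →
      Refines D r W Q (F Q τ) ∧ τ ∈ ancestors (F Q τ))
    {P : Finset Cell} (hP : IsPartition D P) (hA : TreeAdmissible D r P)
    (hl : ∀ τ ∈ l, InTree P τ) :
    Refines D r W P (l.foldl F P) ∧ ∀ τ ∈ l, τ ∈ ancestors (l.foldl F P) := by
  induction l generalizing P with
  | nil => exact ⟨Refines.rfl' hP hA, by simp⟩
  | cons a l ih =>
    obtain ⟨h1, h2⟩ := hF a (by simp) P hP hA (hl a (by simp))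
    obtain ⟨h3, h4⟩ := ih (fun τ hτ => hF τ (by simp [hτ])) h1.isPartition h1.treeAdmissible
      (fun τ hτ => h1.inTree_mono (hl τ (by simp [hτ])))
    refine ⟨h1.trans h3, fun τ hτ => ?_⟩
    rcases List.mem_cons.1 hτ with rfl | hτ
    · exact h3.ancestors_subset h2
    · exact h4 τ hτ

/-! ### Locality and correctness of the recursion -/

/-- `σ` is a cell of at most the level of `τ` whose distance to `τ` is bounded in terms of its own
size. -/
def NearTo (r : ℕ) (τ σ : Cell) : Prop :=
  ∃ j : ℕ, τ.level = σ.level + j ∧ ∀ i, |2 ^ j * σ.pos i - τ.pos i| ≤ (r + 1) * (2 ^ j - 1)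

theorem NearTo.refl (r : ℕ) (τ : Cell) : NearTo r τ τ := ⟨0, by simp⟩

/-- The bound in `NearTo` is the solution of the recursion for the offsets: `2 (r + 1)(2^j - 1) + (r
+ 1) = (r + 1)(2^(j+1) - 1)`. -/
theorem NearTo.of_neighbour {τ τ' σ : Cell} (hl : τ.level = τ'.level + 1)
    (h : ∀ i, |2 * τ'.pos i - τ.pos i| ≤ r + 1) (h' : NearTo r τ' σ) : NearTo r τ σ := by
  obtain ⟨j, h1, h2⟩ := h'
  refine ⟨j + 1, by omega, fun i => ?_⟩
  have a := h i
  have b := h2 i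
  rw [abs_le] at a b ⊢
  rw [pow_succ]
  constructor <;> nlinarith

theorem mem_neighbourhood {P : Finset Cell} {τ τ' : Cell} :
    τ' ∈ neighbourhood D r P τ ↔ τ' ∈ P ∧ τ'.level + 1 = τ.level ∧
      ∃ τ'' ∈ supportExt D r τ τ.level, cellSet D τ'' ⊆ cellSet D τ' := by
  simp [neighbourhood]

theorem desc_of_cellSet_subset {σ τ : Cell} (hl : τ.level ≤ σ.level)
    (h : cellSet D σ ⊆ cellSet D τ) : Desc σ τ := by
  obtain ⟨x, hx⟩ := cellSet_nonempty D σ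
  exact desc_of_inter D hl ⟨x, hx, h hx⟩

/-- The cell `τ''` of the support extension is off by at most `r`, and passing to its parent and
doubling the position loses at most one more. -/
theorem neighbourhood_near {P : Finset Cell} {τ τ' : Cell} (h : τ' ∈ neighbourhood D r P τ)
    (i : Fin 2) : |2 * τ'.pos i - τ.pos i| ≤ r + 1 := by
  obtain ⟨-, hl, τ'', h1, h2⟩ := mem_neighbourhood.1 h
  have hl' := supportExt_level h1
  obtain ⟨n, hn, hd⟩ := desc_of_cellSet_subset (by omega) h2
  obtain rfl : n = 1 := by omega
  have a := supportExt_pos h1 i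
  have b := hd i
  rw [pow_one] at b
  rw [abs_le] at a ⊢
  omega

variable {enum : Finset Cell → List Cell}

theorem mem_enum (he : ∀ s : Finset Cell, (enum s : Multiset Cell) = s.val) {s : Finset Cell}
    {τ : Cell} : τ ∈ enum s ↔ τ ∈ s := by
  rw [← Multiset.mem_coe, he, Finset.mem_val]

/-- Admissibility of `P` puts the parents of all cells of the support extension of `τ` in the
forest. The missing cells are thus children of leaves, and these leaves form the neighbourhood.
After the loop they have been split, so `τ` may be split safely. -/
theorem refines_recursiveRefineAux (he : ∀ s : Finset Cell, (enum s : Multiset Cell) = s.val)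
    (n : ℕ) (τ : Cell) (hn : τ.level = n) {P : Finset Cell} (hP : IsPartition D P)
    (hA : TreeAdmissible D r P) (hτ : InTree P τ) :
    Refines D r (NearTo r τ) P (recursiveRefineAux D r enum n P τ) ∧
      τ ∈ ancestors (recursiveRefineAux D r enum n P τ) := by
  induction n generalizing τ P with
  | zero => exact refines_split hP hA hτ (NearTo.refl r τ) (fun h => absurd h (by omega))
  | succ n ih =>
    obtain ⟨h1, h2⟩ := refines_foldl (r := r) (W := NearTo r τ) (recursiveRefineAux D r enum n)
      (enum (neighbourhood D r P τ)) (fun τ' hτ' Q hQ hQA hin => by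
        rw [mem_enum he] at hτ'
        have hl := (mem_neighbourhood.1 hτ').2.1
        obtain ⟨h1, h2⟩ := ih τ' (by omega) hQ hQA hin
        exact ⟨h1.mono fun σ => NearTo.of_neighbour hl.symm (neighbourhood_near hτ'), h2⟩)
      hP hA (fun τ' hτ' => by
        rw [mem_enum he] at hτ'
        exact ⟨τ', (mem_neighbourhood.1 hτ').1, Desc.refl _⟩)
    have h3 := refines_split (r := r) (W := NearTo r τ) h1.isPartition h1.treeAdmissible
      (h1.inTree_mono hτ) (NearTo.refl r τ) (fun hl σ hσ => by
        have hσl := supportExt_level hσ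
        have hd : Desc σ (up σ n) := desc_up (by omega)
        -- If `σ` is not yet in the forest of `P`, the leaf above it is its parent, which belongs to
        -- the neighbourhood.
        rcases hP.cover (supportExt_grid hσ) with h | ⟨ρ, hρ, hσρ⟩
        · exact h1.inTree_mono h
        · have hin := hA.parent_inTree hP hτ hσ hd (by simp only [up]; omega)
          rcases hσρ.level_le.lt_or_eq with hlt | heq
          · have hup : Desc (up σ n) ρ := hσρ.comparable hd (by simp only [up]; omega)
            obtain ⟨ρ', hρ', hd'⟩ := hin
            obtain rfl := hP.eq_of_desc hρ' hρ (hd'.trans hup)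
            have hlρ : ρ'.level = n := by
              have := hd'.level_le
              simp only [up] at this
              omega
            have hmem := h2 ρ' ((mem_enum he).2 (mem_neighbourhood.2
              ⟨hρ', by omega, σ, hσ, hσρ.cellSet_subset D⟩))
            obtain ⟨ρ₁, h4, h5, h6⟩ := mem_ancestors.1 hmem
            -- The parent `ρ'` now has a leaf `ρ₁` strictly below it. A new leaf above `σ` of level
            -- at most `n` would contain `ρ'`, hence coincide with `ρ₁`, which is finer than that.
            rcases h1.isPartition.cover (supportExt_grid hσ) with h | ⟨ρ₂, h7, h8⟩
            · exact h
            · rcases Nat.lt_or_ge n ρ₂.level with h9 | h9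
              · rw [h8.eq_of_level_le (by omega)]
                exact ⟨ρ₂, h7, Desc.refl _⟩
              · have h10 : Desc ρ' ρ₂ := h8.comparable hσρ (by omega)
                obtain rfl := h1.isPartition.eq_of_desc h4 h7 (h5.trans h10)
                omega
          · rw [hσρ.eq_of_level_le heq.ge]
            exact h1.inTree ρ hρ)
    exact ⟨h1.trans h3.1, h3.2⟩

theorem refines_refine (he : ∀ s : Finset Cell, (enum s : Multiset Cell) = s.val)
    {W : Cell → Prop} {P M : Finset Cell} (hP : IsPartition D P) (hA : TreeAdmissible D r P)
    (hM : M ⊆ P) (hW : ∀ τ ∈ M, ∀ σ, NearTo r τ σ → W σ) :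
    Refines D r W P (refine D r enum P M) ∧ M ⊆ ancestors (refine D r enum P M) := by
  obtain ⟨h1, h2⟩ := refines_foldl (r := r) (W := W) (recursiveRefine D r enum) (enum M)
    (fun τ hτ Q hQ hQA hin => by
      obtain ⟨h1, h2⟩ := refines_recursiveRefineAux he τ.level τ rfl hQ hQA hin
      exact ⟨h1.mono (hW τ ((mem_enum he).1 hτ)), h2⟩)
    hP hA (fun τ hτ => ⟨τ, hM ((mem_enum he).1 hτ), Desc.refl _⟩)
  exact ⟨h1, fun τ hτ => h2 τ ((mem_enum he).2 hτ)⟩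

end AdaptiveSpline

namespace AdaptiveSpline

/-! ### Local geometry of the domain -/

variable {D : GridDomain}

/-- The closed square of level `0` at position `k`. -/
def closedSquare (D : GridDomain) (k : Fin 2 → ℤ) : Set Plane :=
  {x | ∀ i, D.h₀ * k i ≤ x i - D.origin i ∧ x i - D.origin i ≤ D.h₀ * (k i + 1)}

theorem closure_cellSet_zero (D : GridDomain) (k : Fin 2 → ℤ) :
    closure (cellSet D ⟨0, k⟩) = closedSquare D k := by
  rw [closure_cellSet]
  simp [closedSquare, side]

/-- A point lies in the domain if and only if all closed squares containing it belong to the initial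
mesh. -/
theorem mem_domain_iff {x : Plane} : x ∈ domain D ↔ ∀ k, x ∈ closedSquare D k → k ∈ D.base := by
  have hh := D.h₀_pos
  have hcl : closure (⋃ k ∈ D.base, cellSet D ⟨0, k⟩) = ⋃ k ∈ D.base, closedSquare D k := by
    simp only [← closure_cellSet_zero]
    exact D.base.finite_toSet.closure_biUnion _
  constructor
  · intro hx k hk
    rw [← closure_cellSet_zero] at hk
    obtain ⟨y, hy, hyk⟩ := mem_closure_iff.1 hk _ isOpen_interior hx
    have := interior_subset hy
    rw [hcl] at this
    simp only [← closure_cellSet_zero, mem_iUnion] at this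
    obtain ⟨k', hk', hy'⟩ := this
    have hd : Desc ⟨0, k⟩ ⟨0, k'⟩ :=
      desc_of_inter D le_rfl (cellSet_inter_of_closure D ⟨y, hyk, hy'⟩)
    have := hd.eq_of_level_le le_rfl
    simp only [Cell.mk.injEq, true_and] at this
    rwa [this]
  · intro h
    rw [domain, hcl, mem_interior_iff_mem_nhds]
    -- In this neighbourhood the square obtained from `y` by rounding down also contains `x` in its
    -- closure, so it belongs to the initial mesh.
    have hev : ∀ i, ∀ᶠ y : Plane in nhds x,
        D.h₀ * (⌈(x i - D.origin i) / D.h₀⌉ - 1) < y i - D.origin i ∧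
          y i - D.origin i < D.h₀ * (⌊(x i - D.origin i) / D.h₀⌋ + 1) := by
      intro i
      have hc : Continuous fun y : Plane => y i - D.origin i := by fun_prop
      refine (hc.continuousAt.eventually_const_lt ?_).and (hc.continuousAt.eventually_lt_const ?_)
      · rw [← lt_div_iff₀' hh]
        linarith [Int.ceil_lt_add_one ((x i - D.origin i) / D.h₀)]
      · rw [← div_lt_iff₀' hh]
        exact Int.lt_floor_add_one _
    filter_upwards [Filter.eventually_all.2 hev] with y hy
    simp only [mem_iUnion]
    have hyk : y ∈ closedSquare D (fun i => ⌊(y i - D.origin i) / D.h₀⌋) := by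
      intro i
      rw [← le_div_iff₀' hh, ← div_le_iff₀' hh]
      exact ⟨Int.floor_le _, (Int.lt_floor_add_one _).le⟩
    refine ⟨_, h _ fun i => ?_, hyk⟩
    obtain ⟨h1, h2⟩ := hyk i
    obtain ⟨h3, h4⟩ := hy i
    have h5 := lt_of_mul_lt_mul_left (h1.trans_lt h4) hh.le
    have h6 := lt_of_mul_lt_mul_left (h3.trans_le h2) hh.le
    have h7 : ⌊(y i - D.origin i) / D.h₀⌋ ≤ ⌊(x i - D.origin i) / D.h₀⌋ := by
      have : ⌊(y i - D.origin i) / D.h₀⌋ < ⌊(x i - D.origin i) / D.h₀⌋ + 1 := by exact_mod_cast h5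
      omega
    have h8 : ⌈(x i - D.origin i) / D.h₀⌉ ≤ ⌊(y i - D.origin i) / D.h₀⌋ + 1 := by
      have : ⌈(x i - D.origin i) / D.h₀⌉ - 1 < ⌊(y i - D.origin i) / D.h₀⌋ + 1 := by
        rw [← Int.cast_lt (R := ℝ)]
        push_cast
        exact h6
      omega
    rw [← le_div_iff₀' hh, ← div_le_iff₀' hh]
    constructor
    · exact (Int.cast_le.2 h7).trans (Int.floor_le _)
    · refine (Int.le_ceil _).trans ?_
      rw [← Int.cast_le (R := ℝ)] at h8
      push_cast at h8
      exact h8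

/-! ### Translating short segments inside the domain -/

/-- The closed half line on one side of zero. -/
def OnSide (e : Bool) (a : ℝ) : Prop := if e then 0 ≤ a else a ≤ 0

theorem onSide_zero (e : Bool) : OnSide e 0 := by cases e <;> simp [OnSide]

theorem onSide_or (e : Bool) (a : ℝ) : OnSide e a ∨ OnSide (!e) a := by
  cases e <;> simp [OnSide, le_total]

/-- The sign pointing to a side of zero. -/
def sideSign (e : Bool) : ℝ := if e then 1 else -1

theorem OnSide.of_add {e : Bool} {a w : ℝ} (hw : 0 ≤ sideSign (!e) * w) (h : OnSide e (a + w)) :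
    OnSide e a := by
  cases e <;> simp [OnSide, sideSign] at * <;> linarith

theorem onSide_iff_of_strict {e f : Bool} {a w : ℝ} (ha : 0 < sideSign e * a)
    (hw : 0 ≤ sideSign e * w) (h : OnSide f (a + w)) : f = e := by
  cases e <;> cases f <;> simp [OnSide, sideSign] at * <;> linarith

theorem onSide_of_strict {e : Bool} {a : ℝ} (ha : 0 < sideSign e * a) : OnSide e a := by
  cases e <;> simp [OnSide, sideSign] at * <;> linarith

theorem exists_zero_or_sign {a : ℝ → ℝ} (ha : Continuous a) :
    (∃ t ∈ Icc (0 : ℝ) 1, a t = 0) ∨ ∃ e, ∀ t ∈ Icc (0 : ℝ) 1, 0 < sideSign e * a t := by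
  by_cases h1 : ∀ t ∈ Icc (0 : ℝ) 1, 0 < a t
  · exact Or.inr ⟨true, by simpa [sideSign] using h1⟩
  by_cases h2 : ∀ t ∈ Icc (0 : ℝ) 1, a t < 0
  · exact Or.inr ⟨false, by simpa [sideSign] using h2⟩
  push Not at h1 h2
  obtain ⟨t, ht, h1⟩ := h1
  obtain ⟨t', ht', h2⟩ := h2
  obtain ⟨z, hz, h⟩ := isPreconnected_Icc.intermediate_value ht ht' ha.continuousOn ⟨h1, h2⟩
  exact Or.inl ⟨z, hz, h⟩

/-- If a curve avoids some of the four closed quadrants, then it keeps avoiding them if it is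
translated in the direction of a suitable quadrant. -/
theorem exists_sign_of_quadrants {B : Bool → Bool → Prop} {a b : ℝ → ℝ} (ha : Continuous a)
    (hb : Continuous b)
    (h : ∀ t ∈ Icc (0 : ℝ) 1, ∀ e f, OnSide e (a t) → OnSide f (b t) → B e f) :
    ∃ d₀ d₁ : Bool, ∀ t ∈ Icc (0 : ℝ) 1, ∀ w₀ w₁ : ℝ, 0 ≤ sideSign d₀ * w₀ →
      0 ≤ sideSign d₁ * w₁ → ∀ e f, OnSide e (a t + w₀) → OnSide f (b t + w₁) → B e f := by
  rcases exists_zero_or_sign ha with ⟨t₀, ht₀, h₀⟩ | ⟨d₀, h₀⟩ <;>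
  rcases exists_zero_or_sign hb with ⟨t₁, ht₁, h₁⟩ | ⟨d₁, h₁⟩
  -- Both coordinates vanish somewhere. If a quadrant `(e, f)` is missing, translate away from it. A
  -- translated point on side `e` or `f` comes from a point on that side. The opposite quadrant is
  -- present because the curve meets the axis `a = 0`, and it can do so only on the side away from
  -- `(e, f)`.
  · by_cases hB : ∀ e f, B e f
    · exact ⟨true, true, fun t _ w₀ w₁ _ _ e f _ _ => hB e f⟩
    push Not at hB
    obtain ⟨e, f, hef⟩ := hB
    refine ⟨!e, !f, fun t ht w₀ w₁ hw₀ hw₁ e' f' he' hf' => ?_⟩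
    by_contra hB
    have hx : ∀ g : Bool, g = e ∨ g = !e := fun g => by cases g <;> cases e <;> simp
    have hy : ∀ g : Bool, g = f ∨ g = !f := fun g => by cases g <;> cases f <;> simp
    rcases hx e' with rfl | rfl <;> rcases hy f' with rfl | rfl
    · exact hef (h t ht _ _ (he'.of_add hw₀) (hf'.of_add hw₁))
    · rcases onSide_or f (b t) with h2 | h2
      · exact hef (h t ht _ _ (he'.of_add hw₀) h2)
      · exact hB (h t ht _ _ (he'.of_add hw₀) h2)
    · rcases onSide_or e (a t) with h2 | h2
      · exact hef (h t ht _ _ h2 (hf'.of_add hw₁))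
      · exact hB (h t ht _ _ h2 (hf'.of_add hw₁))
    · rcases onSide_or f (b t₀) with h2 | h2
      · exact hef (h t₀ ht₀ _ _ (h₀ ▸ onSide_zero _) h2)
      · exact hB (h t₀ ht₀ _ _ (h₀ ▸ onSide_zero _) h2)
  -- The second coordinate keeps its strict sign under the translation, and at the zero `t₀` of the
  -- first one both quadrants of that sign are met; the first direction is arbitrary.
  · refine ⟨true, d₁, fun t ht w₀ w₁ hw₀ hw₁ e f he hf => ?_⟩
    obtain rfl := onSide_iff_of_strict (h₁ t ht) hw₁ hf
    exact h t₀ ht₀ _ _ (h₀ ▸ onSide_zero _) (onSide_of_strict (h₁ t₀ ht₀))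
  · refine ⟨d₀, true, fun t ht w₀ w₁ hw₀ hw₁ e f he hf => ?_⟩
    obtain rfl := onSide_iff_of_strict (h₀ t ht) hw₀ he
    exact h t₁ ht₁ _ _ (onSide_of_strict (h₀ t₁ ht₁)) (h₁ ▸ onSide_zero _)
  · refine ⟨d₀, d₁, fun t ht w₀ w₁ hw₀ hw₁ e f he hf => ?_⟩
    obtain rfl := onSide_iff_of_strict (h₀ t ht) hw₀ he
    obtain rfl := onSide_iff_of_strict (h₁ t ht) hw₁ hf
    exact h t ht _ _ (onSide_of_strict (h₀ t ht)) (onSide_of_strict (h₁ t ht))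

/-- The domain in the vicinity of a grid point `n`. -/
theorem mem_domain_iff_quadrants {n : Fin 2 → ℤ} {z : Plane}
    (hz : ∀ i, |z i - D.origin i - D.h₀ * n i| < D.h₀) :
    z ∈ domain D ↔ ∀ e f, OnSide e (z 0 - D.origin 0 - D.h₀ * n 0) →
      OnSide f (z 1 - D.origin 1 - D.h₀ * n 1) →
        ![n 0 - (if e then 0 else 1), n 1 - (if f then 0 else 1)] ∈ D.base := by
  have hh := D.h₀_pos
  have key : ∀ (i : Fin 2) (e : Bool), OnSide e (z i - D.origin i - D.h₀ * n i) ↔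
      (D.h₀ * (n i - (if e then 0 else 1) : ℤ) ≤ z i - D.origin i ∧
        z i - D.origin i ≤ D.h₀ * ((n i - (if e then 0 else 1) : ℤ) + 1)) := by
    intro i e
    have := abs_lt.1 (hz i)
    cases e <;> simp [OnSide] <;> intro h <;> nlinarith [h]
  rw [mem_domain_iff]
  constructor
  · intro h e f he hf
    refine h _ fun i => ?_
    fin_cases i
    · exact (key 0 e).1 he
    · exact (key 1 f).1 hf
  · intro h k hk
    have hex : ∀ i, ∃ e : Bool, k i = n i - (if e then 0 else 1) := by
      intro i
      obtain ⟨h1, h2⟩ := hk i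
      have := abs_lt.1 (hz i)
      have a1 : (k i : ℝ) < n i + 1 := by
        refine lt_of_mul_lt_mul_left (a := D.h₀) ?_ hh.le
        linarith
      have a2 : (n i : ℝ) - 1 < k i + 1 := by
        refine lt_of_mul_lt_mul_left (a := D.h₀) ?_ hh.le
        linarith
      have b1 : k i < n i + 1 := by exact_mod_cast a1
      have b2 : n i - 1 < k i + 1 := by exact_mod_cast a2
      by_cases hki : k i = n i
      · exact ⟨true, by simp [hki]⟩
      · exact ⟨false, by simp; omega⟩
    choose e he using hex
    have hkk : k = ![n 0 - (if e 0 then 0 else 1), n 1 - (if e 1 then 0 else 1)] := by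
      funext i
      fin_cases i
      · exact he 0
      · exact he 1
    rw [hkk]
    refine h _ _ ((key 0 _).2 ?_) ((key 1 _).2 ?_)
    · rw [← he 0]; exact hk 0
    · rw [← he 1]; exact hk 1

/-- A short segment in the domain stays in the domain if it is slightly translated in the direction
of a suitable quadrant. -/
theorem exists_sign_translate {x y : Plane} (hxy : segment ℝ x y ⊆ domain D)
    (hd : ∀ i, |y i - x i| ≤ D.h₀ / 8) :
    ∃ d : Fin 2 → Bool, ∀ z ∈ segment ℝ x y, ∀ w : Plane,
      (∀ i, 0 ≤ sideSign (d i) * w i ∧ |w i| ≤ D.h₀ / 8) → z + w ∈ domain D := by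
  have hh := D.h₀_pos
  -- At the nearest grid point the distances add up to at most `1/2 + 1/8 + 1/8 < 1` mesh widths, so
  -- only the four squares around it matter.
  set n : Fin 2 → ℤ := fun i => round ((x i - D.origin i) / D.h₀) with hn
  have hxn : ∀ i, |x i - D.origin i - D.h₀ * n i| ≤ D.h₀ / 2 := by
    intro i
    have h1 := abs_sub_round ((x i - D.origin i) / D.h₀)
    have h2 : x i - D.origin i - D.h₀ * n i = D.h₀ * ((x i - D.origin i) / D.h₀ - n i) := by
      field_simp
    rw [h2, abs_mul, abs_of_pos hh]
    nlinarith
  have hz : ∀ t ∈ Icc (0 : ℝ) 1, ∀ w : Plane, (∀ i, |w i| ≤ D.h₀ / 8) →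
      ∀ i, |(x + t • (y - x) + w) i - D.origin i - D.h₀ * n i| < D.h₀ := by
    intro t ht w hw i
    have h1 := abs_le.1 (hxn i)
    have h2 := abs_le.1 (hw i)
    have h3 : |t * (y i - x i)| ≤ D.h₀ / 8 := by
      rw [abs_mul, abs_of_nonneg ht.1]
      nlinarith [hd i, ht.2, abs_nonneg (y i - x i)]
    have h4 := abs_le.1 h3
    simp only [PiLp.add_apply, PiLp.smul_apply, PiLp.sub_apply, smul_eq_mul]
    rw [abs_lt]
    constructor <;> linarith
  obtain ⟨d₀, d₁, hd⟩ := exists_sign_of_quadrants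
    (B := fun e f => ![n 0 - (if e then 0 else 1), n 1 - (if f then 0 else 1)] ∈ D.base)
    (a := fun t => x 0 + t * (y 0 - x 0) - D.origin 0 - D.h₀ * n 0)
    (b := fun t => x 1 + t * (y 1 - x 1) - D.origin 1 - D.h₀ * n 1)
    (by fun_prop) (by fun_prop) (by
      intro t ht
      have h1 : x + t • (y - x) ∈ domain D := by
        refine hxy ?_
        rw [segment_eq_image']
        exact ⟨t, ht, rfl⟩
      have h2 := hz t ht 0 (fun i => by simpa using by positivity)
      rw [add_zero] at h2
      exact (mem_domain_iff_quadrants h2).1 h1)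
  refine ⟨![d₀, d₁], fun z hzs w hw => ?_⟩
  rw [segment_eq_image'] at hzs
  obtain ⟨t, ht, rfl⟩ := hzs
  rw [mem_domain_iff_quadrants (hz t ht w fun i => (hw i).2)]
  intro e f he hf
  refine hd t ht (w 0) (w 1) (hw 0).1 (hw 1).1 e f ?_ ?_
  · convert he using 1
    simp only [PiLp.add_apply, PiLp.smul_apply, PiLp.sub_apply, smul_eq_mul]
    ring
  · convert hf using 1
    simp only [PiLp.add_apply, PiLp.smul_apply, PiLp.sub_apply, smul_eq_mul]
    ring

end AdaptiveSpline

namespace AdaptiveSpline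

/-! ### Identities for differences -/

theorem fwdDiff_iter_eq_sum (m : ℕ) (h : Plane) (f : Plane → ℝ) (x : Plane) :
    (fwdDiff h)^[m] f x =
      ∑ k ∈ Finset.range (m + 1), (-1 : ℝ) ^ (m - k) * m.choose k * f (x + k • h) := by
  rw [fwdDiff_iter_eq_sum_shift]
  refine Finset.sum_congr rfl fun k _ => ?_
  simp

theorem measurable_fwdDiff_iter {f : Plane → ℝ} (hf : Measurable f) (m : ℕ) :
    Measurable fun q : Plane × Plane => (fwdDiff q.1)^[m] f q.2 := by
  simp only [fwdDiff_iter_eq_sum]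
  refine Finset.measurable_sum _ fun k _ => ?_
  refine (hf.comp ?_).const_mul _
  fun_prop

theorem neg_one_pow_swap {m k l : ℕ} (hk : k ≤ m) (hl : l ≤ m) :
    (-1 : ℝ) ^ k * (-1) ^ (m - l) = (-1) ^ l * (-1) ^ (m - k) := by
  obtain ⟨a, rfl⟩ := Nat.exists_eq_add_of_le hk
  obtain ⟨b, hb⟩ := Nat.exists_eq_add_of_le hl
  have e1 : k + a - l = b := by omega
  have e2 : k + a - k = a := by omega
  rw [e1, e2, ← pow_add, ← pow_add]
  rcases Nat.even_or_odd (k + b) with h | h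
  · rw [h.neg_one_pow, Even.neg_one_pow]
    rw [Nat.even_iff] at *; omega
  · rw [h.neg_one_pow, Odd.neg_one_pow]
    rw [Nat.odd_iff] at *; omega

/-- A difference with step `h` in terms of differences with steps `h + l g` and `l g`. -/
theorem sum_fwdDiff_eq (m : ℕ) (h g : Plane) (f : Plane → ℝ) (x : Plane) :
    ∑ k ∈ Finset.range (m + 1), (-1 : ℝ) ^ k * m.choose k * (fwdDiff (h + k • g))^[m] f x =
      ∑ l ∈ Finset.range (m + 1), (-1 : ℝ) ^ l * m.choose l *
        (fwdDiff (l • g))^[m] f (x + l • h) := by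
  simp only [fwdDiff_iter_eq_sum, Finset.mul_sum]
  rw [Finset.sum_comm]
  refine Finset.sum_congr rfl fun l hl => Finset.sum_congr rfl fun k hk => ?_
  rw [Finset.mem_range] at hl hk
  have e : x + l • (h + k • g) = x + l • h + k • l • g := by
    rw [smul_add, smul_comm k l, add_assoc]
  rw [e]
  -- Both sides are the same double sum over the values `f (x + l h + k l g)`; the signs agree
  -- because `k + m - l` and `l + m - k` have equal parity.
  have := neg_one_pow_swap (m := m) (k := k) (l := l) (by omega) (by omega)
  linear_combination ((m.choose k : ℝ) * m.choose l * f (x + l • h + k • l • g)) * this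

theorem fwdDiff_zero_iter {m : ℕ} (hm : 1 ≤ m) (f : Plane → ℝ) (x : Plane) :
    (fwdDiff (0 : Plane))^[m] f x = 0 := by
  obtain ⟨n, rfl⟩ := Nat.exists_eq_add_of_le' hm
  have : ∀ g : Plane → ℝ, fwdDiff (0 : Plane) g = 0 := by
    intro g; funext y; simp [fwdDiff]
  rw [Function.iterate_succ_apply', this]
  rfl

theorem enorm_mul_choose_le {m l : ℕ} (c : ℝ) (hc : |c| = 1) (a : ℝ) :
    ‖c * m.choose l * a‖ₑ ≤ 2 ^ m * ‖a‖ₑ := by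
  rw [enorm_mul]
  refine mul_le_mul_left ?_ _
  rw [enorm_mul, Real.enorm_eq_ofReal_abs, hc, ENNReal.ofReal_one, one_mul, Real.enorm_natCast]
  exact_mod_cast Nat.choose_le_two_pow m l

/-- The difference with step `h` is bounded by differences with steps `h + l g` and `l g`. -/
theorem enorm_fwdDiff_le {m : ℕ} (hm : 1 ≤ m) (h g : Plane) (f : Plane → ℝ) (x : Plane) :
    ‖(fwdDiff h)^[m] f x‖ₑ ≤ ∑ l ∈ Finset.range m, 2 ^ m *
      (‖(fwdDiff (h + (l + 1) • g))^[m] f x‖ₑ +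
        ‖(fwdDiff ((l + 1) • g))^[m] f (x + (l + 1) • h)‖ₑ) := by
  have key := sum_fwdDiff_eq m h g f x
  -- The term `k = 0` on the left is the wanted difference, and the term `l = 0` on the right has
  -- step zero and vanishes since `m ≥ 1`.
  rw [Finset.sum_range_succ', Finset.sum_range_succ'] at key
  simp only [pow_zero, Nat.choose_zero_right, Nat.cast_one, one_mul, zero_smul, add_zero,
    fwdDiff_zero_iter hm] at key
  have e : (fwdDiff h)^[m] f x = ∑ l ∈ Finset.range m,
      (((-1 : ℝ) ^ (l + 1) * m.choose (l + 1) * (fwdDiff ((l + 1) • g))^[m] f (x + (l + 1) • h)) -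
        (-1 : ℝ) ^ (l + 1) * m.choose (l + 1) * (fwdDiff (h + (l + 1) • g))^[m] f x) := by
    rw [Finset.sum_sub_distrib]; linarith
  rw [e]
  refine (enorm_sum_le _ _).trans (Finset.sum_le_sum fun l _ => ?_)
  refine (enorm_sub_le).trans ?_
  rw [mul_add, add_comm]
  exact add_le_add (enorm_mul_choose_le _ (by simp) _) (enorm_mul_choose_le _ (by simp) _)

/-- A difference with step `2 h` in terms of differences with step `h`. -/
theorem fwdDiff_two_smul (m : ℕ) (h : Plane) (f : Plane → ℝ) (x : Plane) :
    (fwdDiff (2 • h))^[m] f x =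
      ∑ i ∈ Finset.range (m + 1), (m.choose i : ℝ) * (fwdDiff h)^[m] f (x + i • h) := by
  induction m generalizing f x with
  | zero => simp
  | succ m ih =>
    have e : fwdDiff (2 • h) f = fun y => fwdDiff h f y + fwdDiff h f (y + h) := by
      funext y
      simp only [fwdDiff, two_smul, add_assoc]
      ring
    rw [Function.iterate_succ_apply, e]
    have hadd : ∀ y, (fwdDiff h)^[m] (fun y => fwdDiff h f y + fwdDiff h f (y + h)) y =
        (fwdDiff h)^[m + 1] f y + (fwdDiff h)^[m + 1] f (y + h) := by
      intro y
      have : (fun y => fwdDiff h f y + fwdDiff h f (y + h)) =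
          fwdDiff h f + fun y => fwdDiff h f (y + h) := rfl
      rw [this, fwdDiff_iter_add, Pi.add_apply, fwdDiff_iter_comp_add]
      rfl
    rw [ih]
    simp only [hadd, mul_add, Finset.sum_add_distrib]
    rw [Finset.sum_range_succ' _ (m + 1), Finset.sum_range_succ' _ m]
    have e2 : ∀ i, x + i • h + h = x + (i + 1) • h := by
      intro i; rw [succ_nsmul, add_assoc]
    simp only [e2, Nat.choose_succ_succ, Nat.cast_add, add_mul, Finset.sum_add_distrib]
    rw [Finset.sum_range_succ (fun i => ((m.choose (i + 1) : ℕ) : ℝ) *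
      (fwdDiff h)^[m + 1] f (x + (i + 1) • h)) m]
    simp
    ring

/-! ### Powers of sums -/

/-- Bounding every term by the largest one treats all `p > 0` alike, including the quasi-norm range
`p < 1`. -/
theorem rpow_sum_le {ι : Type*} (s : Finset ι) (a : ι → ℝ≥0∞) {p : ℝ} (hp : 0 < p) :
    (∑ i ∈ s, a i) ^ p ≤ (s.card : ℝ≥0∞) ^ p * ∑ i ∈ s, a i ^ p := by
  rcases s.eq_empty_or_nonempty with rfl | hs
  · simp [hp]
  obtain ⟨j, hj, hmax⟩ := s.exists_max_image a hs
  calc (∑ i ∈ s, a i) ^ p ≤ (s.card * a j) ^ p := by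
        refine ENNReal.rpow_le_rpow ?_ hp.le
        rw [← nsmul_eq_mul]
        exact Finset.sum_le_card_nsmul _ _ _ hmax
    _ = (s.card : ℝ≥0∞) ^ p * a j ^ p := ENNReal.mul_rpow_of_nonneg _ _ hp.le
    _ ≤ _ := by
        gcongr
        exact Finset.single_le_sum (f := fun i => a i ^ p) (fun _ _ => zero_le) hj

theorem lintegral_rpow_sum_le {ι : Type*} (s : Finset ι) (F : Plane → ℝ≥0∞)
    (G : ι → Plane → ℝ≥0∞) (hG : ∀ i ∈ s, Measurable (G i)) {p : ℝ} (hp : 0 < p) (c : ℝ≥0∞)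
    (hFG : ∀ x, F x ≤ ∑ i ∈ s, c * G i x) (μ : Measure Plane) :
    ∫⁻ x, F x ^ p ∂μ ≤ ((s.card : ℝ≥0∞) * c) ^ p * ∑ i ∈ s, ∫⁻ x, G i x ^ p ∂μ := by
  rw [← lintegral_finsetSum _ fun i hi => (hG i hi).pow_const p,
    ← lintegral_const_mul _ (Finset.measurable_sum _ fun i hi => (hG i hi).pow_const p)]
  refine lintegral_mono fun x => ?_
  calc F x ^ p ≤ (∑ i ∈ s, c * G i x) ^ p := ENNReal.rpow_le_rpow (hFG x) hp.le
    _ ≤ (s.card : ℝ≥0∞) ^ p * ∑ i ∈ s, (c * G i x) ^ p := rpow_sum_le s _ hp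
    _ = _ := by
        rw [ENNReal.mul_rpow_of_nonneg _ _ hp.le, mul_assoc, Finset.mul_sum (a := c ^ p)]
        simp only [ENNReal.mul_rpow_of_nonneg _ _ hp.le]

theorem setLIntegral_translate_le (F : Plane → ℝ≥0∞) {A B : Set Plane} (v : Plane)
    (h : ∀ x ∈ A, x + v ∈ B) : ∫⁻ x in A, F (x + v) ≤ ∫⁻ x in B, F x := by
  have h1 := (measurePreserving_add_right (volume : Measure Plane) v).setLIntegral_comp_preimage_emb
    (MeasurableEquiv.addRight v).measurableEmbedding F B
  rw [← h1]
  exact lintegral_mono_set h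

/-! ### Moduli of smoothness -/

variable {m : ℕ} {p : ℝ} {f : Plane → ℝ} {G : Set Plane}

/-- The `p`-th power of the norm of a difference. -/
theorem eLpNorm_rpow (hp : 0 < p) (g : Plane → ℝ) (μ : Measure Plane) :
    eLpNorm g (ENNReal.ofReal p) μ ^ p = ∫⁻ x, ‖g x‖ₑ ^ p ∂μ := by
  rw [eLpNorm_eq_lintegral_rpow_enorm_toReal (by simpa using hp) ENNReal.ofReal_ne_top,
    ENNReal.toReal_ofReal hp.le, ← ENNReal.rpow_mul, one_div, inv_mul_cancel₀ hp.ne',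
    ENNReal.rpow_one]

theorem le_modulus_rpow (hp : 0 < p) {h : Plane} {t : ℝ} (ht : ‖h‖ ≤ t) :
    ∫⁻ x in diffDomain m h G, ‖(fwdDiff h)^[m] f x‖ₑ ^ p ≤
      modulus m (ENNReal.ofReal p) f G t ^ p := by
  rw [← eLpNorm_rpow hp]
  refine ENNReal.rpow_le_rpow ?_ hp.le
  exact le_iSup₂ (f := fun (h : Plane) (_ : ‖h‖ ≤ t) => eLpNorm ((fwdDiff h)^[m] f)
    (ENNReal.ofReal p) (volume.restrict (diffDomain m h G))) h ht

theorem modulus_rpow_le (hp : 0 < p) {t : ℝ} {b : ℝ≥0∞}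
    (hb : ∀ h : Plane, ‖h‖ ≤ t →
      ∫⁻ x in diffDomain m h G, ‖(fwdDiff h)^[m] f x‖ₑ ^ p ≤ b) :
    modulus m (ENNReal.ofReal p) f G t ^ p ≤ b := by
  rw [← ENNReal.le_rpow_inv_iff hp]
  refine iSup₂_le fun h ht => ?_
  rw [ENNReal.le_rpow_inv_iff hp, eLpNorm_rpow hp]
  exact hb h ht

theorem modulus_mono {q : ℝ≥0∞} {s t : ℝ} (h : s ≤ t) : modulus m q f G s ≤ modulus m q f G t :=
  iSup₂_le fun u hu => le_iSup₂ (f := fun (h : Plane) (_ : ‖h‖ ≤ t) => eLpNorm ((fwdDiff h)^[m] f)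
    q (volume.restrict (diffDomain m h G))) u (hu.trans h)

theorem diffDomain_mono {G' : Set Plane} (h : G ⊆ G') (u : Plane) :
    diffDomain m u G ⊆ diffDomain m u G' := fun _ hx => Subset.trans hx h

theorem modulus_mono_set {q : ℝ≥0∞} {G' : Set Plane} (h : G ⊆ G') (t : ℝ) :
    modulus m q f G t ≤ modulus m q f G' t :=
  iSup₂_mono fun u _ => eLpNorm_mono_measure _ (Measure.restrict_mono (diffDomain_mono h u) le_rfl)

theorem besovSeminorm_mono {α : ℝ} {q : ℝ≥0∞} {G' : Set Plane} (h : G ⊆ G') :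
    besovSeminorm α q q m f G ≤ besovSeminorm α q q m f G' := by
  refine eLpNorm_mono_enorm fun t => ?_
  simp only [enorm_eq_self]
  exact mul_le_mul_right (modulus_mono_set h t) _

theorem mem_diffDomain_iff {h x : Plane} :
    x ∈ diffDomain m h G ↔ ∀ t ∈ Icc (0 : ℝ) 1, x + t • (m • h) ∈ G := by
  simp only [diffDomain, mem_ofPred_eq, segment_eq_image', add_sub_cancel_left]
  exact image_subset_iff

/-- A difference with step `2u` is a binomial combination of differences with step `u` at points of
the same segment, so no geometry of `G` enters. -/
theorem modulus_two_mul_le (hf : Measurable f) (hp : 0 < p) (t : ℝ) :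
    modulus m (ENNReal.ofReal p) f G (2 * t) ^ p ≤
      (((m + 1 : ℕ) : ℝ≥0∞) * 2 ^ m) ^ p * (m + 1 : ℕ) *
        modulus m (ENNReal.ofReal p) f G t ^ p := by
  refine modulus_rpow_le hp fun h ht => ?_
  obtain ⟨u, rfl⟩ : ∃ u, h = 2 • u := ⟨(2 : ℝ)⁻¹ • h, by
    rw [← Nat.cast_smul_eq_nsmul ℝ, smul_smul]; norm_num⟩
  have hu : ‖u‖ ≤ t := by
    rw [← Nat.cast_smul_eq_nsmul ℝ, norm_smul] at ht
    norm_num at ht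
    exact ht
  have hmeas : ∀ i : ℕ, Measurable fun x => ‖(fwdDiff u)^[m] f (x + i • u)‖ₑ := by
    intro i
    refine Measurable.enorm ?_
    exact (measurable_fwdDiff_iter hf m).comp (f := fun x : Plane => (u, x + i • u)) (by fun_prop)
  refine (lintegral_rpow_sum_le (Finset.range (m + 1)) _
    (fun i x => ‖(fwdDiff u)^[m] f (x + i • u)‖ₑ) (fun i _ => hmeas i) hp (2 ^ m) (fun x => ?_)
    _).trans ?_
  · rw [fwdDiff_two_smul]
    refine (enorm_sum_le _ _).trans (Finset.sum_le_sum fun i _ => ?_)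
    have := enorm_mul_choose_le (m := m) (l := i) 1 (by simp) ((fwdDiff u)^[m] f (x + i • u))
    rwa [one_mul] at this
  · rw [Finset.card_range, mul_assoc]
    gcongr
    have : ∀ i ∈ Finset.range (m + 1), ∫⁻ x in diffDomain m (2 • u) G,
        ‖(fwdDiff u)^[m] f (x + i • u)‖ₑ ^ p ≤ modulus m (ENNReal.ofReal p) f G t ^ p := by
      intro i hi
      refine le_trans ?_ (le_modulus_rpow hp hu)
      refine setLIntegral_translate_le (fun y => ‖(fwdDiff u)^[m] f y‖ₑ ^ p) (i • u) fun x hx => ?_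
      rw [mem_diffDomain_iff] at hx ⊢
      intro s hs
      rw [Finset.mem_range] at hi
      rcases Nat.eq_zero_or_pos m with rfl | hm
      · simpa [show i = 0 by omega] using hx s hs
      · have hm' : (0 : ℝ) < m := by exact_mod_cast hm
        have hi' : (i : ℝ) ≤ m := by exact_mod_cast (by omega : i ≤ m)
        -- The parameter on the segment of total length `2 m u` of the point `x + i u + s m u`.
        convert hx ((i + s * m) / (2 * m)) ⟨by have := hs.1; positivity, ?_⟩ using 1
        · rw [add_assoc]
          congr 1
          simp only [← Nat.cast_smul_eq_nsmul ℝ, smul_smul, ← add_smul]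
          congr 1
          field_simp
          push_cast
          ring
        · rw [div_le_one (by positivity)]
          nlinarith [hs.2]
    refine (Finset.sum_le_card_nsmul _ _ _ this).trans ?_
    rw [Finset.card_range, nsmul_eq_mul]

theorem modulus_two_pow_mul_le (hf : Measurable f) (hp : 0 < p) (k : ℕ) (t : ℝ) :
    modulus m (ENNReal.ofReal p) f G (2 ^ k * t) ^ p ≤
      ((((m + 1 : ℕ) : ℝ≥0∞) * 2 ^ m) ^ p * (m + 1 : ℕ)) ^ k *
        modulus m (ENNReal.ofReal p) f G t ^ p := by
  induction k with
  | zero => simp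
  | succ k ih =>
    rw [pow_succ', mul_assoc, pow_succ', mul_assoc]
    exact (modulus_two_mul_le hf hp _).trans (mul_le_mul_right ih _)

end AdaptiveSpline

namespace AdaptiveSpline

/-! ### Averaged moduli of smoothness -/

variable {D : GridDomain} {m : ℕ} {p : ℝ} {f : Plane → ℝ}

/-- A tube argument over the compact parameter interval. Joint openness in step and point provides
the measurability needed to integrate over steps. -/
theorem isOpen_setOf_diffDomain (m : ℕ) {G : Set Plane} (hG : IsOpen G) :
    IsOpen {q : Plane × Plane | q.2 ∈ diffDomain m q.1 G} := by
  rw [isOpen_iff_mem_nhds]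
  intro q hq
  simp only [mem_ofPred_eq, mem_diffDomain_iff] at hq
  have := isCompact_Icc.eventually_forall_of_forall_eventually (x₀ := q)
    (K := Icc (0 : ℝ) 1) (P := fun q t => q.2 + t • (m • q.1) ∈ G) (fun t ht => by
      have hc : Continuous fun z : (Plane × Plane) × ℝ => z.1.2 + z.2 • (m • z.1.1) := by fun_prop
      exact hc.continuousAt.eventually_mem (hG.mem_nhds (hq t ht)))
  filter_upwards [this] with z hz
  exact mem_diffDomain_iff.2 hz

theorem isOpen_diffDomain (m : ℕ) (h : Plane) {G : Set Plane} (hG : IsOpen G) :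
    IsOpen (diffDomain m h G) :=
  (isOpen_setOf_diffDomain m hG).preimage (f := fun x : Plane => (h, x)) (by fun_prop)

theorem isOpen_domain (D : GridDomain) : IsOpen (domain D) := isOpen_interior

theorem isOpen_box (D : GridDomain) (K : ℝ) (τ : Cell) : IsOpen (box D K τ) := by
  simp only [box, ofPred_forall]
  exact isOpen_iInter_of_finite fun i => isOpen_lt (by fun_prop) continuous_const

theorem measurable_enorm_fwdDiff (hf : Measurable f) (p : ℝ) (u : Plane) :
    Measurable fun x => ‖(fwdDiff u)^[m] f x‖ₑ ^ p :=
  ((measurable_fwdDiff_iter hf m).comp (f := fun x : Plane => (u, x))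
    (by fun_prop)).enorm.pow_const p

/-- The local contribution near `τ` to the `p`-th power of the norm of a difference. -/
noncomputable def localDiff (D : GridDomain) (m : ℕ) (p : ℝ) (f : Plane → ℝ) (K : ℝ) (τ : Cell)
    (u : Plane) : ℝ≥0∞ :=
  ∫⁻ x in diffDomain m u (domain D) ∩ box D K τ, ‖(fwdDiff u)^[m] f x‖ₑ ^ p

theorem measurable_localDiff (hf : Measurable f) (K : ℝ) (τ : Cell) :
    Measurable (localDiff D m p f K τ) := by
  have hS : MeasurableSet {q : Plane × Plane | q.2 ∈ diffDomain m q.1 (domain D) ∩ box D K τ} :=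
    ((isOpen_setOf_diffDomain m (isOpen_domain D)).inter
      ((isOpen_box D K τ).preimage continuous_snd)).measurableSet
  have : localDiff D m p f K τ = fun u => ∫⁻ x, ({q : Plane × Plane |
      q.2 ∈ diffDomain m q.1 (domain D) ∩ box D K τ}.indicator
        (fun q => ‖(fwdDiff q.1)^[m] f q.2‖ₑ ^ p)) (u, x) := by
    funext u
    rw [localDiff, ← lintegral_indicator]
    · rfl
    · exact ((isOpen_diffDomain m u (isOpen_domain D)).inter (isOpen_box D K τ)).measurableSet
  rw [this]
  exact (((measurable_fwdDiff_iter hf m).enorm.pow_const p).indicator hS).lintegral_prod_right'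

/-- Change of variables; in the plane, dilation by `a` has Jacobian `a²`. -/
theorem lintegral_affine_le {Φ : Plane → ℝ≥0∞} (hΦ : Measurable Φ) {a : ℝ} (ha : 0 < a)
    (w : Plane) {W B : Set Plane} (hB : MeasurableSet B) (h : ∀ g ∈ W, w + a • g ∈ B) :
    ∫⁻ g in W, Φ (w + a • g) ≤ ENNReal.ofReal ((a ^ 2)⁻¹) * ∫⁻ u in B, Φ u := by
  have hφ : Measurable fun g : Plane => w + a • g := by fun_prop
  have hmap : Measure.map (fun g : Plane => w + a • g) volume =
      ENNReal.ofReal ((a ^ 2)⁻¹) • (volume : Measure Plane) := by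
    have h1 : (fun g : Plane => w + a • g) = (fun g => w + g) ∘ fun g => a • g := rfl
    rw [h1, ← Measure.map_map (by fun_prop) (by fun_prop), Measure.map_addHaar_smul _ ha.ne',
      Measure.map_smul, map_add_left_eq_self]
    congr 2
    rw [finrank_euclideanSpace_fin, abs_of_pos (by positivity)]
  calc ∫⁻ g in W, Φ (w + a • g) ≤ ∫⁻ g in (fun g : Plane => w + a • g) ⁻¹' B, Φ (w + a • g) :=
        lintegral_mono_set h
    _ = ∫⁻ u in B, Φ u ∂(Measure.map (fun g : Plane => w + a • g) volume) :=
        (setLIntegral_map hB hΦ hφ).symm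
    _ = _ := by rw [hmap, Measure.restrict_smul, lintegral_smul_measure, smul_eq_mul]

/-- The unit square in the direction of a quadrant. -/
def signBox (d : Fin 2 → Bool) : Set Plane :=
  {g | ∀ i, 0 < sideSign (d i) * g i ∧ |g i| < 1}

theorem volume_signBox_pos (d : Fin 2 → Bool) : 0 < volume (signBox d) := by
  have ho : IsOpen (signBox d) := by
    simp only [signBox, ofPred_forall, ofPred_and]
    exact isOpen_iInter_of_finite fun i =>
      (isOpen_lt (by fun_prop) (by fun_prop)).inter (isOpen_lt (by fun_prop) (by fun_prop))
  refine ho.measure_pos _ ⟨WithLp.toLp 2 fun i => sideSign (d i) / 2, fun i => ?_⟩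
  cases h : d i <;> simp [sideSign, h] <;> norm_num [abs_lt]

theorem norm_le_of_signBox {d : Fin 2 → Bool} {g : Plane} (hg : g ∈ signBox d) : ‖g‖ ≤ 2 := by
  rw [EuclideanSpace.norm_eq, Real.sqrt_le_iff]
  refine ⟨by norm_num, ?_⟩
  rw [Fin.sum_univ_two, Real.norm_eq_abs, Real.norm_eq_abs]
  nlinarith [(hg 0).2, (hg 1).2, abs_nonneg (g 0), abs_nonneg (g 1)]

/-- The points whose difference segment stays in the domain when it is slightly translated in the
direction of a quadrant. -/
def shiftable (D : GridDomain) (m : ℕ) (h : Plane) (K : ℝ) (τ : Cell) (d : Fin 2 → Bool) :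
    Set Plane :=
  {x | x ∈ box D K τ ∧ ∀ t ∈ Icc (0 : ℝ) 1, ∀ w : Plane,
    (∀ i, 0 ≤ sideSign (d i) * w i ∧ |w i| ≤ D.h₀ / 8) → x + t • (m • h) + w ∈ domain D}

theorem side_le (D : GridDomain) (ℓ : ℕ) : side D ℓ ≤ D.h₀ := by
  have := side_anti D (Nat.zero_le ℓ)
  simpa [side] using this

theorem abs_apply_le (h : Plane) (i : Fin 2) : |h i| ≤ ‖h‖ := by
  simpa using PiLp.norm_apply_le h i

theorem diffDomain_subset_shiftable {h : Plane} {K : ℝ} {τ : Cell} {t : ℝ}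
    (hh : ‖h‖ ≤ t) (ht : m * t ≤ side D τ.level / 8) :
    diffDomain m h (domain D ∩ box D K τ) ⊆ ⋃ d, shiftable D m h K τ d := by
  intro x hx
  have hx0 := (mem_diffDomain_iff.1 hx) 0 ⟨le_rfl, zero_le_one⟩
  rw [zero_smul, add_zero] at hx0
  obtain ⟨d, hd⟩ := exists_sign_translate (D := D) (x := x) (y := x + m • h)
    (Subset.trans hx inter_subset_left) (fun i => by
      have := abs_apply_le h i
      have hs := side_le D τ.level
      simp only [PiLp.add_apply, PiLp.smul_apply, add_sub_cancel_left, nsmul_eq_mul]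
      rw [abs_mul, Nat.abs_cast]
      have h2 : (m : ℝ) * |h i| ≤ m * t :=
        mul_le_mul_of_nonneg_left (this.trans hh) (Nat.cast_nonneg m)
      linarith)
  refine mem_iUnion.2 ⟨d, hx0.2, fun s hs w hw => hd _ ?_ w hw⟩
  rw [segment_eq_image', add_sub_cancel_left]
  exact ⟨s, hs, rfl⟩

/-- The step `h` is traded for steps perturbed by a vector in the admissible quadrant. The left side
does not depend on `g`, so the estimate may be averaged over `g` afterwards. -/
theorem shiftable_lintegral_le (hm : 1 ≤ m) (hp : 0 < p) (hf : Measurable f) {h : Plane} {K : ℝ}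
    {τ : Cell} {t : ℝ} (hh : ‖h‖ ≤ t) (ht : m * t ≤ side D τ.level / 8) {d : Fin 2 → Bool}
    {g : Plane} (hg : g ∈ signBox d) :
    ∫⁻ x in shiftable D m h K τ d, ‖(fwdDiff h)^[m] f x‖ₑ ^ p ≤
      (((m * 2 : ℕ) : ℝ≥0∞) * 2 ^ m) ^ p * ∑ l ∈ Finset.range m,
        (localDiff D m p f (K + 1) τ (h + ((l + 1 : ℕ) / m * t : ℝ) • g) +
          localDiff D m p f (K + 1) τ (0 + ((l + 1 : ℕ) / m * t : ℝ) • g)) := by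
  have hm0 : (0 : ℝ) < m := by exact_mod_cast hm
  have ht0 : 0 ≤ t := (norm_nonneg h).trans hh
  have hs := side_pos D τ.level
  have hsh := side_le D τ.level
  -- With the perturbation scaled by `t / m`, its multiples up to the `m`-th displace the segments
  -- by at most `m t ≤ h₀ / 8` in each coordinate.
  have hsmul : ∀ l : ℕ, (l + 1) • ((t / m) • g) = (((l + 1 : ℕ) : ℝ) / m * t) • g := by
    intro l
    rw [← Nat.cast_smul_eq_nsmul ℝ, smul_smul]
    congr 1
    ring
  have hfrac : ∀ l ∈ Finset.range m, 0 ≤ ((l + 1 : ℕ) : ℝ) / m ∧ ((l + 1 : ℕ) : ℝ) / m ≤ 1 := by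
    intro l hl
    rw [Finset.mem_range] at hl
    refine ⟨by positivity, ?_⟩
    rw [div_le_one hm0]
    exact_mod_cast hl
  have hw : ∀ l ∈ Finset.range m, ∀ s ∈ Icc (0 : ℝ) 1, ∀ i,
      0 ≤ sideSign (d i) * (s • (m • ((((l + 1 : ℕ) : ℝ) / m * t) • g))) i ∧
        |(s • (m • ((((l + 1 : ℕ) : ℝ) / m * t) • g))) i| ≤ D.h₀ / 8 := by
    intro l hl s hs' i
    obtain ⟨f1, f2⟩ := hfrac l hl
    obtain ⟨g1, g2⟩ := hg i
    have e : (s • (m • ((((l + 1 : ℕ) : ℝ) / m * t) • g))) i =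
        (s * (((l + 1 : ℕ) : ℝ) / m)) * ((m * t) * g i) := by
      simp only [PiLp.smul_apply, smul_eq_mul, nsmul_eq_mul]
      ring
    rw [e]
    have h1 : 0 ≤ s * (((l + 1 : ℕ) : ℝ) / m) := mul_nonneg hs'.1 f1
    have h2 : s * (((l + 1 : ℕ) : ℝ) / m) ≤ 1 := mul_le_one₀ hs'.2 f1 f2
    have h3 : 0 ≤ (m : ℝ) * t := mul_nonneg hm0.le ht0
    constructor
    · have : sideSign (d i) * (s * (((l + 1 : ℕ) : ℝ) / m) * (m * t * g i)) =
        (s * (((l + 1 : ℕ) : ℝ) / m)) * (m * t) * (sideSign (d i) * g i) := by ring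
      rw [this]
      positivity
    · rw [abs_mul _ ((m : ℝ) * t * g i), abs_of_nonneg h1, abs_mul _ (g i), abs_of_nonneg h3]
      have h4 : (m : ℝ) * t * |g i| ≤ m * t := mul_le_of_le_one_right h3 g2.le
      have h5 : s * (((l + 1 : ℕ) : ℝ) / m) * (m * t * |g i|) ≤ m * t * |g i| :=
        mul_le_of_le_one_left (by positivity) h2
      linarith
  -- The Boolean distinguishes differences with step `h + (l + 1) g'` from those with step `(l + 1)
  -- g'`, where `g' = (t / m) g`.
  set s : Finset (ℕ × Bool) := Finset.range m ×ˢ Finset.univ with hsdef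
  set G : ℕ × Bool → Plane → ℝ≥0∞ := fun q x =>
    if q.2 then ‖(fwdDiff (h + (q.1 + 1) • ((t / m) • g)))^[m] f x‖ₑ
    else ‖(fwdDiff ((q.1 + 1) • ((t / m) • g)))^[m] f (x + (q.1 + 1) • h)‖ₑ with hGdef
  have hG : ∀ q ∈ s, Measurable (G q) := by
    rintro ⟨l, b⟩ -
    cases b
    · exact ((measurable_fwdDiff_iter hf m).comp
        (f := fun x : Plane => ((l + 1) • ((t / m) • g), x + (l + 1) • h)) (by fun_prop)).enorm
    · exact ((measurable_fwdDiff_iter hf m).comp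
        (f := fun x : Plane => (h + (l + 1) • ((t / m) • g), x)) (by fun_prop)).enorm
  refine (lintegral_rpow_sum_le s _ G hG hp (2 ^ m) (fun x => ?_) _).trans ?_
  · rw [hsdef, Finset.sum_product]
    simpa [hGdef, mul_add] using enorm_fwdDiff_le hm h ((t / m) • g) f x
  · rw [hsdef, Finset.sum_product, Finset.card_product, Finset.card_range]
    simp only [Finset.card_univ, Fintype.card_bool, Fintype.sum_bool]
    gcongr with l hl
    · rw [← hsmul l]
      simp only [hGdef, if_true]
      refine lintegral_mono_set fun x hx => ⟨?_, fun i => ?_⟩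
      · rw [mem_diffDomain_iff]
        intro θ hθ
        have := hx.2 θ hθ _ (hw l hl θ hθ)
        rwa [hsmul l, smul_add, smul_add, ← add_assoc]
      · have := hx.1 i
        linarith
    · rw [← hsmul l, zero_add]
      simp only [hGdef, Bool.false_eq_true, if_false]
      refine setLIntegral_translate_le
        (fun y => ‖(fwdDiff ((l + 1) • ((t / m) • g)))^[m] f y‖ₑ ^ p) ((l + 1) • h)
        fun x hx => ⟨?_, fun i => ?_⟩
      · rw [mem_diffDomain_iff]
        intro θ hθ
        -- The base point `x + (l + 1) h` lies on the original segment, at parameter `(l + 1) / m`.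
        have := hx.2 _ (hfrac l hl) _ (hw l hl θ hθ)
        rw [hsmul l]
        convert this using 3
        rw [← Nat.cast_smul_eq_nsmul ℝ m h, smul_smul, div_mul_cancel₀ _ hm0.ne',
          Nat.cast_smul_eq_nsmul]
      · have h1 := abs_lt.1 (hx.1 i)
        have h2 := (abs_apply_le h i).trans hh
        have h3 : ((l + 1 : ℕ) : ℝ) * |h i| ≤ m * t := by
          refine mul_le_mul ?_ h2 (abs_nonneg _) hm0.le
          rw [Finset.mem_range] at hl
          exact_mod_cast hl
        have h4 : |((l + 1 : ℕ) : ℝ) * h i| ≤ m * t := by rwa [abs_mul, Nat.abs_cast]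
        have h5 := abs_le.1 h4
        simp only [PiLp.add_apply, PiLp.smul_apply, nsmul_eq_mul]
        rw [abs_lt]
        constructor <;> linarith

/-- The local modulus of smoothness is bounded by an averaged one. -/
theorem exists_modulus_le_average (hm : 1 ≤ m) (hp : 0 < p) :
    ∃ C : ℝ≥0∞, C ≠ ∞ ∧ ∀ (f : Plane → ℝ), Measurable f → ∀ (K : ℝ) (τ : Cell) (t : ℝ), 0 < t →
      m * t ≤ side D τ.level / 8 →
      modulus m (ENNReal.ofReal p) f (domain D ∩ box D K τ) t ^ p ≤
        C * (ENNReal.ofReal ((t ^ 2)⁻¹) *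
          ∫⁻ u in Metric.closedBall 0 (4 * t), localDiff D m p f (K + 1) τ u) := by
  have hm0 : (0 : ℝ) < m := by exact_mod_cast hm
  set C₁ : ℝ≥0∞ := (((m * 2 : ℕ) : ℝ≥0∞) * 2 ^ m) ^ p with hC₁
  have hC₁' : C₁ ≠ ∞ := ENNReal.rpow_ne_top_of_nonneg hp.le
    (ENNReal.mul_ne_top (ENNReal.natCast_ne_top _) (ENNReal.pow_ne_top ENNReal.ofNat_ne_top))
  refine ⟨∑ d : Fin 2 → Bool, (volume (signBox d))⁻¹ *
    (C₁ * (m * (2 * ENNReal.ofReal (m ^ 2)))), ?_, ?_⟩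
  · refine (ENNReal.sum_lt_top.2 fun d _ => ?_).ne
    refine (ENNReal.mul_ne_top (ENNReal.inv_ne_top.2 (volume_signBox_pos d).ne') ?_).lt_top
    exact ENNReal.mul_ne_top hC₁' (ENNReal.mul_ne_top (ENNReal.natCast_ne_top _)
      (ENNReal.mul_ne_top ENNReal.ofNat_ne_top ENNReal.ofReal_ne_top))
  intro f hf K τ t ht hts
  refine modulus_rpow_le hp fun h hh => ?_
  set I := ∫⁻ u in Metric.closedBall 0 (4 * t), localDiff D m p f (K + 1) τ u with hI
  refine (lintegral_mono_set (diffDomain_subset_shiftable hh hts)).trans ?_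
  refine (lintegral_iUnion_le _ _).trans ?_
  rw [tsum_fintype, Finset.sum_mul]
  refine Finset.sum_le_sum fun d _ => ?_
  have hΦ := measurable_localDiff (D := D) (m := m) (p := p) hf (K + 1) τ
  have hvol := volume_signBox_pos d
  have hvol' : volume (signBox d) ≠ ∞ := by
    refine ((measure_mono fun g hg => ?_).trans_lt
      (measure_closedBall_lt_top (x := (0 : Plane)) (r := 2))).ne
    simpa using norm_le_of_signBox hg
  rw [mul_assoc, ← ENNReal.div_eq_inv_mul, ENNReal.le_div_iff_mul_le (Or.inl hvol.ne')
    (Or.inl hvol'), ← setLIntegral_const]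
  -- The steps have norm at most `t + 2 t`; the radius `4 t` is taken because two doublings reach
  -- it. The Jacobian contributes `(m / (l + 1))² t⁻² ≤ m² t⁻²`.
  have hone : ∀ w : Plane, ‖w‖ ≤ t → ∀ l ∈ Finset.range m,
      ∫⁻ g in signBox d, localDiff D m p f (K + 1) τ (w + ((l + 1 : ℕ) / m * t : ℝ) • g) ≤
        ENNReal.ofReal (m ^ 2) * (ENNReal.ofReal ((t ^ 2)⁻¹) * I) := by
    intro w hw l hl
    rw [Finset.mem_range] at hl
    have ha : 0 < ((l + 1 : ℕ) : ℝ) / m * t := by positivity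
    have ha1 : ((l + 1 : ℕ) : ℝ) / m ≤ 1 := by
      rw [div_le_one hm0]; exact_mod_cast hl
    refine (lintegral_affine_le hΦ ha w (B := Metric.closedBall 0 (4 * t))
      Metric.isClosed_closedBall.measurableSet fun g hg => ?_).trans ?_
    · rw [mem_closedBall_zero_iff]
      refine (norm_add_le _ _).trans ?_
      rw [norm_smul, Real.norm_of_nonneg ha.le]
      have h1 := norm_le_of_signBox hg
      have h2 : ((l + 1 : ℕ) : ℝ) / m * t ≤ t := mul_le_of_le_one_left ht.le ha1
      nlinarith [norm_nonneg g]
    · rw [← mul_assoc, ← ENNReal.ofReal_mul (by positivity)]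
      gcongr
      rw [mul_pow, div_pow, mul_inv, inv_div]
      gcongr
      refine div_le_self (by positivity) (one_le_pow₀ ?_)
      push_cast
      linarith [Nat.cast_nonneg (α := ℝ) l]
  have hmeas : ∀ (w : Plane) (a : ℝ), Measurable fun g : Plane =>
      localDiff D m p f (K + 1) τ (w + a • g) := fun w a => hΦ.comp (by fun_prop)
  have hadd : ∀ l : ℕ, Measurable fun g : Plane =>
      localDiff D m p f (K + 1) τ (h + ((l + 1 : ℕ) / m * t : ℝ) • g) +
        localDiff D m p f (K + 1) τ (0 + ((l + 1 : ℕ) / m * t : ℝ) • g) :=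
    fun l => (hmeas _ _).add (hmeas _ _)
  calc ∫⁻ _ in signBox d, ∫⁻ x in shiftable D m h K τ d, ‖(fwdDiff h)^[m] f x‖ₑ ^ p
      ≤ ∫⁻ g in signBox d, C₁ * ∑ l ∈ Finset.range m,
        (localDiff D m p f (K + 1) τ (h + ((l + 1 : ℕ) / m * t : ℝ) • g) +
          localDiff D m p f (K + 1) τ (0 + ((l + 1 : ℕ) / m * t : ℝ) • g)) := by
        refine setLIntegral_mono ((Finset.measurable_sum _ fun l _ => hadd l).const_mul _)
          fun g hg => ?_
        exact shiftable_lintegral_le hm hp hf hh hts hg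
    _ = C₁ * ∑ l ∈ Finset.range m,
        ((∫⁻ g in signBox d, localDiff D m p f (K + 1) τ (h + ((l + 1 : ℕ) / m * t : ℝ) • g)) +
          ∫⁻ g in signBox d, localDiff D m p f (K + 1) τ (0 + ((l + 1 : ℕ) / m * t : ℝ) • g)) := by
        rw [lintegral_const_mul _ (Finset.measurable_sum _ fun l _ => hadd l),
          lintegral_finsetSum _ fun l _ => hadd l]
        congr 1
        exact Finset.sum_congr rfl fun l _ => lintegral_add_left (hmeas _ _) _
    _ ≤ C₁ * ∑ l ∈ Finset.range m, (2 * (ENNReal.ofReal (m ^ 2) *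
          (ENNReal.ofReal ((t ^ 2)⁻¹) * I))) := by
        gcongr with l hl
        rw [two_mul]
        exact add_le_add (hone h hh l hl) (hone 0 (by simpa using ht.le) l hl)
    _ = _ := by
        rw [Finset.sum_const, Finset.card_range, nsmul_eq_mul]
        ring

end AdaptiveSpline

namespace AdaptiveSpline

/-! ### Summation over a uniform mesh -/

variable {D : GridDomain} {m : ℕ} {p : ℝ} {f : Plane → ℝ}

/-- The uniform mesh of level `ℓ` as a finite set. -/
noncomputable def gridFinset (D : GridDomain) (ℓ : ℕ) : Finset Cell :=
  (D.base ×ˢ (Finset.univ : Finset (Fin 2 → Fin (2 ^ ℓ)))).image fun q =>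
    ⟨ℓ, fun i => 2 ^ ℓ * q.1 i + (q.2 i : ℕ)⟩

theorem mem_gridFinset {ℓ : ℕ} {τ : Cell} : τ ∈ gridFinset D ℓ ↔ τ ∈ grid D ℓ := by
  have hpos : (0 : ℤ) < 2 ^ ℓ := by positivity
  simp only [gridFinset, Finset.mem_image, Finset.mem_product, Finset.mem_univ, and_true, grid,
    mem_ofPred_eq]
  constructor
  · rintro ⟨⟨k, e⟩, hk, rfl⟩
    refine ⟨rfl, ?_⟩
    convert hk using 1
    funext i
    have h2 : ((e i : ℕ) : ℤ) < 2 ^ ℓ := by exact_mod_cast (e i).2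
    exact Int.ediv_eq_iff_of_pos hpos |>.2 ⟨by linarith [Int.natCast_nonneg (e i : ℕ)], by linarith⟩
  · rintro ⟨rfl, hk⟩
    refine ⟨⟨_, fun i => ⟨(τ.pos i % 2 ^ τ.level).toNat, ?_⟩⟩, hk, ?_⟩
    · have h1 := Int.emod_lt_of_pos (τ.pos i) hpos
      have h2 := Int.emod_nonneg (τ.pos i) hpos.ne'
      zify
      rwa [Int.toNat_of_nonneg h2]
    · refine Cell.ext' rfl fun i => ?_
      simp only
      rw [Int.toNat_of_nonneg (Int.emod_nonneg _ hpos.ne'), Int.mul_ediv_add_emod]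

theorem card_gridFinset_le (D : GridDomain) (ℓ : ℕ) :
    (gridFinset D ℓ).card ≤ D.base.card * 4 ^ ℓ := by
  refine Finset.card_image_le.trans ?_
  rw [Finset.card_product, Finset.card_univ, Fintype.card_fun, Fintype.card_fin, Fintype.card_fin,
    ← pow_mul, mul_comm ℓ 2, pow_mul]
  norm_num

/-- A point lies in boundedly many of the boxes around the cells of one level. -/
theorem card_box_le (ℓ K : ℕ) (x : Plane) (s : Finset Cell)
    (hs : ∀ τ ∈ s, τ.level = ℓ ∧ x ∈ box D K τ) : s.card ≤ (2 * K + 3) ^ 2 := by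
  have hside := side_pos D ℓ
  set S : Finset (Fin 2 → ℤ) := Fintype.piFinset fun i =>
    Finset.Icc (⌊(x i - D.origin i) / side D ℓ⌋ - (K + 1))
      (⌊(x i - D.origin i) / side D ℓ⌋ + (K + 1)) with hS
  have hcard : S.card = (2 * K + 3) ^ 2 := by
    rw [hS, Fintype.card_piFinset, Fin.prod_univ_two, Int.card_Icc, Int.card_Icc, pow_two]
    congr 1 <;> omega
  rw [← hcard]
  refine Finset.card_le_card_of_injOn Cell.pos (fun τ hτ => ?_) fun σ hσ τ hτ h => ?_
  · obtain ⟨rfl, hx⟩ := hs τ hτ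
    rw [hS, Finset.mem_coe, Fintype.mem_piFinset]
    intro i
    have h1 := abs_lt.1 (hx i)
    have e : x i - D.origin i = side D τ.level * ((x i - D.origin i) / side D τ.level) := by
      field_simp
    set y := (x i - D.origin i) / side D τ.level
    rw [e] at h1
    have h2 : y - τ.pos i < K := by
      refine lt_of_mul_lt_mul_left (a := side D τ.level) ?_ hside.le
      linarith [h1.2]
    have h3 : -(K : ℝ) < y - τ.pos i := by
      refine lt_of_mul_lt_mul_left (a := side D τ.level) ?_ hside.le
      linarith [h1.1]
    have h4 := Int.floor_le y
    have h5 := Int.lt_floor_add_one y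
    rw [Finset.mem_Icc]
    constructor
    · have : ((⌊y⌋ - K : ℤ) : ℝ) < (τ.pos i : ℝ) := by push_cast; linarith
      have := Int.cast_lt.1 this
      omega
    · have : (τ.pos i : ℝ) < ((⌊y⌋ + K + 1 : ℤ) : ℝ) := by push_cast; linarith
      have := Int.cast_lt.1 this
      omega
  · exact Cell.ext' ((hs σ hσ).1.trans (hs τ hτ).1.symm) (congrFun h)

/-- For a fixed step the sum can be taken under the integral, where only the bounded overlap of the
boxes counts. This is the gain from averaging over steps. -/
theorem sum_localDiff_le (hp : 0 < p) (hf : Measurable f) (ℓ K : ℕ) {u : Plane} {t : ℝ}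
    (hu : ‖u‖ ≤ t) :
    ∑ τ ∈ gridFinset D ℓ, localDiff D m p f K τ u ≤
      ((2 * K + 3) ^ 2 : ℕ) * modulus m (ENNReal.ofReal p) f (domain D) t ^ p := by
  classical
  have hF := measurable_enorm_fwdDiff (m := m) hf p u
  calc ∑ τ ∈ gridFinset D ℓ, localDiff D m p f K τ u
      = ∑ τ ∈ gridFinset D ℓ, ∫⁻ x in diffDomain m u (domain D),
          (box D K τ).indicator (fun x => ‖(fwdDiff u)^[m] f x‖ₑ ^ p) x := by
        refine Finset.sum_congr rfl fun τ _ => ?_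
        rw [lintegral_indicator (isOpen_box D K τ).measurableSet,
          Measure.restrict_restrict (isOpen_box D K τ).measurableSet, inter_comm]
        rfl
    _ = ∫⁻ x in diffDomain m u (domain D), ∑ τ ∈ gridFinset D ℓ,
          (box D K τ).indicator (fun x => ‖(fwdDiff u)^[m] f x‖ₑ ^ p) x :=
        (lintegral_finsetSum _ fun τ _ => hF.indicator (isOpen_box D K τ).measurableSet).symm
    _ ≤ ∫⁻ x in diffDomain m u (domain D),
          ((2 * K + 3) ^ 2 : ℕ) * ‖(fwdDiff u)^[m] f x‖ₑ ^ p := by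
        refine lintegral_mono fun x => ?_
        simp only [indicator_apply]
        rw [← Finset.sum_filter, Finset.sum_const, nsmul_eq_mul]
        gcongr
        refine card_box_le (D := D) ℓ K x _ fun τ hτ => ?_
        rw [Finset.mem_filter, mem_gridFinset] at hτ
        exact ⟨grid_level hτ.1, hτ.2⟩
    _ = ((2 * K + 3) ^ 2 : ℕ) * ∫⁻ x in diffDomain m u (domain D), ‖(fwdDiff u)^[m] f x‖ₑ ^ p :=
        lintegral_const_mul _ hF
    _ ≤ _ := by
        gcongr
        exact le_modulus_rpow hp hu

/-- For steps longer than `T` no segment fits into the box, so they contribute nothing. -/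
theorem modulus_large_le {G : Set Plane} {τ : Cell} {K : ℝ} (hG : G ⊆ box D K τ) (hm : 1 ≤ m)
    {q : ℝ≥0∞} {T t : ℝ} (hT : 4 * K * side D τ.level ≤ m * T) :
    modulus m q f G t ≤ modulus m q f G T := by
  refine iSup₂_le fun h ht => ?_
  by_cases hh : ‖h‖ ≤ T
  · exact le_iSup₂ (f := fun (h : Plane) (_ : ‖h‖ ≤ T) => eLpNorm ((fwdDiff h)^[m] f)
      q (volume.restrict (diffDomain m h G))) h hh
  have hm0 : (0 : ℝ) < m := by exact_mod_cast hm
  have hempty : diffDomain m h G = ∅ := by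
    rw [eq_empty_iff_forall_notMem]
    intro x hx
    rw [mem_diffDomain_iff] at hx
    have h0 := hG (hx 0 ⟨le_rfl, zero_le_one⟩)
    have h1 := hG (hx 1 ⟨zero_le_one, le_rfl⟩)
    have hi : ∀ i, |h i| * m ≤ 2 * K * side D τ.level := by
      intro i
      have a0 := abs_lt.1 (h0 i)
      have a1 := abs_lt.1 (h1 i)
      simp only [PiLp.add_apply, PiLp.smul_apply, zero_smul, one_smul, add_zero,
        nsmul_eq_mul] at a0 a1
      rw [← Nat.abs_cast (R := ℝ) m, ← abs_mul, abs_le]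
      constructor <;> linarith
    have hnorm : ‖h‖ ≤ |h 0| + |h 1| := by
      rw [EuclideanSpace.norm_eq, Real.sqrt_le_iff, Fin.sum_univ_two]
      refine ⟨by positivity, ?_⟩
      simp only [Real.norm_eq_abs]
      nlinarith [abs_nonneg (h 0), abs_nonneg (h 1)]
    have := hi 0
    have := hi 1
    push Not at hh
    nlinarith
  rw [hempty]
  simp

/-- The moduli of smoothness on the boxes around the cells of one level sum up to at most the
modulus of smoothness on the domain. -/
theorem exists_sum_modulus_le (D : GridDomain) (hm : 1 ≤ m) (hp : 0 < p) (K : ℕ) :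
    ∃ C : ℝ≥0∞, C ≠ ∞ ∧ ∀ (f : Plane → ℝ), Measurable f → ∀ (ℓ : ℕ) (t : ℝ), 0 < t →
      ∑ τ ∈ gridFinset D ℓ, modulus m (ENNReal.ofReal p) f (domain D ∩ box D K τ) t ^ p ≤
        C * modulus m (ENNReal.ofReal p) f (domain D) t ^ p := by
  have hm0 : (0 : ℝ) < m := by exact_mod_cast hm
  obtain ⟨C₀, hC₀, h₀⟩ := exists_modulus_le_average (D := D) hm hp
  set Λ : ℝ≥0∞ := (((m + 1 : ℕ) : ℝ≥0∞) * 2 ^ m) ^ p * (m + 1 : ℕ) with hΛ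
  have hΛ' : Λ ≠ ∞ := ENNReal.mul_ne_top (ENNReal.rpow_ne_top_of_nonneg hp.le
    (ENNReal.mul_ne_top (ENNReal.natCast_ne_top _) (ENNReal.pow_ne_top ENNReal.ofNat_ne_top)))
    (ENNReal.natCast_ne_top _)
  set V := volume (Metric.closedBall (0 : Plane) 1) with hV
  have hV' : V ≠ ∞ := measure_closedBall_lt_top.ne
  set N : ℝ≥0∞ := (((2 * (K + 1) + 3) ^ 2 : ℕ) : ℝ≥0∞) with hN
  set C₁ : ℝ≥0∞ := C₀ * (16 * V * (N * Λ ^ 2)) with hC₁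
  have hC₁' : C₁ ≠ ∞ := ENNReal.mul_ne_top hC₀ (ENNReal.mul_ne_top
    (ENNReal.mul_ne_top ENNReal.ofNat_ne_top hV')
    (ENNReal.mul_ne_top (ENNReal.natCast_ne_top _) (ENNReal.pow_ne_top hΛ')))
  -- The averaged bound applies directly. The factor `t⁻²` cancels against the area of the ball of
  -- radius `4 t`, and returning from `4 t` to `t` costs `Λ²`.
  have small : ∀ (f : Plane → ℝ), Measurable f → ∀ (ℓ : ℕ) (t : ℝ), 0 < t →
      m * t ≤ side D ℓ / 8 →
      ∑ τ ∈ gridFinset D ℓ, modulus m (ENNReal.ofReal p) f (domain D ∩ box D K τ) t ^ p ≤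
        C₁ * modulus m (ENNReal.ofReal p) f (domain D) t ^ p := by
    intro f hf ℓ t ht hts
    set M := modulus m (ENNReal.ofReal p) f (domain D) t ^ p with hM
    have h4 : modulus m (ENNReal.ofReal p) f (domain D) (4 * t) ^ p ≤ Λ ^ 2 * M := by
      have := modulus_two_pow_mul_le (m := m) (G := domain D) hf hp 2 t
      rwa [show (2 : ℝ) ^ 2 = 4 by norm_num] at this
    calc ∑ τ ∈ gridFinset D ℓ, modulus m (ENNReal.ofReal p) f (domain D ∩ box D K τ) t ^ p
        ≤ ∑ τ ∈ gridFinset D ℓ, C₀ * (ENNReal.ofReal ((t ^ 2)⁻¹) *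
            ∫⁻ u in Metric.closedBall 0 (4 * t), localDiff D m p f (K + 1 : ℕ) τ u) := by
          refine Finset.sum_le_sum fun τ hτ => ?_
          rw [mem_gridFinset] at hτ
          rw [Nat.cast_add_one]
          exact h₀ f hf K τ t ht (by rwa [grid_level hτ])
      _ = C₀ * (ENNReal.ofReal ((t ^ 2)⁻¹) * ∫⁻ u in Metric.closedBall 0 (4 * t),
            ∑ τ ∈ gridFinset D ℓ, localDiff D m p f (K + 1 : ℕ) τ u) := by
          rw [← Finset.mul_sum, ← Finset.mul_sum,
            lintegral_finsetSum _ fun τ _ => measurable_localDiff hf _ τ]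
      _ ≤ C₀ * (ENNReal.ofReal ((t ^ 2)⁻¹) * ∫⁻ u in Metric.closedBall (0 : Plane) (4 * t),
            N * (Λ ^ 2 * M)) := by
          gcongr C₀ * (_ * ?_)
          refine setLIntegral_mono measurable_const fun u hu => ?_
          rw [mem_closedBall_zero_iff] at hu
          exact (sum_localDiff_le hp hf ℓ (K + 1) hu).trans (mul_le_mul_right h4 _)
      _ = C₀ * (ENNReal.ofReal ((t ^ 2)⁻¹) * (N * (Λ ^ 2 * M) *
            (ENNReal.ofReal ((4 * t) ^ 2) * V))) := by
          rw [setLIntegral_const]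
          have := Measure.addHaar_closedBall_mul (volume : Measure Plane) 0
            (show 0 ≤ 4 * t by positivity) zero_le_one
          rw [mul_one, finrank_euclideanSpace_fin] at this
          rw [this]
      _ = C₀ * ((ENNReal.ofReal ((t ^ 2)⁻¹) * ENNReal.ofReal ((4 * t) ^ 2)) *
            (V * (N * (Λ ^ 2 * M)))) := by ring
      _ = C₁ * M := by
          rw [← ENNReal.ofReal_mul (by positivity),
            show (t ^ 2)⁻¹ * (4 * t) ^ 2 = 16 by field_simp; norm_num]
          norm_num [hC₁]
          ring
  refine ⟨Λ ^ (32 * K) * C₁ + C₁, ENNReal.add_ne_top.2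
    ⟨ENNReal.mul_ne_top (ENNReal.pow_ne_top hΛ') hC₁', hC₁'⟩, fun f hf ℓ t ht => ?_⟩
  by_cases hts : m * t ≤ side D ℓ / 8
  · exact (small f hf ℓ t ht hts).trans (mul_le_mul_left le_add_self _)
  push Not at hts
  -- The largest step size covered by `small`. After `32 K` doublings it exceeds the threshold of
  -- `modulus_large_le`, because `32 K ≤ 2 ^ (32 K)`.
  set t₀ := side D ℓ / (8 * m) with ht₀
  have hs := side_pos D ℓ
  have ht₀' : 0 < t₀ := by positivity
  have hmt₀ : m * t₀ = side D ℓ / 8 := by rw [ht₀]; field_simp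
  have htt : t₀ ≤ t := by
    refine le_of_mul_le_mul_left ?_ hm0
    linarith
  calc ∑ τ ∈ gridFinset D ℓ, modulus m (ENNReal.ofReal p) f (domain D ∩ box D K τ) t ^ p
      ≤ ∑ τ ∈ gridFinset D ℓ, Λ ^ (32 * K) *
          modulus m (ENNReal.ofReal p) f (domain D ∩ box D K τ) t₀ ^ p := by
        refine Finset.sum_le_sum fun τ hτ => ?_
        rw [mem_gridFinset] at hτ
        refine le_trans ?_ (modulus_two_pow_mul_le hf hp (32 * K) t₀)
        refine ENNReal.rpow_le_rpow (modulus_large_le (D := D) (τ := τ) (K := K)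
          inter_subset_right hm ?_) hp.le
        rw [grid_level hτ, mul_left_comm, hmt₀]
        have : ((32 * K : ℕ) : ℝ) ≤ 2 ^ (32 * K) := by
          exact_mod_cast (Nat.lt_two_pow_self (n := 32 * K)).le
        push_cast at this
        nlinarith
    _ = Λ ^ (32 * K) * ∑ τ ∈ gridFinset D ℓ,
          modulus m (ENNReal.ofReal p) f (domain D ∩ box D K τ) t₀ ^ p :=
        (Finset.mul_sum _ _ _).symm
    _ ≤ Λ ^ (32 * K) * (C₁ * modulus m (ENNReal.ofReal p) f (domain D) t ^ p) := by
        gcongr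
        refine (small f hf ℓ t₀ ht₀' hmt₀.le).trans ?_
        gcongr
        exact modulus_mono htt
    _ ≤ _ := by
        rw [← mul_assoc]
        exact mul_le_mul_left le_self_add _

/-! ### Besov seminorms -/

theorem besovSeminorm_rpow (hp : 0 < p) (α : ℝ) (G : Set Plane) :
    besovSeminorm α (ENNReal.ofReal p) (ENNReal.ofReal p) m f G ^ p =
      ∫⁻ t in Ioi (0 : ℝ), ENNReal.ofReal (t ^ (-α - 1 / p)) ^ p *
        modulus m (ENNReal.ofReal p) f G t ^ p := by
  rw [besovSeminorm, eLpNorm_eq_lintegral_rpow_enorm_toReal (by simpa using hp)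
    ENNReal.ofReal_ne_top, ENNReal.toReal_ofReal hp.le, ← ENNReal.rpow_mul, one_div,
    inv_mul_cancel₀ hp.ne', ENNReal.rpow_one]
  simp only [enorm_eq_self, ENNReal.mul_rpow_of_nonneg _ _ hp.le]

/-- This direction of additivity needs no measurability, so the moduli need not be shown measurable
in `t`. -/
theorem sum_lintegral_le {ι β : Type*} [MeasurableSpace β] (s : Finset ι) (F : ι → β → ℝ≥0∞)
    (μ : Measure β) : ∑ i ∈ s, ∫⁻ x, F i x ∂μ ≤ ∫⁻ x, ∑ i ∈ s, F i x ∂μ := by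
  classical
  induction s using Finset.induction_on with
  | empty => simp
  | insert i s hi ih =>
    simp only [Finset.sum_insert hi]
    exact (add_le_add le_rfl ih).trans (le_lintegral_add _ _)

/-- A difference samples finitely many translates, which preserve null sets. This permits replacing
`v` by a measurable representative. -/
theorem modulus_congr {G : Set Plane} (hG : IsOpen G) {g : Plane → ℝ}
    (h : ∀ᵐ x, x ∈ G → f x = g x) {q : ℝ≥0∞} (t : ℝ) :
    modulus m q f G t = modulus m q g G t := by
  refine iSup_congr fun u => iSup_congr fun _ => eLpNorm_congr_ae ?_
  have h1 : ∀ᵐ x, ∀ k ∈ Finset.range (m + 1), x + k • u ∈ G → f (x + k • u) = g (x + k • u) := by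
    rw [Finset.eventually_all]
    intro k _
    exact (measurePreserving_add_right (volume : Measure Plane) (k • u)).quasiMeasurePreserving.ae h
  filter_upwards [ae_restrict_of_ae h1,
    ae_restrict_mem (isOpen_diffDomain m u hG).measurableSet] with x hx hx'
  rw [fwdDiff_iter_eq_sum, fwdDiff_iter_eq_sum]
  refine Finset.sum_congr rfl fun k hk => ?_
  rw [hx k hk]
  rw [mem_diffDomain_iff] at hx'
  rw [Finset.mem_range] at hk
  rcases Nat.eq_zero_or_pos m with rfl | hm
  · simpa [show k = 0 by omega] using hx' 0 ⟨le_rfl, zero_le_one⟩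
  · have hm0 : (0 : ℝ) < m := by exact_mod_cast hm
    convert hx' (k / m) ⟨by positivity, by
      rw [div_le_one hm0]; exact_mod_cast (by omega : k ≤ m)⟩ using 2
    rw [← Nat.cast_smul_eq_nsmul ℝ m, smul_smul, div_mul_cancel₀ _ hm0.ne', Nat.cast_smul_eq_nsmul]

/-- The Besov seminorms on the boxes around the cells of one level sum up to at most the Besov
seminorm on the domain. -/
theorem exists_sum_besovSeminorm_le (D : GridDomain) (hm : 1 ≤ m) (hp : 0 < p) (α : ℝ) (K : ℕ) :
    ∃ C : ℝ≥0∞, C ≠ ∞ ∧ ∀ (v : Plane → ℝ),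
      AEStronglyMeasurable v (volume.restrict (domain D)) → ∀ ℓ : ℕ,
      ∑ τ ∈ gridFinset D ℓ,
        besovSeminorm α (ENNReal.ofReal p) (ENNReal.ofReal p) m v (domain D ∩ box D K τ) ^ p ≤
        C * besovSeminorm α (ENNReal.ofReal p) (ENNReal.ofReal p) m v (domain D) ^ p := by
  obtain ⟨C, hC, h⟩ := exists_sum_modulus_le D hm hp K
  refine ⟨C, hC, fun v hv ℓ => ?_⟩
  have hmeas : Measurable (hv.mk v) := hv.stronglyMeasurable_mk.measurable
  have hae : ∀ᵐ x, x ∈ domain D → v x = hv.mk v x :=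
    (ae_restrict_iff' (isOpen_domain D).measurableSet).1 hv.ae_eq_mk
  simp only [besovSeminorm_rpow hp]
  refine (sum_lintegral_le _ _ _).trans ?_
  rw [← lintegral_const_mul' _ _ hC]
  refine setLIntegral_mono' measurableSet_Ioi fun t ht => ?_
  rw [← Finset.mul_sum, mul_left_comm]
  gcongr
  rw [modulus_congr (isOpen_domain D) hae]
  refine le_trans (Finset.sum_le_sum fun τ _ => ?_) (h _ hmeas ℓ t ht)
  rw [modulus_congr ((isOpen_domain D).inter (isOpen_box D K τ))
    (hae.mono fun x hx hx' => hx hx'.1)]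

end AdaptiveSpline

namespace AdaptiveSpline

/-! ### Counting refined cells -/

variable {D : GridDomain} {m r : ℕ} {p : ℝ}

/-- The bounds balance where `4^(K(1+γ))` is about `X`. Below that level the growing bound is summed
and above it the decaying one; both geometric sums are comparable to `4^K`, hence to `X^(1/(1+γ))`.
-/
theorem sum_le_of_two_bounds {γ : ℝ} (hγ : 0 < γ) {b E X : ℝ} (hb : 0 ≤ b) (hE : 0 ≤ E)
    (hX : 0 ≤ X) (a : ℕ → ℝ) (h₁ : ∀ k, a k ≤ b * 4 ^ k)
    (h₂ : ∀ k, a k ≤ E * X * ((4 : ℝ) ^ (-γ)) ^ k) (M : ℕ) :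
    ∑ k ∈ Finset.range M, a k ≤
      (2 * b + 4 * (E / (1 - (4 : ℝ) ^ (-γ)))) * X ^ (1 / (1 + γ)) := by
  set q : ℝ := (4 : ℝ) ^ (-γ) with hq
  have hq0 : 0 < q := Real.rpow_pos_of_pos (by norm_num) _
  have hq1 : q < 1 := Real.rpow_lt_one_of_one_lt_of_neg (by norm_num) (by linarith)
  have hq2 : 0 < 1 - q := by linarith
  have hθ : 0 < 1 / (1 + γ) := by positivity
  rcases hX.eq_or_lt with rfl | hX
  · rw [Real.zero_rpow hθ.ne', mul_zero]
    refine Finset.sum_nonpos fun k _ => (h₂ k).trans ?_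
    simp
  have hex : ∃ K : ℕ, X ≤ (4 : ℝ) ^ ((K : ℝ) * (1 + γ)) := by
    obtain ⟨K, hK⟩ := pow_unbounded_of_one_lt X (show (1 : ℝ) < 4 by norm_num)
    refine ⟨K, hK.le.trans ?_⟩
    rw [← Real.rpow_natCast]
    exact Real.rpow_le_rpow_of_exponent_le (by norm_num)
      (le_mul_of_one_le_right (Nat.cast_nonneg K) (by linarith))
  classical
  set K := Nat.find hex with hKdef
  have hK : X ≤ (4 : ℝ) ^ ((K : ℝ) * (1 + γ)) := Nat.find_spec hex
  have hsplit : ∑ k ∈ Finset.range M, a k ≤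
      b * ∑ k ∈ Finset.range K, (4 : ℝ) ^ k + E * X * (q ^ K / (1 - q)) := by
    rw [← Finset.sum_filter_add_sum_filter_not (Finset.range M) (fun k => k < K)]
    refine add_le_add ?_ ?_
    · rw [Finset.mul_sum]
      refine (Finset.sum_le_sum fun k _ => h₁ k).trans ?_
      refine Finset.sum_le_sum_of_subset_of_nonneg (fun k hk => ?_) fun _ _ _ => by positivity
      simpa using (Finset.mem_filter.1 hk).2
    · refine (Finset.sum_le_sum fun k _ => h₂ k).trans ?_
      rw [← Finset.mul_sum]
      refine mul_le_mul_of_nonneg_left ?_ (by positivity)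
      refine le_trans (Finset.sum_le_sum_of_subset_of_nonneg (t := Finset.Ico K M)
        (fun k hk => ?_) fun _ _ _ => by positivity) (geom_sum_Ico_le_of_lt_one hq0.le hq1)
      simp only [Finset.mem_filter, Finset.mem_range] at hk
      rw [Finset.mem_Ico]; omega
  refine hsplit.trans ?_
  have hgeom : ∑ k ∈ Finset.range K, (4 : ℝ) ^ k = (4 ^ K - 1) / 3 := by
    rw [geom_sum_eq (by norm_num)]; norm_num
  rw [hgeom]
  have hE' : 0 ≤ E / (1 - q) := by positivity
  have hXθ : 0 ≤ X ^ (1 / (1 + γ)) := Real.rpow_nonneg hX.le _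
  -- For `K = 0` the growing part is empty and `X ≤ 1`, so `X` is below its own smaller power. For
  -- `K > 0`, minimality bounds `4^(K-1)`.
  rcases Nat.eq_zero_or_pos K with h0 | h0
  · rw [h0] at hK ⊢
    simp only [Nat.cast_zero, zero_mul, Real.rpow_zero] at hK
    have hXle : X ≤ X ^ (1 / (1 + γ)) := by
      have := Real.rpow_le_rpow_of_exponent_ge hX hK
        (show 1 / (1 + γ) ≤ 1 by rw [div_le_one (by positivity)]; linarith)
      rwa [Real.rpow_one] at this
    have e : E * X * (q ^ 0 / (1 - q)) = E / (1 - q) * X := by rw [pow_zero]; ring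
    rw [e, pow_zero]
    have h1 := mul_le_mul_of_nonneg_left hXle hE'
    have h2 := mul_nonneg hb hXθ
    have h3 := mul_nonneg hE' hXθ
    nlinarith
  · have hlt := Nat.find_min hex (show K - 1 < K by omega)
    push Not at hlt
    have h4 : (4 : ℝ) ^ (K - 1) ≤ X ^ (1 / (1 + γ)) := by
      have := Real.rpow_le_rpow (by positivity) hlt.le hθ.le
      rw [← Real.rpow_mul (by norm_num), mul_assoc, mul_one_div_cancel (by positivity), mul_one,
        Real.rpow_natCast] at this
      exact this
    have h5 : (4 : ℝ) ^ K = 4 * 4 ^ (K - 1) := by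
      rw [← pow_succ']; congr 1; omega
    have h6 : X * q ^ K ≤ 4 ^ K := by
      calc X * q ^ K ≤ (4 : ℝ) ^ ((K : ℝ) * (1 + γ)) * q ^ K :=
            mul_le_mul_of_nonneg_right hK (by positivity)
        _ = 4 ^ K := by
          rw [hq, ← Real.rpow_natCast, ← Real.rpow_natCast, ← Real.rpow_mul (by norm_num),
            ← Real.rpow_add (by norm_num)]
          congr 1
          ring
    have e : E * X * (q ^ K / (1 - q)) = E / (1 - q) * (X * q ^ K) := by ring
    rw [e]
    have h7 : E / (1 - q) * (X * q ^ K) ≤ E / (1 - q) * (4 * X ^ (1 / (1 + γ))) :=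
      mul_le_mul_of_nonneg_left (by linarith) hE'
    have h8 : b * ((4 ^ K - 1) / 3) ≤ b * (2 * X ^ (1 / (1 + γ))) :=
      mul_le_mul_of_nonneg_left (by linarith) hb
    linarith

/-- Measured in cells of level `k`, such a `σ` is within `r + 1` positions of the ancestor of `τ` in
each coordinate. -/
theorem card_nearTo_le {τ : Cell} {k : ℕ} (s : Finset Cell)
    (hs : ∀ σ ∈ s, σ.level = k ∧ NearTo r τ σ) : s.card ≤ (2 * r + 3) ^ 2 := by
  set S : Finset (Fin 2 → ℤ) := Fintype.piFinset fun i =>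
    Finset.Icc (τ.pos i / 2 ^ (τ.level - k) - (r + 1)) (τ.pos i / 2 ^ (τ.level - k) + (r + 1))
    with hS
  have hcard : S.card = (2 * r + 3) ^ 2 := by
    rw [hS, Fintype.card_piFinset, Fin.prod_univ_two, Int.card_Icc, Int.card_Icc, pow_two]
    congr 1 <;> omega
  rw [← hcard]
  refine Finset.card_le_card_of_injOn Cell.pos (fun σ hσ => ?_) fun σ hσ ρ hρ h => ?_
  · obtain ⟨rfl, j, hj, hd⟩ := hs σ hσ
    rw [hS, Finset.mem_coe, Fintype.mem_piFinset]
    intro i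
    have e : τ.level - σ.level = j := by omega
    rw [e, Finset.mem_Icc]
    have h1 := abs_le.1 (hd i)
    have hpos : (0 : ℤ) < 2 ^ j := by positivity
    have h2 := Int.mul_ediv_self_le (x := τ.pos i) (k := 2 ^ j) hpos.ne'
    have h3 := Int.lt_mul_ediv_self_add (x := τ.pos i) (k := 2 ^ j) hpos
    set y := τ.pos i / 2 ^ j
    constructor
    · refine le_of_mul_le_mul_left ?_ hpos
      nlinarith
    · refine Int.lt_add_one_iff.1 (lt_of_mul_lt_mul_left (a := (2 : ℤ) ^ j) ?_ hpos.le)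
      nlinarith
  · exact Cell.ext' ((hs σ hσ).1.trans (hs ρ hρ).1.symm) (congrFun h)

open Classical in
/-- The number of cells near the cells of a family, if the number of cells of each level in that
family decays geometrically. -/
theorem card_near_family_le {γ : ℝ} (hγ : 0 < γ) {X : ℝ} (hX : 0 ≤ X) {W : Cell → Prop}
    (hW : ∀ τ, W τ → τ ∈ grid D τ.level)
    (hcard : ∀ ℓ, (((gridFinset D ℓ).filter W).card : ℝ) ≤ X * ((4 : ℝ) ^ (-γ)) ^ ℓ)
    (s : Finset Cell) (hs : ∀ σ ∈ s, σ ∈ grid D σ.level ∧ ∃ τ, W τ ∧ NearTo r τ σ) :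
    (s.card : ℝ) ≤ (2 * D.base.card + 4 * (((2 * r + 3) ^ 2 : ℕ) / (1 - (4 : ℝ) ^ (-γ)) /
      (1 - (4 : ℝ) ^ (-γ)))) * X ^ (1 / (1 + γ)) := by
  set q : ℝ := (4 : ℝ) ^ (-γ) with hq
  have hq0 : 0 < q := Real.rpow_pos_of_pos (by norm_num) _
  have hq1 : q < 1 := Real.rpow_lt_one_of_one_lt_of_neg (by norm_num) (by linarith)
  have hq2 : 0 < 1 - q := by linarith
  choose! w hw using fun σ hσ => (hs σ hσ).2
  -- Only makes the sums over levels finite; the final bound is independent of `M`.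
  set M := s.sup (fun σ => (w σ).level) + 1 with hM
  have hlev : ∀ σ ∈ s, σ.level ≤ (w σ).level ∧ (w σ).level < M := by
    intro σ hσ
    obtain ⟨j, hj, -⟩ := (hw σ hσ).2
    exact ⟨by omega, Nat.lt_succ_of_le (Finset.le_sup (f := fun σ => (w σ).level) hσ)⟩
  have hsum : (s.card : ℝ) =
      ∑ k ∈ Finset.range M, ((s.filter fun σ => σ.level = k).card : ℝ) := by
    rw [Finset.card_eq_sum_card_fiberwise (f := Cell.level) (t := Finset.range M)]
    · push_cast; rfl
    · intro σ hσ
      have := hlev σ hσ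
      simp only [Finset.coe_range, mem_Iio]
      omega
  rw [hsum]
  refine sum_le_of_two_bounds hγ (Nat.cast_nonneg _) (by positivity) hX _ (fun k => ?_)
    (fun k => ?_) M
  · have h1 : (s.filter fun σ => σ.level = k) ⊆ gridFinset D k := by
      intro σ hσ
      rw [Finset.mem_filter] at hσ
      rw [mem_gridFinset, ← hσ.2]
      exact (hs σ hσ.1).1
    exact_mod_cast (Finset.card_le_card h1).trans (card_gridFinset_le D k)
  -- Sort the cells of level `k` by the level `ℓ ≥ k` of a responsible cell. Geometric decay in `ℓ`
  -- costs only a factor `1 / (1 - q)`.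
  · have h1 : (s.filter fun σ => σ.level = k) ⊆ (Finset.Ico k M).biUnion fun ℓ =>
        ((gridFinset D ℓ).filter W).biUnion fun τ =>
          s.filter fun σ => σ.level = k ∧ NearTo r τ σ := by
      intro σ hσ
      rw [Finset.mem_filter] at hσ
      have h2 := hlev σ hσ.1
      have h3 := hw σ hσ.1
      simp only [Finset.mem_biUnion, Finset.mem_filter, Finset.mem_Ico, mem_gridFinset]
      exact ⟨(w σ).level, ⟨by omega, h2.2⟩, w σ, ⟨hW _ h3.1, h3.1⟩, hσ.1, hσ.2, h3.2⟩
    have h2 : (s.filter fun σ => σ.level = k).card ≤ ∑ ℓ ∈ Finset.Ico k M,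
        ((gridFinset D ℓ).filter W).card * (2 * r + 3) ^ 2 := by
      refine (Finset.card_le_card h1).trans (Finset.card_biUnion_le.trans ?_)
      refine Finset.sum_le_sum fun ℓ _ => Finset.card_biUnion_le_card_mul _ _ _ fun τ _ => ?_
      exact card_nearTo_le (τ := τ) (k := k) _ fun σ hσ => (Finset.mem_filter.1 hσ).2
    calc ((s.filter fun σ => σ.level = k).card : ℝ)
        ≤ ∑ ℓ ∈ Finset.Ico k M, (((gridFinset D ℓ).filter W).card : ℝ) *
          ((2 * r + 3) ^ 2 : ℕ) := by exact_mod_cast h2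
      _ ≤ ∑ ℓ ∈ Finset.Ico k M, X * q ^ ℓ * ((2 * r + 3) ^ 2 : ℕ) :=
          Finset.sum_le_sum fun ℓ _ => mul_le_mul_of_nonneg_right (hcard ℓ) (Nat.cast_nonneg _)
      _ = X * ((2 * r + 3) ^ 2 : ℕ) * ∑ ℓ ∈ Finset.Ico k M, q ^ ℓ := by
          rw [Finset.mul_sum]
          exact Finset.sum_congr rfl fun ℓ _ => by ring
      _ ≤ X * ((2 * r + 3) ^ 2 : ℕ) * (q ^ k / (1 - q)) :=
          mul_le_mul_of_nonneg_left (geom_sum_Ico_le_of_lt_one hq0.le hq1) (by positivity)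
      _ = _ := by ring

/-! ### Cells with a large error -/

theorem exists_volume_cellSet_le (D : GridDomain) :
    ∃ V : ℝ, 0 < V ∧ ∀ τ, volume (cellSet D τ) ≤ ENNReal.ofReal (V * (1 / 4) ^ τ.level) := by
  have hh := D.h₀_pos
  set B := volume (Metric.closedBall (0 : Plane) 1) with hB
  have hB' : B ≠ ∞ := measure_closedBall_lt_top.ne
  refine ⟨(2 * D.h₀) ^ 2 * (B.toReal + 1), by positivity, fun τ => ?_⟩
  have hs := side_pos D τ.level
  set c : Plane := WithLp.toLp 2 fun i => D.origin i + side D τ.level * τ.pos i with hc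
  have hsub : cellSet D τ ⊆ Metric.closedBall c (2 * side D τ.level) := by
    intro x hx
    rw [Metric.mem_closedBall, dist_eq_norm, EuclideanSpace.norm_eq, Real.sqrt_le_iff,
      Fin.sum_univ_two]
    refine ⟨by positivity, ?_⟩
    have hi : ∀ i, ‖(x - c) i‖ ^ 2 ≤ side D τ.level ^ 2 := by
      intro i
      rw [Real.norm_eq_abs, sq_abs]
      obtain ⟨h1, h2⟩ := hx i
      simp only [hc, PiLp.sub_apply]
      nlinarith
    nlinarith [hi 0, hi 1]
  have hvol := Measure.addHaar_closedBall_mul (volume : Measure Plane) c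
    (show 0 ≤ 2 * side D τ.level by positivity) zero_le_one
  rw [mul_one, finrank_euclideanSpace_fin] at hvol
  refine (measure_mono hsub).trans ?_
  rw [hvol, ← hB, ← ENNReal.ofReal_toReal hB', ← ENNReal.ofReal_mul (by positivity)]
  refine ENNReal.ofReal_le_ofReal ?_
  have e : (2 * side D τ.level) ^ 2 = (2 * D.h₀) ^ 2 * (1 / 4) ^ τ.level := by
    rw [side, mul_pow, mul_pow, div_pow, ← pow_mul, mul_comm τ.level 2, pow_mul, div_pow, one_pow]
    norm_num
    ring
  rw [e, ENNReal.toReal_ofReal ENNReal.toReal_nonneg]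
  have h1 : (0 : ℝ) ≤ (2 * D.h₀) ^ 2 * (1 / 4) ^ τ.level := by positivity
  have h2 : (0 : ℝ) ≤ B.toReal := ENNReal.toReal_nonneg
  rw [mul_right_comm _ (B.toReal + 1)]
  exact mul_le_mul_of_nonneg_left (by linarith) h1

/-- The cells of the uniform meshes near which the function `v` is not yet resolved. -/
def IsUnresolved (D : GridDomain) (α p δ : ℝ) (m : ℕ) (v : Plane → ℝ) (ε : ℝ) (K : ℕ) (τ : Cell) :
    Prop :=
  τ ∈ grid D τ.level ∧ ENNReal.ofReal ε < volume (cellSet D τ) ^ δ *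
    besovSeminorm α (ENNReal.ofReal p) (ENNReal.ofReal p) m v (domain D ∩ box D K τ)

-- Chebyshev's inequality on one level: each counted cell contributes more than `ε^p` to the
-- weighted sum of local seminorms, and the weight `|τ|^(δp)` produces the decay in `ℓ`.
open Classical in
theorem exists_card_unresolved_le (D : GridDomain) (hm : 1 ≤ m) (hp : 0 < p) (α : ℝ) {δ : ℝ}
    (hδ : 0 < δ) (K : ℕ) :
    ∃ A : ℝ, 0 ≤ A ∧ ∀ v : Plane → ℝ,
      MemBesov α (ENNReal.ofReal p) (ENNReal.ofReal p) m v (domain D) → ∀ ε : ℝ, 0 < ε → ∀ ℓ : ℕ,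
      (((gridFinset D ℓ).filter (IsUnresolved D α p δ m v ε K)).card : ℝ) ≤
        A * (besovSeminorm α (ENNReal.ofReal p) (ENNReal.ofReal p) m v (domain D)).toReal ^ p *
          ε ^ (-p) * ((4 : ℝ) ^ (-(δ * p))) ^ ℓ := by
  obtain ⟨C, hC, hsum⟩ := exists_sum_besovSeminorm_le D hm hp α K
  obtain ⟨V, hV, hvol⟩ := exists_volume_cellSet_le D
  refine ⟨V ^ (δ * p) * C.toReal, by positivity, fun v hv ε hε ℓ => ?_⟩
  set S := besovSeminorm α (ENNReal.ofReal p) (ENNReal.ofReal p) m v (domain D) with hS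
  have hS' : S ≠ ∞ := hv.2.ne
  have hδp : 0 < δ * p := mul_pos hδ hp
  set F := (gridFinset D ℓ).filter (IsUnresolved D α p δ m v ε K) with hF
  have hx : 0 < V * (1 / 4) ^ ℓ := by positivity
  have key : (F.card : ℝ≥0∞) * ENNReal.ofReal (ε ^ p) ≤
      ENNReal.ofReal ((V * (1 / 4) ^ ℓ) ^ (δ * p)) * (C * S ^ p) := by
    calc (F.card : ℝ≥0∞) * ENNReal.ofReal (ε ^ p)
        = ∑ τ ∈ F, ENNReal.ofReal (ε ^ p) := by rw [Finset.sum_const, nsmul_eq_mul]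
      _ ≤ ∑ τ ∈ F, ENNReal.ofReal ((V * (1 / 4) ^ ℓ) ^ (δ * p)) *
          besovSeminorm α (ENNReal.ofReal p) (ENNReal.ofReal p) m v
            (domain D ∩ box D K τ) ^ p := by
          refine Finset.sum_le_sum fun τ hτ => ?_
          rw [hF, Finset.mem_filter, mem_gridFinset] at hτ
          obtain ⟨hg, -, hlt⟩ := hτ
          have h1 := hvol τ
          rw [grid_level hg] at h1
          rw [← ENNReal.ofReal_rpow_of_pos hε, ← ENNReal.ofReal_rpow_of_pos hx, ENNReal.rpow_mul,
            ← ENNReal.mul_rpow_of_nonneg _ _ hp.le]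
          refine ENNReal.rpow_le_rpow (hlt.le.trans ?_) hp.le
          gcongr
      _ = ENNReal.ofReal ((V * (1 / 4) ^ ℓ) ^ (δ * p)) * ∑ τ ∈ F,
          besovSeminorm α (ENNReal.ofReal p) (ENNReal.ofReal p) m v
            (domain D ∩ box D K τ) ^ p := (Finset.mul_sum _ _ _).symm
      _ ≤ _ := by
          gcongr
          refine le_trans (Finset.sum_le_sum_of_subset (Finset.filter_subset _ _)) ?_
          exact hsum v hv.1.1 ℓ
  have hfin : ENNReal.ofReal ((V * (1 / 4) ^ ℓ) ^ (δ * p)) * (C * S ^ p) ≠ ∞ :=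
    ENNReal.mul_ne_top ENNReal.ofReal_ne_top
      (ENNReal.mul_ne_top hC (ENNReal.rpow_ne_top_of_nonneg hp.le hS'))
  have hreal := ENNReal.toReal_mono hfin key
  rw [ENNReal.toReal_mul, ENNReal.toReal_mul, ENNReal.toReal_mul, ENNReal.toReal_natCast,
    ENNReal.toReal_ofReal (by positivity), ENNReal.toReal_ofReal (by positivity),
    ← ENNReal.toReal_rpow] at hreal
  have e1 : (V * (1 / 4) ^ ℓ) ^ (δ * p) = V ^ (δ * p) * ((4 : ℝ) ^ (-(δ * p))) ^ ℓ := by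
    rw [Real.mul_rpow hV.le (by positivity), ← Real.rpow_natCast, ← Real.rpow_natCast,
      ← Real.rpow_mul (by norm_num), ← Real.rpow_mul (by norm_num), one_div,
      Real.inv_rpow (by norm_num), ← Real.rpow_neg (by norm_num)]
    congr 2
    ring
  rw [e1] at hreal
  have hεp : 0 < ε ^ p := Real.rpow_pos_of_pos hε p
  rw [← le_div_iff₀ hεp] at hreal
  refine hreal.trans (le_of_eq ?_)
  rw [Real.rpow_neg hε.le]
  ring

/-! ### The adaptive procedure -/

/-- Treats both choices of `ω` at once and removes the dependence of the error on the current
partition. -/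
theorem subset_domain_inter_box (hr : 1 ≤ r) {ω : Finset Cell → Cell → Set Plane}
    (hω : ω = (fun _ τ => cellSet D τ) ∨ ω = (fun P τ => patch D r P τ)) {P : Finset Cell}
    (hP : IsPartition D P) (hA : TreeAdmissible D r P) {τ : Cell} (hτ : τ ∈ P) :
    ω P τ ⊆ domain D ∩ box D (2 * r + 6 : ℕ) τ := by
  push_cast
  rcases hω with rfl | rfl
  · refine subset_inter (cellSet_subset_domain (hP.1 τ hτ)) (cellSet_subset_box ?_ τ)
    have : (0 : ℝ) ≤ r := Nat.cast_nonneg r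
    linarith
  · exact subset_inter (patch_subset_domain hP τ)
      (patch_subset_box hr hP (hP.strictlyAdmissible_iff.2 hA) hτ)

variable {enum : Finset Cell → List Cell} {ω : Finset Cell → Cell → Set Plane}
  {α δ : ℝ} {v : Plane → ℝ} {ε : ℝ} {P₀ : Finset Cell}

theorem mem_marked {P : Finset Cell} {τ : Cell} : τ ∈ marked D ω α p δ m v ε P ↔
    τ ∈ P ∧ ENNReal.ofReal ε < cellError D ω α p δ m v P τ := by
  simp [marked]

theorem isUnresolved_of_marked (hr : 1 ≤ r)
    (hω : ω = (fun _ τ => cellSet D τ) ∨ ω = (fun P τ => patch D r P τ)) {P : Finset Cell}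
    (hP : IsPartition D P) (hA : TreeAdmissible D r P) {τ : Cell}
    (hτ : τ ∈ marked D ω α p δ m v ε P) : IsUnresolved D α p δ m v ε (2 * r + 6) τ := by
  obtain ⟨h1, h2⟩ := mem_marked.1 hτ
  exact ⟨hP.1 τ h1, h2.trans_le
    (mul_le_mul_right (besovSeminorm_mono (subset_domain_inter_box hr hω hP hA h1)) _)⟩

/-- The property of newly refined cells does not mention the step, so it can be carried through the
whole iteration and counted once at the end. -/
theorem refines_adaptiveSeq (hr : 1 ≤ r)
    (hω : ω = (fun _ τ => cellSet D τ) ∨ ω = (fun P τ => patch D r P τ))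
    (he : ∀ s : Finset Cell, (enum s : Multiset Cell) = s.val) (hP₀ : IsPartition D P₀)
    (hA₀ : TreeAdmissible D r P₀) (n : ℕ) :
    Refines D r (fun σ => ∃ τ, IsUnresolved D α p δ m v ε (2 * r + 6) τ ∧ NearTo r τ σ) P₀
      (adaptiveSeq D r enum ω α p δ m v ε P₀ n) := by
  induction n with
  | zero => exact Refines.rfl' hP₀ hA₀
  | succ n ih =>
    refine ih.trans (refines_refine he ih.isPartition ih.treeAdmissible
      (fun τ hτ => (mem_marked.1 hτ).1) fun τ hτ σ hσ => ⟨τ, ?_, hσ⟩).1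
    exact isUnresolved_of_marked hr hω ih.isPartition ih.treeAdmissible hτ

theorem card_ancestors_lt (he : ∀ s : Finset Cell, (enum s : Multiset Cell) = s.val)
    {P : Finset Cell} (hP : IsPartition D P) (hA : TreeAdmissible D r P) {M : Finset Cell}
    (hM : M ⊆ P) (hne : M ≠ ∅) :
    (ancestors P).card < (ancestors (refine D r enum P M)).card := by
  obtain ⟨h1, h2⟩ := refines_refine he (W := fun _ => True) hP hA hM fun _ _ _ _ => trivial
  obtain ⟨τ, hτ⟩ := Finset.nonempty_iff_ne_empty.2 hne
  refine Finset.card_lt_card ((Finset.ssubset_iff_of_subset h1.ancestors_subset).2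
    ⟨τ, h2 hτ, hP.notMem_ancestors (hM hτ)⟩)

end AdaptiveSpline

/-! ### The adaptive procedure: termination, admissibility and the two bounds -/

open AdaptiveSpline in
theorem mainTheorem7 (D : GridDomain) (r m : ℕ) (hr : 2 ≤ r) (hm : 1 ≤ m)
    (α p δ : ℝ) (hα : 0 ≤ α) (hp : 0 < p) (hδ : 0 < δ)
    (P₀ : Finset Cell) (hP₀ : IsPartition D P₀) (hP₀' : IsStrictlyAdmissible D r P₀)
    (ω : Finset Cell → Cell → Set Plane)
    (hω : ω = (fun _ τ => cellSet D τ) ∨ ω = (fun P τ => patch D r P τ)) :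
    ∃ C : ℝ, 0 < C ∧
      ∀ v : Plane → ℝ,
        MemBesov α (ENNReal.ofReal p) (ENNReal.ofReal p) m v (domain D) →
      ∀ ε : ℝ, 0 < ε →
      ∀ enum : Finset Cell → List Cell, (∀ s : Finset Cell, (enum s : Multiset Cell) = s.val) →
      ∃ L : ℕ,
        (∀ n < L, marked D ω α p δ m v ε (adaptiveSeq D r enum ω α p δ m v ε P₀ n) ≠ ∅) ∧
        marked D ω α p δ m v ε (adaptiveSeq D r enum ω α p δ m v ε P₀ L) = ∅ ∧
        IsPartition D (adaptiveSeq D r enum ω α p δ m v ε P₀ L) ∧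
        IsAdmissible D r (adaptiveSeq D r enum ω α p δ m v ε P₀ L) ∧
        ∑ τ ∈ adaptiveSeq D r enum ω α p δ m v ε P₀ L,
            cellError D ω α p δ m v (adaptiveSeq D r enum ω α p δ m v ε P₀ L) τ ^ 2 ≤
          ENNReal.ofReal (C * (adaptiveSeq D r enum ω α p δ m v ε P₀ L).card * ε ^ 2) ∧
        ((adaptiveSeq D r enum ω α p δ m v ε P₀ L).card : ℝ) - P₀.card ≤
          C * (besovSeminorm α (ENNReal.ofReal p) (ENNReal.ofReal p) m v (domain D)).toReal
              ^ (p / (1 + δ * p)) * ε ^ (-(p / (1 + δ * p))) := by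
  classical
  have hA₀ := hP₀.strictlyAdmissible_iff.1 hP₀'
  have hr1 : 1 ≤ r := by omega
  have hδp : 0 < δ * p := mul_pos hδ hp
  obtain ⟨A, hA, hcard⟩ := exists_card_unresolved_le D hm hp α hδ (2 * r + 6)
  have hq : 0 < 1 - (4 : ℝ) ^ (-(δ * p)) :=
    sub_pos.2 (Real.rpow_lt_one_of_one_lt_of_neg (by norm_num) (by linarith))
  set B : ℝ := 2 * D.base.card + 4 * (((2 * r + 3) ^ 2 : ℕ) / (1 - (4 : ℝ) ^ (-(δ * p))) /
      (1 - (4 : ℝ) ^ (-(δ * p)))) with hB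
  have hB0 : 0 ≤ B := by positivity
  -- The `1` serves the bound on the squared errors; the `3` is the number of cells gained per
  -- split.
  refine ⟨1 + 3 * B * A ^ (1 / (1 + δ * p)), by positivity, fun v hv ε hε enum he => ?_⟩
  set S := (besovSeminorm α (ENNReal.ofReal p) (ENNReal.ofReal p) m v (domain D)).toReal with hS
  have hS0 : 0 ≤ S := ENNReal.toReal_nonneg
  set P := adaptiveSeq D r enum ω α p δ m v ε P₀ with hPdef
  have href := fun n => refines_adaptiveSeq (ω := ω) (α := α) (p := p) (δ := δ) (m := m) (v := v)
    (ε := ε) hr1 hω he hP₀ hA₀ n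
  set Z := S ^ (p / (1 + δ * p)) * ε ^ (-(p / (1 + δ * p))) with hZ
  have hZ0 : 0 ≤ Z := by positivity
  have hnew : ∀ n, ((ancestors (P n)).card : ℝ) ≤
      (ancestors P₀).card + B * A ^ (1 / (1 + δ * p)) * Z := by
    intro n
    have h1 := card_near_family_le (D := D) (r := r) hδp (X := A * S ^ p * ε ^ (-p))
      (by positivity) (W := IsUnresolved D α p δ m v ε (2 * r + 6)) (fun τ hτ => hτ.1)
      (hcard v hv ε hε) (ancestors (P n) \ ancestors P₀) (fun σ hσ => by
        rw [Finset.mem_sdiff] at hσ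
        refine ⟨(href n).isPartition.inTree_grid (inTree_iff.2 (Or.inr hσ.1)),
          (href n).new σ hσ.1 hσ.2⟩)
    have h2 : (A * S ^ p * ε ^ (-p)) ^ (1 / (1 + δ * p)) = A ^ (1 / (1 + δ * p)) * Z := by
      rw [Real.mul_rpow (by positivity) (by positivity), Real.mul_rpow hA (by positivity),
        ← Real.rpow_mul hS0, ← Real.rpow_mul hε.le, hZ, mul_assoc]
      congr 4 <;> ring
    rw [h2, ← hB, ← mul_assoc] at h1
    have h3 := Finset.card_sdiff_add_card_eq_card (href n).ancestors_subset
    have h4 : ((ancestors (P n)).card : ℝ) =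
        (ancestors (P n) \ ancestors P₀).card + (ancestors P₀).card := by exact_mod_cast h3.symm
    linarith
  -- Without a stop the number of strict ancestors would grow at every step, against the uniform
  -- bound `hnew`.
  have hterm : ∃ L, marked D ω α p δ m v ε (P L) = ∅ := by
    by_contra! hne
    have hgrow : ∀ n, n ≤ (ancestors (P n)).card := by
      intro n
      induction n with
      | zero => exact Nat.zero_le _
      | succ n ih =>
        exact lt_of_le_of_lt ih (card_ancestors_lt he (href n).isPartition (href n).treeAdmissible
          (fun τ hτ => (mem_marked.1 hτ).1) (hne n).ne_empty)
    obtain ⟨n, hn⟩ := exists_nat_gt ((ancestors P₀).card + B * A ^ (1 / (1 + δ * p)) * Z)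
    have h1 : (n : ℝ) ≤ (ancestors (P n)).card := by exact_mod_cast hgrow n
    linarith [hnew n]
  refine ⟨Nat.find hterm, fun n hn => Nat.find_min hterm hn, Nat.find_spec hterm,
    (href _).isPartition, ?_, ?_, ?_⟩
  · exact ((href _).isPartition.strictlyAdmissible_iff.2 (href _).treeAdmissible).isAdmissible hr1
      (href _).isPartition
  · have hspec := Nat.find_spec hterm
    set Q := P (Nat.find hterm)
    have hle : ∀ τ ∈ Q, cellError D ω α p δ m v Q τ ^ 2 ≤ ENNReal.ofReal (ε ^ 2) := by
      intro τ hτ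
      rw [ENNReal.ofReal_pow hε.le]
      gcongr
      by_contra hlt
      have : τ ∈ marked D ω α p δ m v ε Q := mem_marked.2 ⟨hτ, not_le.1 hlt⟩
      rw [hspec] at this
      simp at this
    refine (Finset.sum_le_card_nsmul _ _ _ hle).trans ?_
    rw [nsmul_eq_mul, ← ENNReal.ofReal_natCast, ← ENNReal.ofReal_mul (Nat.cast_nonneg _)]
    refine ENNReal.ofReal_le_ofReal ?_
    rw [mul_assoc]
    refine le_mul_of_one_le_left (by positivity) ?_
    have : 0 ≤ 3 * B * A ^ (1 / (1 + δ * p)) := by positivity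
    linarith
  · have h1 := (href (Nat.find hterm)).card_le
    have h2 := hnew (Nat.find hterm)
    have h3 : ((P (Nat.find hterm)).card : ℝ) + 3 * (ancestors P₀).card ≤
        P₀.card + 3 * (ancestors (P (Nat.find hterm))).card := by exact_mod_cast h1
    rw [mul_assoc, ← hZ]
    nlinarith
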